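/- An \emph{orthogonal polygon, possibly with holes}, is a compact set $P\subset\mathbb{R}^2$ with connected interior and $P=\overline{\operatorname{int}P}$ whose boundary is the union of finitely many pairwise disjoint simple closed polygonal curves all of whose edges are axis-parallel; its vertices are the vertices of these curves. A \emph{sliding camera} is a nondegenerate axis-parallel line segment $s\subseteq P$ (its trajectory); it \emph{sees} a point $p\in P$ if there is a point $q\in s$ such that the segment $pq$ is normal to $s$ and contained in $P$ (where $p=q$ is allowed). A finite set $T$ of sliding cameras is a \emph{cover} of $P$ if every point of $P$ is seen by some camera in $T$, and an \emph{optimal cover} if, in addition, the total length $\sum_{s\in T}\operatorname{length}(s)$ is minimum among all covers of $P$. \textbf{Theorem.} There is an algorithm that, given an orthogonal polygon $P$ with $n$ vertices, possibly with holes, finds an optimal cover of $P$ in time polynomial in $n$. Here $P$ is given by the real coordinates of its vertices, listed in cyclic order along each boundary curve, and the algorithm is a single program for a real RAM with indirectly addressed integer and real memory whose arithmetic operations are addition, (truncated) subtraction and comparison of natural numbers, and addition, subtraction and comparison of real numbers; each operation and each memory access costs one unit of time. The output is the list, without repetition, of the endpoint pairs of the segments of an optimal cover. -/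

import Mathlib

/-! ## Orthogonal polygons, possibly with holes -/

/-- Points of the plane. Only the affine structure and the topology of `ℝ × ℝ` are used, never its
norm; lengths are defined explicitly below. -/
abbrev Point : Type := ℝ × ℝ

/-- The `i`-th vertex of a cyclic sequence of points (indices are read modulo the length). -/
def cycleVertex (c : List Point) (i : ℕ) : Point := c.getD (i % c.length) 0

/-- The `i`-th edge of a cyclic sequence of points: the closed segment from the `i`-th vertex to the
next one. -/
def cycleEdge (c : List Point) (i : ℕ) : Set Point :=
  segment ℝ (cycleVertex c i) (cycleVertex c (i + 1))

/-- The closed polygonal curve traced by a cyclic sequence of points. -/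
def cycleCurve (c : List Point) : Set Point :=
  {p | ∃ i < c.length, p ∈ cycleEdge c i}

/-- `c` lists, in cyclic order, the vertices of a simple closed polygonal curve all of whose edges
are nondegenerate and axis-parallel: two different edges meet at most in a vertex that is the end of
one and the beginning of the other. -/
structure IsSimpleOrthogonalCycle (c : List Point) : Prop where
  four_le : 4 ≤ c.length
  ne : ∀ i < c.length, cycleVertex c i ≠ cycleVertex c (i + 1)
  axisParallel : ∀ i < c.length, (cycleVertex c i).1 = (cycleVertex c (i + 1)).1 ∨
    (cycleVertex c i).2 = (cycleVertex c (i + 1)).2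
  simple : ∀ i < c.length, ∀ j < c.length, i ≠ j → ∀ p ∈ cycleEdge c i, p ∈ cycleEdge c j →
    (j = (i + 1) % c.length ∧ p = cycleVertex c j) ∨
    (i = (j + 1) % c.length ∧ p = cycleVertex c i)

/-- `P` is an orthogonal polygon, possibly with holes, and `B` lists its boundary cycles (the outer
boundary and the boundaries of the holes, in any order and with any orientation).
`P` is the closed bounded region with connected interior whose boundary consists of the pairwise
disjoint simple closed orthogonal curves in `B`. The condition `closure (interior P) = P` says that
`P` has no lower-dimensional parts. -/
structure IsOrthogonalPolygon (P : Set Point) (B : List (List Point)) : Prop where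
  isCompact : IsCompact P
  isConnected_interior : IsConnected (interior P)
  closure_interior : closure (interior P) = P
  cycles : ∀ c ∈ B, IsSimpleOrthogonalCycle c
  pairwise_disjoint : B.Pairwise fun c d => Disjoint (cycleCurve c) (cycleCurve d)
  frontier_eq : frontier P = {p | ∃ c ∈ B, p ∈ cycleCurve c}

/-- The number of vertices of a polygon given by its boundary cycles. -/
def numVertices (B : List (List Point)) : ℕ := (B.map List.length).sum

/-! ## Sliding cameras -/

/-- The trajectory of a camera, given by its two endpoints. -/
abbrev Seg : Type := Point × Point

/-- `s` is a (nondegenerate) orthogonal line segment, with its endpoints given in increasing order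
(so that every orthogonal segment is represented exactly once). -/
def Seg.IsOrthogonal (s : Seg) : Prop :=
  (s.1.1 = s.2.1 ∧ s.1.2 < s.2.2) ∨ (s.1.2 = s.2.2 ∧ s.1.1 < s.2.1)

/-- The set of points of a segment. -/
def Seg.carrier (s : Seg) : Set Point := segment ℝ s.1 s.2

/-- The Euclidean length of a segment. -/
noncomputable def Seg.length (s : Seg) : ℝ :=
  √((s.2.1 - s.1.1) ^ 2 + (s.2.2 - s.1.2) ^ 2)

/-- The camera travelling along `s` sees `p` within `P`: there is a point `q` of `s` such that `pq`
is normal to `s` and is contained in `P`. (For `p` on `s` one may take `q = p`.) -/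
def Seg.Sees (P : Set Point) (s : Seg) (p : Point) : Prop :=
  ∃ q ∈ s.carrier,
    (p.1 - q.1) * (s.2.1 - s.1.1) + (p.2 - q.2) * (s.2.2 - s.1.2) = 0 ∧ segment ℝ p q ⊆ P

/-- `T` is a cover of `P`: a finite set of orthogonal segments contained in `P` whose cameras
together see every point of `P`. -/
structure IsCover (P : Set Point) (T : Finset Seg) : Prop where
  isOrthogonal : ∀ s ∈ T, s.IsOrthogonal
  subset : ∀ s ∈ T, s.carrier ⊆ P
  sees : ∀ p ∈ P, ∃ s ∈ T, s.Sees P p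

/-- The total length of the trajectories in `T`. -/
noncomputable def totalLength (T : Finset Seg) : ℝ := ∑ s ∈ T, s.length

/-- `T` is an optimal cover of `P`: a cover of minimum total length among all covers of `P`. -/
def IsOptimalCover (P : Set Point) (T : Finset Seg) : Prop :=
  IsCover P T ∧ ∀ T' : Finset Seg, IsCover P T' → totalLength T ≤ totalLength T'

/-! ## The machine model

A random access machine on natural numbers and real numbers, programmed by while-programs. A program
uses a fixed finite number of unbounded arrays of naturals and of reals; array cells are addressed by
(computed) naturals. The operations on naturals are addition, truncated subtraction and comparison,
those on reals are addition, subtraction and comparison. Every operation, memory access, constant and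
control step costs one unit of time. There is no multiplication (neither on naturals nor on reals)
and no conversion between reals and naturals, so this is a restriction of the usual real RAM. -/

namespace RealRAM

/-- Memory contents: `nat k i` (`real k i`) is cell `i` of the `k`-th array of naturals (reals). -/
structure State where
  nat : ℕ → ℕ → ℕ
  real : ℕ → ℕ → ℝ

/-- Write `v` into cell `i` of the `k`-th array of naturals. -/
def State.setNat (σ : State) (k i v : ℕ) : State :=
  { σ with nat := Function.update σ.nat k (Function.update (σ.nat k) i v) }

/-- Write `v` into cell `i` of the `k`-th array of reals. -/
noncomputable def State.setReal (σ : State) (k i : ℕ) (v : ℝ) : State :=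
  { σ with real := Function.update σ.real k (Function.update (σ.real k) i v) }

/-- Expressions with values in the naturals; `get k e` reads the cell with address `e` of array `k`. -/
inductive NatExpr where
  | lit (m : ℕ)
  | get (k : ℕ) (e : NatExpr)
  | add (a b : NatExpr)
  | sub (a b : NatExpr)

def NatExpr.eval (σ : State) : NatExpr → ℕ
  | .lit m => m
  | .get k e => σ.nat k (e.eval σ)
  | .add a b => a.eval σ + b.eval σ
  | .sub a b => a.eval σ - b.eval σ

/-- The time needed to evaluate an expression: the number of its nodes. -/
def NatExpr.cost : NatExpr → ℕ
  | .lit _ => 1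
  | .get _ e => e.cost + 1
  | .add a b => a.cost + b.cost + 1
  | .sub a b => a.cost + b.cost + 1

/-- Expressions with values in the reals. -/
inductive RealExpr where
  | zero
  | one
  | get (k : ℕ) (e : NatExpr)
  | add (a b : RealExpr)
  | sub (a b : RealExpr)

noncomputable def RealExpr.eval (σ : State) : RealExpr → ℝ
  | .zero => 0
  | .one => 1
  | .get k e => σ.real k (e.eval σ)
  | .add a b => a.eval σ + b.eval σ
  | .sub a b => a.eval σ - b.eval σ

def RealExpr.cost : RealExpr → ℕ
  | .zero => 1
  | .one => 1
  | .get _ e => e.cost + 1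
  | .add a b => a.cost + b.cost + 1
  | .sub a b => a.cost + b.cost + 1

/-- Tests. -/
inductive Test where
  | natEq (a b : NatExpr)
  | natLt (a b : NatExpr)
  | realEq (a b : RealExpr)
  | realLt (a b : RealExpr)
  | not (b : Test)
  | and (b c : Test)

def Test.Holds (σ : State) : Test → Prop
  | .natEq a b => a.eval σ = b.eval σ
  | .natLt a b => a.eval σ < b.eval σ
  | .realEq a b => a.eval σ = b.eval σ
  | .realLt a b => a.eval σ < b.eval σ
  | .not b => ¬ b.Holds σ
  | .and b c => b.Holds σ ∧ c.Holds σ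

def Test.cost : Test → ℕ
  | .natEq a b => a.cost + b.cost + 1
  | .natLt a b => a.cost + b.cost + 1
  | .realEq a b => a.cost + b.cost + 1
  | .realLt a b => a.cost + b.cost + 1
  | .not b => b.cost + 1
  | .and b c => b.cost + c.cost + 1

/-- Programs; `setNat k i e` stores the value of `e` in cell `i` of the `k`-th array of naturals. -/
inductive Prog where
  | skip
  | setNat (k : ℕ) (i e : NatExpr)
  | setReal (k : ℕ) (i : NatExpr) (e : RealExpr)
  | seq (p q : Prog)
  | branch (b : Test) (p q : Prog)
  | loop (b : Test) (p : Prog)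

/-- `Exec p σ τ t`: started in state `σ`, the program `p` halts in state `τ` after exactly `t` units
of time. -/
inductive Exec : Prog → State → State → ℕ → Prop
  | skip (σ : State) : Exec .skip σ σ 1
  | setNat (σ : State) (k : ℕ) (i e : NatExpr) :
      Exec (.setNat k i e) σ (σ.setNat k (i.eval σ) (e.eval σ)) (i.cost + e.cost + 1)
  | setReal (σ : State) (k : ℕ) (i : NatExpr) (e : RealExpr) :
      Exec (.setReal k i e) σ (σ.setReal k (i.eval σ) (e.eval σ)) (i.cost + e.cost + 1)
  | seq {p q : Prog} {σ τ υ : State} {t u : ℕ} (hp : Exec p σ τ t) (hq : Exec q τ υ u) :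
      Exec (.seq p q) σ υ (t + u)
  | branchTrue {b : Test} {p q : Prog} {σ τ : State} {t : ℕ} (hb : b.Holds σ)
      (hp : Exec p σ τ t) : Exec (.branch b p q) σ τ (b.cost + t + 1)
  | branchFalse {b : Test} {p q : Prog} {σ τ : State} {t : ℕ} (hb : ¬ b.Holds σ)
      (hq : Exec q σ τ t) : Exec (.branch b p q) σ τ (b.cost + t + 1)
  | loopFalse {b : Test} {p : Prog} {σ : State} (hb : ¬ b.Holds σ) :
      Exec (.loop b p) σ σ (b.cost + 1)
  | loopTrue {b : Test} {p : Prog} {σ τ υ : State} {t u : ℕ} (hb : b.Holds σ)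
      (hp : Exec p σ τ t) (hl : Exec (.loop b p) τ υ u) :
      Exec (.loop b p) σ υ (b.cost + t + u + 1)

/-- The initial memory for a polygon with boundary cycles `B`: cell `0` of the natural array `0` holds
the number of cycles, the natural array `1` the numbers of vertices of the cycles, and the real
arrays `0` and `1` the `x`- and `y`-coordinates of the vertices, cycle after cycle. All other cells
hold `0`. -/
noncomputable def inputState (B : List (List Point)) : State where
  nat k i :=
    if k = 0 then (if i = 0 then B.length else 0)
    else if k = 1 then (B.map List.length).getD i 0
    else 0
  real k i :=
    if k = 0 then (B.flatten.map Prod.fst).getD i 0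
    else if k = 1 then (B.flatten.map Prod.snd).getD i 0
    else 0

/-- The list of segments that a final memory represents: cell `0` of the natural array `2` holds their
number, and cell `i` of the real arrays `2`, `3`, `4`, `5` the coordinates of the two endpoints of the
`i`-th segment. -/
def outputSegs (σ : State) : List Seg :=
  (List.range (σ.nat 2 0)).map fun i =>
    ((σ.real 2 i, σ.real 3 i), (σ.real 4 i, σ.real 5 i))

end RealRAM

/-!
The horizontal and vertical lines through the vertices of `P` divide it into at most `n ^ 2` grid
cells. Consider the maximal vertical and horizontal runs of cells contained in `P`. Every cell lies in
one run of each kind, and thus is an edge of a bipartite graph whose nodes are the runs. A vertical run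
of cells is guarded by a horizontal camera that extends over its width, so that every vertex cover of
the graph, weighted by widths, yields a cover of `P` of no greater length
(`IsGrid.isCover_of_isVertexCover`, `IsGrid.totalLength_le_weight`).

Conversely, a cover of `P` yields a vertex cover of no greater weight: take the vertical runs all of
whose vertical lines meet a horizontal camera, and the horizontal runs all of whose horizontal lines
meet a vertical camera. If a cell belonged to no such run, there would be a vertical and a horizontal
line through it that meet no such camera, and no camera would see their intersection. Since no vertical
line within `P` meets two vertical runs in the same column, the widths of the chosen runs add up to at
most the length of the cameras (`IsGrid.exists_vertexCover_weight_le`, `sum_width_le_sum_length`).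
Hence a minimum-weight vertex cover gives an optimal cover.

A minimum-weight vertex cover is found by a push-relabel method with additions, subtractions and
comparisons of reals only (`BipartiteGraph.round`). Labels are bounded by `2 * K + 2`, where `K` bounds
the number of nodes on each side. A potential of order `K ^ 4` decreases in every round until all
excess is at nodes of maximum label (`BipartiteGraph.round_spec`). There is then a positive label `g`
that no node has. The left nodes below `g` and the right nodes above `g` are a vertex cover, and the
preflow certifies that it has minimum weight (`BipartiteGraph.weight_gap_le`).

Which cells are contained in `P` is decided from bottom to top: membership changes exactly where the
common side of two cells lies on the boundary (`IsBoundary.inCell_iff`). This holds because `P` is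
bounded and the closure of its interior; the Jordan curve theorem is not needed.

The algorithm is composed of for-programs, whose loops run up to bounds fixed in advance. They have a
denotation (`ForProg.den`), which is used for the correctness proof, and a running time that is
polynomial in the bounds of the loops (`ForProg.exists_exec`). The bounds are the number of cycles, `n`,
`K = n ^ 2` and `2 * K + 2`.
-/

open RealRAM

/-! ### For-programs -/

/-- The array of naturals that holds the bounds of the for-loops. -/
notation "bnd" => (10 : ℕ)

/-- The array of naturals that holds the counters of the for-loops. -/
notation "ctr" => (11 : ℕ)

/-- Programs whose only loops are for-loops. In `loop v b p` the counter, cell `v` of the array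
`ctr`, runs from `0` to the value of cell `b` of the array `bnd`. -/
inductive ForProg where
  | skip
  | setNat (k : ℕ) (i e : NatExpr)
  | setReal (k : ℕ) (i : NatExpr) (e : RealExpr)
  | seq (p q : ForProg)
  | branch (b : Test) (p q : ForProg)
  | loop (v b : ℕ) (p : ForProg)

namespace ForProg

/-- Translation into while-programs. -/
def toProg : ForProg → Prog
  | skip => .skip
  | setNat k i e => .setNat k i e
  | setReal k i e => .setReal k i e
  | seq p q => .seq p.toProg q.toProg
  | branch b p q => .branch b p.toProg q.toProg
  | loop v b p => .seq (.setNat ctr (.lit v) (.lit 0))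
      (.loop (.natLt (.get ctr (.lit v)) (.get bnd (.lit b)))
        (.seq p.toProg (.setNat ctr (.lit v) (.add (.get ctr (.lit v)) (.lit 1)))))

open Classical in
/-- The state transformation computed by a for-program. -/
noncomputable def den : ForProg → State → State
  | skip => fun σ => σ
  | setNat k i e => fun σ => σ.setNat k (i.eval σ) (e.eval σ)
  | setReal k i e => fun σ => σ.setReal k (i.eval σ) (e.eval σ)
  | seq p q => fun σ => q.den (p.den σ)
  | branch b p q => fun σ => if b.Holds σ then p.den σ else q.den σ
  | loop v b p => fun σ =>
      Nat.rec (σ.setNat ctr v 0) (fun i τ => (p.den τ).setNat ctr v (i + 1)) (σ.nat bnd b)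

/-- The arrays of naturals, other than `ctr`, that a program writes to. -/
def natWrites : ForProg → List ℕ
  | skip => []
  | setNat k _ _ => [k]
  | setReal _ _ _ => []
  | seq p q => p.natWrites ++ q.natWrites
  | branch _ p q => p.natWrites ++ q.natWrites
  | loop _ _ p => p.natWrites

/-- The arrays of reals that a program writes to. -/
def realWrites : ForProg → List ℕ
  | skip => []
  | setNat _ _ _ => []
  | setReal k _ _ => [k]
  | seq p q => p.realWrites ++ q.realWrites
  | branch _ p q => p.realWrites ++ q.realWrites
  | loop _ _ p => p.realWrites

/-- The counters of the loops of a program. -/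
def counters : ForProg → List ℕ
  | skip => []
  | setNat _ _ _ => []
  | setReal _ _ _ => []
  | seq p q => p.counters ++ q.counters
  | branch _ p q => p.counters ++ q.counters
  | loop v _ p => v :: p.counters

/-- The program assigns neither to bounds nor to counters, and nested loops have different
counters. -/
def Ok : ForProg → Prop
  | skip => True
  | setNat k _ _ => k ≠ ctr ∧ k ≠ bnd
  | setReal _ _ _ => True
  | seq p q => p.Ok ∧ q.Ok
  | branch _ p q => p.Ok ∧ q.Ok
  | loop v _ p => v ∉ p.counters ∧ p.Ok

/-- A bound on the running time, in terms of bounds `β b` on the numbers of iterations. -/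
noncomputable def costPoly (β : ℕ → Polynomial ℕ) : ForProg → Polynomial ℕ
  | skip => 1
  | setNat _ i e => ((i.cost + e.cost + 1 : ℕ) : Polynomial ℕ)
  | setReal _ i e => ((i.cost + e.cost + 1 : ℕ) : Polynomial ℕ)
  | seq p q => p.costPoly β + q.costPoly β
  | branch b p q => ((b.cost + 1 : ℕ) : Polynomial ℕ) + p.costPoly β + q.costPoly β
  | loop _ b p => β b * (p.costPoly β + 12) + 9

/-- `τ` agrees with `σ` wherever the program does not write. -/
structure Frame (p : ForProg) (σ τ : State) : Prop where
  nat : ∀ k, k ≠ ctr → k ∉ p.natWrites → τ.nat k = σ.nat k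
  real : ∀ k, k ∉ p.realWrites → τ.real k = σ.real k
  counter : ∀ v ∉ p.counters, τ.nat ctr v = σ.nat ctr v

end ForProg

/-! ### Memory accesses -/

theorem nat_setNat (σ : State) (k i v k' i' : ℕ) :
    (σ.setNat k i v).nat k' i' = if k' = k ∧ i' = i then v else σ.nat k' i' := by
  simp only [State.setNat, Function.update_apply]
  by_cases h : k' = k
  · subst h; by_cases h' : i' = i <;> simp [h']
  · simp [h]

theorem nat_setNat_of_ne (σ : State) {k k' : ℕ} (i v : ℕ) (h : k' ≠ k) :
    (σ.setNat k i v).nat k' = σ.nat k' := by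
  simp [State.setNat, h]

theorem real_setReal (σ : State) (k i : ℕ) (v : ℝ) (k' i' : ℕ) :
    (σ.setReal k i v).real k' i' = if k' = k ∧ i' = i then v else σ.real k' i' := by
  simp only [State.setReal, Function.update_apply]
  by_cases h : k' = k
  · subst h; by_cases h' : i' = i <;> simp [h']
  · simp [h]

theorem real_setReal_of_ne (σ : State) {k k' : ℕ} (i : ℕ) (v : ℝ) (h : k' ≠ k) :
    (σ.setReal k i v).real k' = σ.real k' := by
  simp [State.setReal, h]

theorem nat_setReal (σ : State) (k i : ℕ) (v : ℝ) : (σ.setReal k i v).nat = σ.nat := rfl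

theorem real_setNat (σ : State) (k i v : ℕ) : (σ.setNat k i v).real = σ.real := rfl

/-! ### Semantics and running time of for-programs -/

namespace ForProg

theorem Frame.refl (p : ForProg) (σ : State) : Frame p σ σ :=
  ⟨fun _ _ _ => rfl, fun _ _ => rfl, fun _ _ => rfl⟩

theorem den_frame (p : ForProg) (hp : p.Ok) (σ : State) : Frame p σ (p.den σ) := by
  induction p generalizing σ with
  | skip => exact Frame.refl _ _
  | setNat k i e =>
    refine ⟨fun k' _ h => ?_, fun _ _ => rfl, fun v _ => ?_⟩
    · exact nat_setNat_of_ne _ _ _ (by simpa [natWrites] using h)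
    · simp only [den]; rw [nat_setNat_of_ne]; exact hp.1.symm
  | setReal k i e =>
    exact ⟨fun _ _ _ => rfl,
      fun k' h => real_setReal_of_ne _ _ _ (by simpa [realWrites] using h), fun _ _ => rfl⟩
  | seq p q ihp ihq =>
    have h1 := ihp hp.1 σ
    have h2 := ihq hp.2 (p.den σ)
    refine ⟨fun k hk h => ?_, fun k h => ?_, fun v h => ?_⟩
    · simp only [natWrites, List.mem_append, not_or] at h
      exact (h2.nat k hk h.2).trans (h1.nat k hk h.1)
    · simp only [realWrites, List.mem_append, not_or] at h
      exact (h2.real k h.2).trans (h1.real k h.1)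
    · simp only [counters, List.mem_append, not_or] at h
      exact (h2.counter v h.2).trans (h1.counter v h.1)
  | branch b p q ihp ihq =>
    have h1 := ihp hp.1 σ
    have h2 := ihq hp.2 σ
    refine ⟨fun k hk h => ?_, fun k h => ?_, fun v h => ?_⟩
    · simp only [natWrites, List.mem_append, not_or] at h
      simp only [den]; split_ifs
      exacts [h1.nat k hk h.1, h2.nat k hk h.2]
    · simp only [realWrites, List.mem_append, not_or] at h
      simp only [den]; split_ifs
      exacts [h1.real k h.1, h2.real k h.2]
    · simp only [counters, List.mem_append, not_or] at h
      simp only [den]; split_ifs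
      exacts [h1.counter v h.1, h2.counter v h.2]
  | loop v b p ih =>
    simp only [den]
    generalize σ.nat bnd b = m
    induction m with
    | zero =>
      refine ⟨fun k hk h => ?_, fun k h => rfl, fun w h => ?_⟩
      · exact nat_setNat_of_ne _ _ _ hk
      · simp only [counters, List.mem_cons, not_or] at h
        simp [nat_setNat, h.1]
    | succ m ihm =>
      have h1 := ih hp.2 (Nat.rec (σ.setNat ctr v 0)
        (fun i τ => (p.den τ).setNat ctr v (i + 1)) m)
      refine ⟨fun k hk h => ?_, fun k h => ?_, fun w h => ?_⟩
      · rw [nat_setNat_of_ne _ _ _ hk]; exact (h1.nat k hk h).trans (ihm.nat k hk h)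
      · rw [real_setNat]; exact (h1.real k h).trans (ihm.real k h)
      · have h' := h
        simp only [counters, List.mem_cons, not_or] at h
        rw [nat_setNat, if_neg (by simp [h.1])]
        exact (h1.counter w h.2).trans (ihm.counter w h')

/-- Bounds are never written. -/
theorem den_bnd (p : ForProg) (hp : p.Ok) (σ : State) : (p.den σ).nat bnd = σ.nat bnd := by
  refine (den_frame p hp σ).nat _ (by decide) ?_
  induction p generalizing σ with
  | skip => simp [natWrites]
  | setNat k i e => simpa [natWrites] using hp.2.symm
  | setReal k i e => simp [natWrites]
  | seq p q ihp ihq => simpa [natWrites] using ⟨ihp hp.1 σ, ihq hp.2 σ⟩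
  | branch b p q ihp ihq => simpa [natWrites] using ⟨ihp hp.1 σ, ihq hp.2 σ⟩
  | loop v b p ih => simpa [natWrites] using ih hp.2 σ

/-- The invariant rule for loops. -/
theorem loop_induction {v b : ℕ} {p : ForProg} {σ : State} (hok : (loop v b p).Ok)
    (I : ℕ → State → Prop) (h0 : I 0 (σ.setNat ctr v 0))
    (hs : ∀ i τ, i < σ.nat bnd b → Frame (loop v b p) σ τ → τ.nat bnd = σ.nat bnd →
      τ.nat ctr v = i → I i τ → I (i + 1) ((p.den τ).setNat ctr v (i + 1))) :
    I (σ.nat bnd b) ((loop v b p).den σ) := by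
  suffices h : ∀ m ≤ σ.nat bnd b, ∀ τ, τ = (Nat.rec (σ.setNat ctr v 0)
      (fun i τ => (p.den τ).setNat ctr v (i + 1)) m : State) →
      Frame (loop v b p) σ τ ∧ τ.nat bnd = σ.nat bnd ∧ τ.nat ctr v = m ∧ I m τ from
    (h _ le_rfl _ rfl).2.2.2
  intro m
  induction m with
  | zero =>
    rintro - τ rfl
    refine ⟨⟨fun k hk h => nat_setNat_of_ne _ _ _ hk, fun k h => rfl, fun w h => ?_⟩,
      nat_setNat_of_ne _ _ _ (by decide), by simp [nat_setNat], h0⟩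
    simp only [counters, List.mem_cons, not_or] at h
    simp [nat_setNat, h.1]
  | succ m ihm =>
    rintro hm τ rfl
    obtain ⟨f, hb, hc, hI⟩ := ihm (by omega) _ rfl
    have h1 := den_frame p hok.2 (Nat.rec (σ.setNat ctr v 0)
        (fun i τ => (p.den τ).setNat ctr v (i + 1)) m)
    refine ⟨⟨fun k hk h => ?_, fun k h => ?_, fun w h => ?_⟩, ?_, by simp [nat_setNat],
      hs m _ (by omega) f hb hc hI⟩
    · rw [nat_setNat_of_ne _ _ _ hk]; exact (h1.nat k hk h).trans (f.nat k hk h)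
    · rw [real_setNat]; exact (h1.real k h).trans (f.real k h)
    · have h' := h
      simp only [counters, List.mem_cons, not_or] at h
      rw [nat_setNat, if_neg (by simp [h.1])]
      exact (h1.counter w h.2).trans (f.counter w h')
    · rw [nat_setNat_of_ne _ _ _ (by decide), den_bnd p hok.2]; exact hb

/-- A for-program halts after a number of steps that is polynomial in the bounds of its loops. -/
theorem exists_exec (β : ℕ → Polynomial ℕ) (n : ℕ) (p : ForProg) (hp : p.Ok) (σ : State)
    (hβ : ∀ b, σ.nat bnd b ≤ (β b).eval n) :
    ∃ t ≤ (p.costPoly β).eval n, Exec p.toProg σ (p.den σ) t := by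
  induction p generalizing σ with
  | skip => exact ⟨1, by simp [costPoly], Exec.skip σ⟩
  | setNat k i e => exact ⟨_, by simp [costPoly], Exec.setNat σ k i e⟩
  | setReal k i e => exact ⟨_, by simp [costPoly], Exec.setReal σ k i e⟩
  | seq p q ihp ihq =>
    obtain ⟨t, ht, h1⟩ := ihp hp.1 σ hβ
    obtain ⟨u, hu, h2⟩ := ihq hp.2 (p.den σ) (by simpa [den_bnd p hp.1] using hβ)
    exact ⟨t + u, by simp only [costPoly, Polynomial.eval_add]; omega, Exec.seq h1 h2⟩
  | branch b p q ihp ihq =>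
    simp only [den]
    split_ifs with hb
    · obtain ⟨t, ht, h1⟩ := ihp hp.1 σ hβ
      refine ⟨_, ?_, Exec.branchTrue hb h1⟩
      simp only [costPoly, Polynomial.eval_add, Polynomial.eval_natCast, Nat.cast_id]; omega
    · obtain ⟨t, ht, h1⟩ := ihq hp.2 σ hβ
      refine ⟨_, ?_, Exec.branchFalse hb h1⟩
      simp only [costPoly, Polynomial.eval_add, Polynomial.eval_natCast, Nat.cast_id]; omega
  | loop v b p ih =>
    -- the loop is unrolled from the end: `r` iterations remain after the first `σ.nat bnd b - r`
    set s : ℕ → State := fun m => Nat.rec (σ.setNat ctr v 0)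
      (fun i τ => (p.den τ).setNat ctr v (i + 1)) m with hs
    have key : ∀ m, (s m).nat bnd = σ.nat bnd ∧ (s m).nat ctr v = m := by
      intro m
      induction m with
      | zero => exact ⟨nat_setNat_of_ne _ _ _ (by decide), by simp [hs, nat_setNat]⟩
      | succ m ihm =>
        refine ⟨?_, by simp [hs, nat_setNat]⟩
        simp only [hs]
        rw [nat_setNat_of_ne _ _ _ (by decide), den_bnd p hp.2]; exact ihm.1
    set C := (p.costPoly β).eval n with hC
    have run : ∀ r m, m + r = σ.nat bnd b → ∃ t ≤ r * (C + 12) + 6,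
        Exec (.loop (.natLt (.get ctr (.lit v)) (.get bnd (.lit b)))
          (.seq p.toProg (.setNat ctr (.lit v) (.add (.get ctr (.lit v)) (.lit 1)))))
          (s m) (s (σ.nat bnd b)) t := by
      intro r
      induction r with
      | zero =>
        intro m hm
        obtain rfl : m = σ.nat bnd b := by omega
        refine ⟨_, ?_, Exec.loopFalse ?_⟩
        · simp [Test.cost, NatExpr.cost]
        · simp [Test.Holds, NatExpr.eval, key]
      | succ r ihr =>
        intro m hm
        obtain ⟨u, hu, h2⟩ := ihr (m + 1) (by omega)
        obtain ⟨t, ht, h1⟩ := ih hp.2 (s m) (by simpa [(key m).1] using hβ)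
        have h3 := Exec.setNat (p.den (s m)) ctr (.lit v) (.add (.get ctr (.lit v)) (.lit 1))
        have h4 : (p.den (s m)).setNat ctr (NatExpr.eval (p.den (s m)) (.lit v))
            (NatExpr.eval (p.den (s m)) (.add (.get ctr (.lit v)) (.lit 1))) = s (m + 1) := by
          have h5 := ((den_frame p hp.2 (s m)).counter v hp.1).trans (key m).2
          simp only [NatExpr.eval, h5]
          rfl
        rw [h4] at h3
        refine ⟨_, ?_, Exec.loopTrue ?_ (Exec.seq h1 h3) h2⟩
        · simp only [Test.cost, NatExpr.cost]
          have : (r + 1) * (C + 12) = r * (C + 12) + C + 12 := by ring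
          omega
        · simp only [Test.Holds, NatExpr.eval, key]; omega
    obtain ⟨t, ht, h1⟩ := run (σ.nat bnd b) 0 (by simp)
    have h0 := Exec.setNat σ ctr (.lit v) (.lit 0)
    refine ⟨_, ?_, Exec.seq h0 h1⟩
    simp only [costPoly, Polynomial.eval_add, Polynomial.eval_mul, NatExpr.cost, ← hC]
    have h2 := Nat.mul_le_mul_right (C + 12) (hβ b)
    have e1 : Polynomial.eval n (12 : Polynomial ℕ) = 12 := Polynomial.eval_ofNat ..
    have e2 : Polynomial.eval n (9 : Polynomial ℕ) = 9 := Polynomial.eval_ofNat ..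
    rw [e1, e2]
    omega

end ForProg

/-! ### Minimum-weight vertex covers of bipartite graphs -/

/-- A bipartite multigraph with weighted nodes. The nodes of both sides are numbered by the naturals
below `K`; so are the potential edges, among which `ins` selects the edges that are present. Edge `c`
joins the left node `vid c` to the right node `hid c`. -/
structure BipartiteGraph where
  K : ℕ
  ins : ℕ → Prop
  vid : ℕ → ℕ
  hid : ℕ → ℕ
  wV : ℕ → ℝ
  wH : ℕ → ℝ
  vid_lt : ∀ c < K, ins c → vid c < K
  hid_lt : ∀ c < K, ins c → hid c < K

/-- A preflow with distance labels: `F c` is the flow along edge `c`, `E` the excess of the left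
nodes, `G` the inflow of the right nodes minus their weight, `DV` and `DH` are the labels. -/
@[ext]
structure Preflow where
  E : ℕ → ℝ
  G : ℕ → ℝ
  F : ℕ → ℝ
  DV : ℕ → ℕ
  DH : ℕ → ℕ

theorem sum_add_eq_of_eq_off {ι M : Type*} [AddCommMonoid M] [DecidableEq ι] {s : Finset ι}
    {f g : ι → M} {v : ι} (hv : v ∈ s) (h : ∀ u ∈ s, u ≠ v → f u = g u) :
    ∑ u ∈ s, f u + g v = ∑ u ∈ s, g u + f v := by
  rw [← Finset.sum_erase_add s f hv, ← Finset.sum_erase_add s g hv,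
    Finset.sum_congr rfl fun u hu => h u (Finset.mem_of_mem_erase hu) (Finset.ne_of_mem_erase hu)]
  abel

namespace BipartiteGraph

open Classical in
/-- Push the whole excess of a left node along the edge `c` if the labels admit it. -/
noncomputable def pushV (N : BipartiteGraph) (c : ℕ) (s : Preflow) : Preflow :=
  if N.ins c ∧ 0 < s.E (N.vid c) ∧ s.DV (N.vid c) = s.DH (N.hid c) + 1 then
    { s with
      F := Function.update s.F c (s.F c + s.E (N.vid c))
      G := Function.update s.G (N.hid c) (s.G (N.hid c) + s.E (N.vid c))
      E := Function.update s.E (N.vid c) 0 }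
  else s

open Classical in
/-- Send excess of a right node back along the edge `c` if the labels admit it. -/
noncomputable def pushH (N : BipartiteGraph) (c : ℕ) (s : Preflow) : Preflow :=
  if N.ins c ∧ 0 < s.G (N.hid c) ∧ 0 < s.F c ∧ s.DH (N.hid c) = s.DV (N.vid c) + 1 then
    if s.F c < s.G (N.hid c) then
      { s with
        E := Function.update s.E (N.vid c) (s.E (N.vid c) + s.F c)
        G := Function.update s.G (N.hid c) (s.G (N.hid c) - s.F c)
        F := Function.update s.F c 0 }
    else
      { s with
        E := Function.update s.E (N.vid c) (s.E (N.vid c) + s.G (N.hid c))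
        F := Function.update s.F c (s.F c - s.G (N.hid c))
        G := Function.update s.G (N.hid c) 0 }
  else s

open Classical in
/-- Raise the label of a left node with excess. -/
noncomputable def liftV (cap u : ℕ) (s : Preflow) : Preflow :=
  if 0 < s.E u ∧ s.DV u < cap then { s with DV := Function.update s.DV u (s.DV u + 1) } else s

open Classical in
/-- Raise the label of a right node with excess. -/
noncomputable def liftH (cap u : ℕ) (s : Preflow) : Preflow :=
  if 0 < s.G u ∧ s.DH u < cap then { s with DH := Function.update s.DH u (s.DH u + 1) } else s

/-- Apply `f 0`, ..., `f (n - 1)` in this order. -/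
def sweep {α : Type*} (f : ℕ → α → α) : ℕ → α → α
  | 0, s => s
  | n + 1, s => f n (sweep f n s)

/-- One round: sweeps of all pushes and lifts, first for the left and then for the right nodes. -/
noncomputable def round (N : BipartiteGraph) (cap : ℕ) (s : Preflow) : Preflow :=
  sweep (liftH cap) N.K (sweep N.pushH N.K (sweep (liftV cap) N.K (sweep N.pushV N.K s)))

open Classical in
/-- The flow out of a left node. -/
noncomputable def outflow (N : BipartiteGraph) (F : ℕ → ℝ) (u : ℕ) : ℝ :=
  ∑ c ∈ Finset.range N.K, if N.ins c ∧ N.vid c = u then F c else 0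

open Classical in
/-- The flow into a right node. -/
noncomputable def inflow (N : BipartiteGraph) (F : ℕ → ℝ) (u : ℕ) : ℝ :=
  ∑ c ∈ Finset.range N.K, if N.ins c ∧ N.hid c = u then F c else 0

/-- The invariant of the push-relabel method. Labels drop by at most one along residual edges; the
forward direction of an edge is always residual, the backward direction if the flow is positive. A
right node that is not saturated has label `0`. -/
structure Inv (N : BipartiteGraph) (cap : ℕ) (s : Preflow) : Prop where
  E_nonneg : ∀ u, 0 ≤ s.E u
  F_nonneg : ∀ c, 0 ≤ s.F c
  E_eq : ∀ u < N.K, s.E u = N.wV u - N.outflow s.F u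
  G_eq : ∀ u < N.K, s.G u = N.inflow s.F u - N.wH u
  forward : ∀ c < N.K, N.ins c → s.DV (N.vid c) ≤ s.DH (N.hid c) + 1
  backward : ∀ c < N.K, N.ins c → 0 < s.F c → s.DH (N.hid c) ≤ s.DV (N.vid c) + 1
  unsaturated : ∀ u, s.G u < 0 → s.DH u = 0
  DV_le : ∀ u, s.DV u ≤ cap
  DH_le : ∀ u, s.DH u ≤ cap

open Classical in
/-- The admissible backward edges. -/
noncomputable def admissible (N : BipartiteGraph) (s : Preflow) : Finset ℕ :=
  {c ∈ Finset.range N.K | N.ins c ∧ 0 < s.F c ∧ s.DH (N.hid c) = s.DV (N.vid c) + 1}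

/-- The distance of the labels from their maximum value. -/
def room (N : BipartiteGraph) (cap : ℕ) (s : Preflow) : ℕ :=
  ∑ u ∈ Finset.range N.K, (cap - s.DV u) + ∑ u ∈ Finset.range N.K, (cap - s.DH u)

open Classical in
/-- The sum of the labels of the nodes with excess. -/
noncomputable def activeSum (N : BipartiteGraph) (s : Preflow) : ℕ :=
  ∑ u ∈ Finset.range N.K, (if 0 < s.E u then s.DV u else 0) +
    ∑ u ∈ Finset.range N.K, (if 0 < s.G u then s.DH u else 0)

/-- The potential that decreases with every push and every lift. A lift consumes `room`, which pays
for all the backward edges that become admissible; a saturating push consumes an admissible edge,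
which pays for the node it activates; any other push decreases `activeSum`. -/
noncomputable def potential (N : BipartiteGraph) (cap : ℕ) (s : Preflow) : ℕ :=
  (N.K * (cap + 1) + 2) * N.room cap s + (cap + 1) * (N.admissible s).card + N.activeSum s

variable {N : BipartiteGraph} {cap : ℕ}

open Classical in
theorem outflow_update (F : ℕ → ℝ) {c : ℕ} (hc : c < N.K) (hi : N.ins c) (x : ℝ) (u : ℕ) :
    N.outflow (Function.update F c x) u =
      N.outflow F u + if u = N.vid c then x - F c else 0 := by
  unfold outflow
  have h := sum_add_eq_of_eq_off (s := Finset.range N.K) (v := c)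
    (f := fun c' => if N.ins c' ∧ N.vid c' = u then Function.update F c x c' else 0)
    (g := fun c' => if N.ins c' ∧ N.vid c' = u then F c' else 0) (Finset.mem_range.2 hc)
    (fun c' _ h => by simp [Function.update_of_ne h])
  simp only [hi, true_and, Function.update_self, eq_comm (b := u)] at h ⊢
  by_cases hu : u = N.vid c
  · rw [if_pos hu] at h ⊢; rw [if_pos hu] at h; linarith
  · rw [if_neg hu] at h ⊢; rw [if_neg hu] at h; linarith

open Classical in
theorem inflow_update (F : ℕ → ℝ) {c : ℕ} (hc : c < N.K) (hi : N.ins c) (x : ℝ) (u : ℕ) :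
    N.inflow (Function.update F c x) u =
      N.inflow F u + if u = N.hid c then x - F c else 0 := by
  unfold inflow
  have h := sum_add_eq_of_eq_off (s := Finset.range N.K) (v := c)
    (f := fun c' => if N.ins c' ∧ N.hid c' = u then Function.update F c x c' else 0)
    (g := fun c' => if N.ins c' ∧ N.hid c' = u then F c' else 0) (Finset.mem_range.2 hc)
    (fun c' _ h => by simp [Function.update_of_ne h])
  simp only [hi, true_and, Function.update_self, eq_comm (b := u)] at h ⊢
  by_cases hu : u = N.hid c
  · rw [if_pos hu] at h ⊢; rw [if_pos hu] at h; linarith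
  · rw [if_neg hu] at h ⊢; rw [if_neg hu] at h; linarith

open Classical in
theorem mem_admissible {s : Preflow} {c : ℕ} : c ∈ N.admissible s ↔
    c < N.K ∧ N.ins c ∧ 0 < s.F c ∧ s.DH (N.hid c) = s.DV (N.vid c) + 1 := by
  rw [admissible, Finset.mem_filter, Finset.mem_range]

open Classical in
theorem card_admissible_le (s : Preflow) : (N.admissible s).card ≤ N.K :=
  (Finset.card_filter_le _ _).trans (Finset.card_range _).le

theorem Inv.pushV {s : Preflow} (h : N.Inv cap s) {c : ℕ} (hc : c < N.K) :
    N.Inv cap (N.pushV c s) := by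
  unfold BipartiteGraph.pushV
  split_ifs with hp
  swap
  · exact h
  obtain ⟨hi, hE, hd⟩ := hp
  refine ⟨fun u => ?_, fun c' => ?_, fun u hu => ?_, fun u hu => ?_, h.forward, fun c' hc' hi' hF => ?_,
    fun u hu => ?_, h.DV_le, h.DH_le⟩
  · by_cases hu : u = N.vid c <;> simp [hu, h.E_nonneg]
  · have := h.F_nonneg c'
    by_cases hu : c' = c
    · subst hu; simp; linarith
    · simpa [Function.update_apply, hu]
  · simp only
    rw [outflow_update _ hc hi, Function.update_apply]
    have := h.E_eq u hu
    split_ifs with h1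
    · subst h1; linarith
    · linarith
  · simp only
    rw [inflow_update _ hc hi, Function.update_apply]
    have := h.G_eq u hu
    split_ifs with h1
    · subst h1; linarith
    · linarith
  · by_cases hu : c' = c
    · subst hu; simp only; omega
    · exact h.backward c' hc' hi' (by simpa [Function.update_apply, hu] using hF)
  · refine h.unsaturated u ?_
    simp only [Function.update_apply] at hu
    split_ifs at hu with h1
    · subst h1; linarith
    · exact hu

theorem Inv.pushH {s : Preflow} (h : N.Inv cap s) {c : ℕ} (hc : c < N.K) :
    N.Inv cap (N.pushH c s) := by
  unfold BipartiteGraph.pushH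
  split_ifs with hp hFG
  · obtain ⟨hi, hG, hF, hd⟩ := hp
    refine ⟨fun u => ?_, fun c' => ?_, fun u hu => ?_, fun u hu => ?_, h.forward,
      fun c' hc' hi' hF' => ?_, fun u hu => ?_, h.DV_le, h.DH_le⟩
    · have := h.E_nonneg u
      simp only [Function.update_apply]
      split_ifs with h1
      · subst h1; linarith
      · exact this
    · by_cases hu : c' = c <;> simp [hu, h.F_nonneg]
    · simp only
      rw [outflow_update _ hc hi, Function.update_apply]
      have := h.E_eq u hu
      split_ifs with h1
      · subst h1; linarith
      · linarith
    · simp only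
      rw [inflow_update _ hc hi, Function.update_apply]
      have := h.G_eq u hu
      split_ifs with h1
      · subst h1; linarith
      · linarith
    · by_cases hu : c' = c
      · subst hu; simp at hF'
      · exact h.backward c' hc' hi' (by simpa [Function.update_apply, hu] using hF')
    · refine h.unsaturated u ?_
      simp only [Function.update_apply] at hu
      split_ifs at hu with h1
      · subst h1; linarith
      · exact hu
  · obtain ⟨hi, hG, hF, hd⟩ := hp
    refine ⟨fun u => ?_, fun c' => ?_, fun u hu => ?_, fun u hu => ?_, h.forward,
      fun c' hc' hi' hF' => ?_, fun u hu => ?_, h.DV_le, h.DH_le⟩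
    · have := h.E_nonneg u
      simp only [Function.update_apply]
      split_ifs with h1
      · subst h1; linarith
      · exact this
    · have := h.F_nonneg c'
      simp only [Function.update_apply]
      split_ifs with h1
      · linarith
      · exact this
    · simp only
      rw [outflow_update _ hc hi, Function.update_apply]
      have := h.E_eq u hu
      split_ifs with h1
      · subst h1; linarith
      · linarith
    · simp only
      rw [inflow_update _ hc hi, Function.update_apply]
      have := h.G_eq u hu
      split_ifs with h1
      · subst h1; linarith
      · linarith
    · by_cases hu : c' = c
      · subst hu; exact h.backward c' hc' hi' hF
      · exact h.backward c' hc' hi' (by simpa [Function.update_apply, hu] using hF')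
    · refine h.unsaturated u ?_
      simp only [Function.update_apply] at hu
      split_ifs at hu with h1
      · exact absurd hu (lt_irrefl _)
      · exact hu
  · exact h

/-- Lifting a left node keeps the labels valid if none of its edges is admissible. -/
theorem Inv.liftV {s : Preflow} (h : N.Inv cap s) {u : ℕ}
    (hu : ∀ c < N.K, N.ins c → N.vid c = u → 0 < s.E u → s.DV u ≤ s.DH (N.hid c)) :
    N.Inv cap (liftV cap u s) := by
  unfold BipartiteGraph.liftV
  split_ifs with hp
  swap
  · exact h
  refine ⟨h.E_nonneg, h.F_nonneg, h.E_eq, h.G_eq, fun c hc hi => ?_, fun c hc hi hF => ?_,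
    h.unsaturated, fun u' => ?_, h.DH_le⟩
  · have h1 := h.forward c hc hi
    simp only [Function.update_apply]
    split_ifs with h2
    · have := hu c hc hi h2 hp.1; omega
    · exact h1
  · have h1 := h.backward c hc hi hF
    simp only [Function.update_apply]
    split_ifs with h2
    · rw [h2] at h1; omega
    · exact h1
  · have := h.DV_le u'
    simp only [Function.update_apply]
    split_ifs with h2
    · omega
    · exact this

/-- Lifting a right node keeps the labels valid if none of its edges is admissible. -/
theorem Inv.liftH {s : Preflow} (h : N.Inv cap s) {u : ℕ}
    (hu : ∀ c < N.K, N.ins c → N.hid c = u → 0 < s.G u → 0 < s.F c → s.DH u ≤ s.DV (N.vid c)) :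
    N.Inv cap (liftH cap u s) := by
  unfold BipartiteGraph.liftH
  split_ifs with hp
  swap
  · exact h
  refine ⟨h.E_nonneg, h.F_nonneg, h.E_eq, h.G_eq, fun c hc hi => ?_, fun c hc hi hF => ?_,
    fun u' hu' => ?_, h.DV_le, fun u' => ?_⟩
  · have h1 := h.forward c hc hi
    simp only [Function.update_apply]
    split_ifs with h2
    · rw [h2] at h1; omega
    · exact h1
  · have h1 := h.backward c hc hi hF
    simp only [Function.update_apply]
    split_ifs with h2
    · have := hu c hc hi h2 hp.1 hF; omega
    · exact h1
  · have h1 := h.unsaturated u' hu'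
    simp only [Function.update_apply]
    split_ifs with h2
    · subst h2; exact absurd hp.1 (not_lt.2 (le_of_lt hu'))
    · exact h1
  · have := h.DH_le u'
    simp only [Function.update_apply]
    split_ifs with h2
    · omega
    · exact this

theorem potential_pushV {s : Preflow} {c : ℕ} (hc : c < N.K) :
    N.pushV c s = s ∨ N.potential cap (N.pushV c s) < N.potential cap s := by
  unfold pushV
  split_ifs with hp
  swap
  · exact Or.inl rfl
  obtain ⟨hi, hE, hd⟩ := hp
  right
  set s' : Preflow := { s with
      F := Function.update s.F c (s.F c + s.E (N.vid c))
      G := Function.update s.G (N.hid c) (s.G (N.hid c) + s.E (N.vid c))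
      E := Function.update s.E (N.vid c) 0 } with hs'
  have hA : (N.admissible s').card ≤ (N.admissible s).card := by
    refine Finset.card_le_card fun c' hc' => ?_
    rw [mem_admissible] at hc' ⊢
    obtain ⟨h1, h2, h3, h4⟩ := hc'
    refine ⟨h1, h2, ?_, h4⟩
    by_cases h5 : c' = c
    · subst h5; simp only [hs'] at h4; omega
    · simpa [hs', Function.update_apply, h5] using h3
  have hV := sum_add_eq_of_eq_off (s := Finset.range N.K) (v := N.vid c)
    (f := fun u => if 0 < s'.E u then s'.DV u else 0)
    (g := fun u => if 0 < s.E u then s.DV u else 0) (Finset.mem_range.2 (N.vid_lt c hc hi))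
    (fun u _ h => by simp [hs', Function.update_of_ne h])
  have hH := sum_add_eq_of_eq_off (s := Finset.range N.K) (v := N.hid c)
    (f := fun u => if 0 < s'.G u then s'.DH u else 0)
    (g := fun u => if 0 < s.G u then s.DH u else 0) (Finset.mem_range.2 (N.hid_lt c hc hi))
    (fun u _ h => by simp [hs', Function.update_of_ne h])
  have e1 : (if 0 < s'.E (N.vid c) then s'.DV (N.vid c) else 0) = 0 := by simp [hs']
  have e2 : (if 0 < s'.G (N.hid c) then s'.DH (N.hid c) else 0) ≤ s.DH (N.hid c) := by
    split_ifs <;> simp [hs']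
  simp only [e1, if_pos hE] at hV
  have hR : N.room cap s' = N.room cap s := rfl
  have hm := Nat.mul_le_mul_left (cap + 1) hA
  unfold potential activeSum
  rw [hR]
  omega

theorem potential_pushH {s : Preflow} (h : N.Inv cap s) {c : ℕ} (hc : c < N.K) :
    N.pushH c s = s ∨ N.potential cap (N.pushH c s) < N.potential cap s := by
  unfold pushH
  split_ifs with hp hFG
  · obtain ⟨hi, hG, hF, hd⟩ := hp
    right
    set s' : Preflow := { s with
        E := Function.update s.E (N.vid c) (s.E (N.vid c) + s.F c)
        G := Function.update s.G (N.hid c) (s.G (N.hid c) - s.F c)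
        F := Function.update s.F c 0 } with hs'
    have hA : (N.admissible s').card < (N.admissible s).card := by
      refine Finset.card_lt_card (Finset.ssubset_iff_of_subset (fun c' hc' => ?_) |>.2
        ⟨c, mem_admissible.2 ⟨hc, hi, hF, hd⟩, fun hc' => ?_⟩)
      · rw [mem_admissible] at hc' ⊢
        obtain ⟨h1, h2, h3, h4⟩ := hc'
        refine ⟨h1, h2, ?_, h4⟩
        by_cases h5 : c' = c
        · subst h5; simp [hs'] at h3
        · simpa [hs', Function.update_apply, h5] using h3
      · rw [mem_admissible] at hc'
        simp [hs'] at hc'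
    have hV := sum_add_eq_of_eq_off (s := Finset.range N.K) (v := N.vid c)
      (f := fun u => if 0 < s'.E u then s'.DV u else 0)
      (g := fun u => if 0 < s.E u then s.DV u else 0) (Finset.mem_range.2 (N.vid_lt c hc hi))
      (fun u _ h => by simp [hs', Function.update_of_ne h])
    have hH : ∑ u ∈ Finset.range N.K, (if 0 < s'.G u then s'.DH u else 0) =
        ∑ u ∈ Finset.range N.K, (if 0 < s.G u then s.DH u else 0) := by
      refine Finset.sum_congr rfl fun u _ => ?_
      by_cases hu : u = N.hid c
      · subst hu; simp [hs', hG, hFG]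
      · simp [hs', Function.update_of_ne hu]
    have e1 : (if 0 < s'.E (N.vid c) then s'.DV (N.vid c) else 0) ≤ cap := by
      split_ifs
      exacts [h.DV_le _, Nat.zero_le _]
    have hR : N.room cap s' = N.room cap s := rfl
    have hm := Nat.mul_le_mul_left (cap + 1) (Nat.succ_le_of_lt hA)
    rw [Nat.mul_succ] at hm
    unfold potential activeSum
    rw [hR, hH]
    omega
  · obtain ⟨hi, hG, hF, hd⟩ := hp
    right
    set s' : Preflow := { s with
        E := Function.update s.E (N.vid c) (s.E (N.vid c) + s.G (N.hid c))
        F := Function.update s.F c (s.F c - s.G (N.hid c))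
        G := Function.update s.G (N.hid c) 0 } with hs'
    have hA : (N.admissible s').card ≤ (N.admissible s).card := by
      refine Finset.card_le_card fun c' hc' => ?_
      rw [mem_admissible] at hc' ⊢
      obtain ⟨h1, h2, h3, h4⟩ := hc'
      refine ⟨h1, h2, ?_, h4⟩
      by_cases h5 : c' = c
      · subst h5; exact hF
      · simpa [hs', Function.update_apply, h5] using h3
    have hV := sum_add_eq_of_eq_off (s := Finset.range N.K) (v := N.vid c)
      (f := fun u => if 0 < s'.E u then s'.DV u else 0)
      (g := fun u => if 0 < s.E u then s.DV u else 0) (Finset.mem_range.2 (N.vid_lt c hc hi))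
      (fun u _ h => by simp [hs', Function.update_of_ne h])
    have hH := sum_add_eq_of_eq_off (s := Finset.range N.K) (v := N.hid c)
      (f := fun u => if 0 < s'.G u then s'.DH u else 0)
      (g := fun u => if 0 < s.G u then s.DH u else 0) (Finset.mem_range.2 (N.hid_lt c hc hi))
      (fun u _ h => by simp [hs', Function.update_of_ne h])
    have e1 : (if 0 < s'.G (N.hid c) then s'.DH (N.hid c) else 0) = 0 := by simp [hs']
    have e2 : (if 0 < s'.E (N.vid c) then s'.DV (N.vid c) else 0) ≤ s.DV (N.vid c) := by
      split_ifs <;> simp [hs']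
    simp only [e1, if_pos hG] at hH
    have hR : N.room cap s' = N.room cap s := rfl
    have hm := Nat.mul_le_mul_left (cap + 1) hA
    unfold potential activeSum
    rw [hR]
    omega
  · exact Or.inl rfl

theorem potential_liftV {s : Preflow} {u : ℕ} (hu : u < N.K) :
    liftV cap u s = s ∨ N.potential cap (liftV cap u s) < N.potential cap s := by
  unfold liftV
  split_ifs with hp
  swap
  · exact Or.inl rfl
  right
  set s' : Preflow := { s with DV := Function.update s.DV u (s.DV u + 1) } with hs'
  have hV := sum_add_eq_of_eq_off (s := Finset.range N.K) (v := u)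
    (f := fun u => if 0 < s'.E u then s'.DV u else 0)
    (g := fun u => if 0 < s.E u then s.DV u else 0) (Finset.mem_range.2 hu)
    (fun u _ h => by simp [hs', Function.update_of_ne h])
  have hR := sum_add_eq_of_eq_off (s := Finset.range N.K) (v := u)
    (f := fun u => cap - s'.DV u) (g := fun u => cap - s.DV u) (Finset.mem_range.2 hu)
    (fun u _ h => by simp [hs', Function.update_of_ne h])
  have e : s'.DV u = s.DV u + 1 := by simp [hs']
  have e' : s'.E u = s.E u := rfl
  simp only [e, e', if_pos hp.1] at hV hR
  have hR' : N.room cap s = N.room cap s' + 1 := by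
    unfold room
    have : s'.DH = s.DH := rfl
    rw [this]; omega
  have hG : s'.G = s.G := rfl
  have hH : s'.DH = s.DH := rfl
  have hm := Nat.mul_le_mul_left (cap + 1) (card_admissible_le (N := N) s')
  unfold potential activeSum
  have hC : (N.K * (cap + 1) + 2) * (N.room cap s' + 1) =
      (N.K * (cap + 1) + 2) * N.room cap s' + ((cap + 1) * N.K + 2) := by ring
  rw [hR', hG, hH, hC]
  omega

theorem potential_liftH {s : Preflow} {u : ℕ} (hu : u < N.K) :
    liftH cap u s = s ∨ N.potential cap (liftH cap u s) < N.potential cap s := by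
  unfold liftH
  split_ifs with hp
  swap
  · exact Or.inl rfl
  right
  set s' : Preflow := { s with DH := Function.update s.DH u (s.DH u + 1) } with hs'
  have hV := sum_add_eq_of_eq_off (s := Finset.range N.K) (v := u)
    (f := fun u => if 0 < s'.G u then s'.DH u else 0)
    (g := fun u => if 0 < s.G u then s.DH u else 0) (Finset.mem_range.2 hu)
    (fun u _ h => by simp [hs', Function.update_of_ne h])
  have hR := sum_add_eq_of_eq_off (s := Finset.range N.K) (v := u)
    (f := fun u => cap - s'.DH u) (g := fun u => cap - s.DH u) (Finset.mem_range.2 hu)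
    (fun u _ h => by simp [hs', Function.update_of_ne h])
  have e : s'.DH u = s.DH u + 1 := by simp [hs']
  have e' : s'.G u = s.G u := rfl
  simp only [e, e', if_pos hp.1] at hV hR
  have hR' : N.room cap s = N.room cap s' + 1 := by
    unfold room
    have : s'.DV = s.DV := rfl
    rw [this]; omega
  have hG : s'.E = s.E := rfl
  have hH : s'.DV = s.DV := rfl
  have hm := Nat.mul_le_mul_left (cap + 1) (card_admissible_le (N := N) s')
  unfold potential activeSum
  have hC : (N.K * (cap + 1) + 2) * (N.room cap s' + 1) =
      (N.K * (cap + 1) + 2) * N.room cap s' + ((cap + 1) * N.K + 2) := by ring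
  rw [hR', hG, hH, hC]
  omega

/-- A sweep of operations none of which increases the potential without changing the state either
does nothing at all or decreases the potential. -/
theorem sweep_spec {f : ℕ → Preflow → Preflow} (J : ℕ → Preflow → Prop) (n : ℕ) (s : Preflow)
    (h0 : J 0 s) (hf : ∀ i < n, ∀ s, J i s →
      J (i + 1) (f i s) ∧ (f i s = s ∨ N.potential cap (f i s) < N.potential cap s)) :
    J n (sweep f n s) ∧ ((sweep f n s = s ∧ ∀ i < n, f i s = s) ∨
      N.potential cap (sweep f n s) < N.potential cap s) := by
  induction n with
  | zero => exact ⟨h0, Or.inl ⟨rfl, by simp⟩⟩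
  | succ n ih =>
    obtain ⟨h1, h2⟩ := ih fun i hi => hf i (by omega)
    obtain ⟨h3, h4⟩ := hf n (by omega) _ h1
    refine ⟨h3, ?_⟩
    simp only [sweep]
    rcases h2 with ⟨h2, h5⟩ | h2
    · rw [h2] at h4 ⊢
      rcases h4 with h4 | h4
      · refine Or.inl ⟨h4, fun i hi => ?_⟩
        rcases Nat.lt_succ_iff_lt_or_eq.1 hi with hi | rfl
        exacts [h5 i hi, h4]
      · exact Or.inr h4
    · right
      rcases h4 with h4 | h4
      · rw [h4]; exact h2
      · exact h4.trans h2

theorem sweep_pushV {s : Preflow} (h : N.Inv cap s) :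
    (N.Inv cap (sweep N.pushV N.K s) ∧ ∀ c < N.K, N.ins c →
      0 < (sweep N.pushV N.K s).E (N.vid c) →
      (sweep N.pushV N.K s).DV (N.vid c) ≤ (sweep N.pushV N.K s).DH (N.hid c)) ∧
    ((sweep N.pushV N.K s = s ∧ ∀ c < N.K, N.pushV c s = s) ∨
      N.potential cap (sweep N.pushV N.K s) < N.potential cap s) := by
  refine sweep_spec (fun i s => N.Inv cap s ∧ ∀ c < i, N.ins c →
      0 < s.E (N.vid c) → s.DV (N.vid c) ≤ s.DH (N.hid c)) N.K s ⟨h, by simp⟩ ?_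
  rintro i hi s ⟨h1, h2⟩
  refine ⟨⟨h1.pushV hi, fun c hc hic hE => ?_⟩, potential_pushV hi⟩
  have h3 := h1.forward c (by omega) hic
  unfold pushV at hE ⊢
  split_ifs at hE ⊢ with hp
  · simp only [Function.update_apply] at hE ⊢
    split_ifs at hE with h4
    · exact absurd hE (lt_irrefl _)
    · rcases Nat.lt_succ_iff_lt_or_eq.1 hc with hc | rfl
      exacts [h2 c hc hic hE, absurd rfl h4]
  · rcases Nat.lt_succ_iff_lt_or_eq.1 hc with hc | rfl
    · exact h2 c hc hic hE
    · by_contra h4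
      exact hp ⟨hic, hE, by omega⟩

theorem sweep_pushH {s : Preflow} (h : N.Inv cap s) :
    (N.Inv cap (sweep N.pushH N.K s) ∧ ∀ c < N.K, N.ins c →
      0 < (sweep N.pushH N.K s).G (N.hid c) → 0 < (sweep N.pushH N.K s).F c →
      (sweep N.pushH N.K s).DH (N.hid c) ≤ (sweep N.pushH N.K s).DV (N.vid c)) ∧
    ((sweep N.pushH N.K s = s ∧ ∀ c < N.K, N.pushH c s = s) ∨
      N.potential cap (sweep N.pushH N.K s) < N.potential cap s) := by
  refine sweep_spec (fun i s => N.Inv cap s ∧ ∀ c < i, N.ins c →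
      0 < s.G (N.hid c) → 0 < s.F c → s.DH (N.hid c) ≤ s.DV (N.vid c)) N.K s ⟨h, by simp⟩ ?_
  rintro i hi s ⟨h1, h2⟩
  refine ⟨⟨h1.pushH hi, fun c hc hic hG hF => ?_⟩, potential_pushH h1 hi⟩
  have h3 := h1.backward c (by omega) hic
  have h4 : 0 ≤ s.F i := h1.F_nonneg i
  unfold pushH at hG hF ⊢
  split_ifs at hG hF ⊢ with hp hFG
  · simp only [Function.update_apply] at hG hF ⊢
    split_ifs at hF with h5
    · exact absurd hF (lt_irrefl _)
    · refine h2 c (by omega) hic ?_ hF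
      split_ifs at hG with h6
      · rw [h6]; linarith
      · exact hG
  · simp only [Function.update_apply] at hG hF ⊢
    split_ifs at hG with h6
    · exact absurd hG (lt_irrefl _)
    · have h5 : c ≠ i := fun h => h6 (by rw [h])
      rw [if_neg h5] at hF
      exact h2 c (by omega) hic hG hF
  · rcases Nat.lt_succ_iff_lt_or_eq.1 hc with hc | rfl
    · exact h2 c hc hic hG hF
    · by_contra h4
      exact hp ⟨hic, hG, hF, by have := h3 hF; omega⟩

theorem sweep_liftV {s : Preflow} (h : N.Inv cap s)
    (hs : ∀ c < N.K, N.ins c → 0 < s.E (N.vid c) → s.DV (N.vid c) ≤ s.DH (N.hid c)) :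
    N.Inv cap (sweep (liftV cap) N.K s) ∧
    ((sweep (liftV cap) N.K s = s ∧ ∀ u < N.K, liftV cap u s = s) ∨
      N.potential cap (sweep (liftV cap) N.K s) < N.potential cap s) := by
  have := sweep_spec (N := N) (cap := cap) (f := liftV cap)
    (fun i s => N.Inv cap s ∧ ∀ c < N.K, N.ins c → i ≤ N.vid c →
      0 < s.E (N.vid c) → s.DV (N.vid c) ≤ s.DH (N.hid c)) N.K s
      ⟨h, fun c hc hi _ => hs c hc hi⟩ ?_
  · exact ⟨this.1.1, this.2⟩
  rintro i hi s ⟨h1, h2⟩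
  refine ⟨⟨h1.liftV fun c hc hic hv hE => ?_, fun c hc hic hv hE => ?_⟩, potential_liftV hi⟩
  · have := h2 c hc hic hv.ge
    rw [hv] at this
    exact this hE
  · unfold liftV at hE ⊢
    split_ifs at hE ⊢
    · simp only
      rw [Function.update_of_ne (by omega)]
      exact h2 c hc hic (by omega) hE
    · exact h2 c hc hic (by omega) hE

theorem sweep_liftH {s : Preflow} (h : N.Inv cap s)
    (hs : ∀ c < N.K, N.ins c → 0 < s.G (N.hid c) → 0 < s.F c →
      s.DH (N.hid c) ≤ s.DV (N.vid c)) :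
    N.Inv cap (sweep (liftH cap) N.K s) ∧
    ((sweep (liftH cap) N.K s = s ∧ ∀ u < N.K, liftH cap u s = s) ∨
      N.potential cap (sweep (liftH cap) N.K s) < N.potential cap s) := by
  have := sweep_spec (N := N) (cap := cap) (f := liftH cap)
    (fun i s => N.Inv cap s ∧ ∀ c < N.K, N.ins c → i ≤ N.hid c →
      0 < s.G (N.hid c) → 0 < s.F c → s.DH (N.hid c) ≤ s.DV (N.vid c)) N.K s
      ⟨h, fun c hc hi _ => hs c hc hi⟩ ?_
  · exact ⟨this.1.1, this.2⟩
  rintro i hi s ⟨h1, h2⟩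
  refine ⟨⟨h1.liftH fun c hc hic hv hE => ?_, fun c hc hic hv hE hF => ?_⟩, potential_liftH hi⟩
  · have := h2 c hc hic hv.ge
    rw [hv] at this
    exact this hE
  · unfold liftH at hE hF ⊢
    split_ifs at hE hF ⊢
    · simp only
      rw [Function.update_of_ne (by omega)]
      exact h2 c hc hic (by omega) hE hF
    · exact h2 c hc hic (by omega) hE hF

/-- All nodes with excess have the maximum label. -/
def Done (N : BipartiteGraph) (cap : ℕ) (s : Preflow) : Prop :=
  ∀ u < N.K, (0 < s.E u → cap ≤ s.DV u) ∧ (0 < s.G u → cap ≤ s.DH u)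

/-- A round makes progress unless the method is done. -/
theorem round_spec {s : Preflow} (h : N.Inv cap s) :
    N.Inv cap (N.round cap s) ∧ ((N.round cap s = s ∧ N.Done cap s) ∨
      N.potential cap (N.round cap s) < N.potential cap s) := by
  obtain ⟨⟨i1, a1⟩, d1⟩ := sweep_pushV h
  obtain ⟨i2, d2⟩ := sweep_liftV i1 a1
  obtain ⟨⟨i3, a3⟩, d3⟩ := sweep_pushH i2
  obtain ⟨i4, d4⟩ := sweep_liftH i3 a3
  refine ⟨i4, ?_⟩
  unfold round
  rcases d1 with ⟨d1, -⟩ | d1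
  · rw [d1] at d2 d3 d4 ⊢
    rcases d2 with ⟨d2, e2⟩ | d2
    · rw [d2] at d3 d4 ⊢
      rcases d3 with ⟨d3, -⟩ | d3
      · rw [d3] at d4 ⊢
        rcases d4 with ⟨d4, e4⟩ | d4
        · refine Or.inl ⟨d4, fun u hu => ⟨fun hE => ?_, fun hG => ?_⟩⟩
          · by_contra hc
            have := congrArg (fun s => s.DV u) (e2 u hu)
            simp [liftV, hE, not_le.1 hc] at this
          · by_contra hc
            have := congrArg (fun s => s.DH u) (e4 u hu)
            simp [liftH, hG, not_le.1 hc] at this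
        · exact Or.inr d4
      · rcases d4 with ⟨d4, -⟩ | d4
        · rw [d4]; exact Or.inr d3
        · exact Or.inr (d4.trans d3)
    · rcases d3 with ⟨d3, -⟩ | d3
      · rw [d3] at d4 ⊢
        rcases d4 with ⟨d4, -⟩ | d4
        · rw [d4]; exact Or.inr d2
        · exact Or.inr (d4.trans d2)
      · rcases d4 with ⟨d4, -⟩ | d4
        · rw [d4]; exact Or.inr (d3.trans d2)
        · exact Or.inr (d4.trans (d3.trans d2))
  · right
    have e2 : N.potential cap (sweep (liftV cap) N.K (sweep N.pushV N.K s)) <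
        N.potential cap s := by
      rcases d2 with ⟨d2, -⟩ | d2
      · rwa [d2]
      · exact d2.trans d1
    have e3 : N.potential cap (sweep N.pushH N.K (sweep (liftV cap) N.K (sweep N.pushV N.K s))) <
        N.potential cap s := by
      rcases d3 with ⟨d3, -⟩ | d3
      · rwa [d3]
      · exact d3.trans e2
    rcases d4 with ⟨d4, -⟩ | d4
    · rwa [d4]
    · exact d4.trans e3

theorem iterate_round_spec {s : Preflow} (h : N.Inv cap s) {m : ℕ}
    (hm : N.potential cap s < m) :
    N.Inv cap ((N.round cap)^[m] s) ∧ N.Done cap ((N.round cap)^[m] s) := by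
  have key : ∀ m, N.Inv cap ((N.round cap)^[m] s) ∧ (N.Done cap ((N.round cap)^[m] s) ∧
      N.round cap ((N.round cap)^[m] s) = (N.round cap)^[m] s ∨
      N.potential cap ((N.round cap)^[m] s) + m ≤ N.potential cap s) := by
    intro m
    induction m with
    | zero => exact ⟨h, Or.inr le_rfl⟩
    | succ m ih =>
      rw [Function.iterate_succ_apply']
      obtain ⟨h1, h2⟩ := round_spec ih.1
      refine ⟨h1, ?_⟩
      rcases ih.2 with ⟨h3, h4⟩ | h3
      · left; rw [h4]; exact ⟨h3, h4⟩
      · rcases h2 with ⟨h2, h4⟩ | h2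
        · left; rw [h2]; exact ⟨h4, h2⟩
        · right; omega
  refine ⟨(key m).1, ?_⟩
  rcases (key m).2 with h1 | h1
  · exact h1.1
  · omega

open Classical in
theorem sum_outflow (F : ℕ → ℝ) (A : ℕ → Prop) [DecidablePred A] :
    ∑ u ∈ Finset.range N.K, (if A u then N.outflow F u else 0) =
      ∑ c ∈ Finset.range N.K, if N.ins c ∧ A (N.vid c) then F c else 0 := by
  have h1 : ∀ u, (if A u then N.outflow F u else 0) = ∑ c ∈ Finset.range N.K,
      if N.vid c = u then (if N.ins c ∧ A (N.vid c) then F c else 0) else 0 := by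
    intro u
    unfold outflow
    split_ifs with hA
    · refine Finset.sum_congr rfl fun c _ => ?_
      by_cases h : N.vid c = u <;> simp [h, hA]
    · symm
      refine Finset.sum_eq_zero fun c _ => ?_
      by_cases h : N.vid c = u <;> simp [h, hA]
  rw [Finset.sum_congr rfl fun u _ => h1 u, Finset.sum_comm]
  refine Finset.sum_congr rfl fun c hc => ?_
  rw [Finset.sum_ite_eq]
  by_cases hi : N.ins c
  · rw [if_pos (Finset.mem_range.2 (N.vid_lt c (Finset.mem_range.1 hc) hi))]
  · simp [hi]

open Classical in
theorem sum_inflow (F : ℕ → ℝ) (A : ℕ → Prop) [DecidablePred A] :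
    ∑ u ∈ Finset.range N.K, (if A u then N.inflow F u else 0) =
      ∑ c ∈ Finset.range N.K, if N.ins c ∧ A (N.hid c) then F c else 0 := by
  have h1 : ∀ u, (if A u then N.inflow F u else 0) = ∑ c ∈ Finset.range N.K,
      if N.hid c = u then (if N.ins c ∧ A (N.hid c) then F c else 0) else 0 := by
    intro u
    unfold inflow
    split_ifs with hA
    · refine Finset.sum_congr rfl fun c _ => ?_
      by_cases h : N.hid c = u <;> simp [h, hA]
    · symm
      refine Finset.sum_eq_zero fun c _ => ?_
      by_cases h : N.hid c = u <;> simp [h, hA]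
  rw [Finset.sum_congr rfl fun u _ => h1 u, Finset.sum_comm]
  refine Finset.sum_congr rfl fun c hc => ?_
  rw [Finset.sum_ite_eq]
  by_cases hi : N.ins c
  · rw [if_pos (Finset.mem_range.2 (N.hid_lt c (Finset.mem_range.1 hc) hi))]
  · simp [hi]

/-- The total weight of a pair of node sets. -/
noncomputable def weight (N : BipartiteGraph) (A B : ℕ → Prop) : ℝ := by
  classical exact ∑ u ∈ Finset.range N.K, (if A u then N.wV u else 0) +
    ∑ u ∈ Finset.range N.K, (if B u then N.wH u else 0)

/-- `A` and `B` together contain an end of every edge. -/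
def IsVertexCover (N : BipartiteGraph) (A B : ℕ → Prop) : Prop :=
  ∀ c < N.K, N.ins c → A (N.vid c) ∨ B (N.hid c)

/-- A label that no node has splits the nodes into a vertex cover. -/
theorem isVertexCover_of_gap {s : Preflow} (h : N.Inv cap s) {g : ℕ}
    (hV : ∀ u < N.K, s.DV u ≠ g) (hH : ∀ u < N.K, s.DH u ≠ g) :
    N.IsVertexCover (fun u => s.DV u < g) (fun u => g < s.DH u) := by
  intro c hc hi
  have h1 := h.forward c hc hi
  have h2 := hV _ (N.vid_lt c hc hi)
  have h3 := hH _ (N.hid_lt c hc hi)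
  simp only
  omega

/-- The vertex cover at a gap of the labels has minimum weight: the part of the flow that the right
nodes can absorb is at most the weight of any vertex cover, and equals the weight of this one. -/
theorem weight_gap_le {s : Preflow} (h : N.Inv cap s) (hd : N.Done cap s) {g : ℕ} (hg : 1 ≤ g)
    (hgc : g ≤ cap) (hV : ∀ u < N.K, s.DV u ≠ g) (hH : ∀ u < N.K, s.DH u ≠ g)
    {C D : ℕ → Prop} (hC : ∀ u, C u ↔ s.DV u < g) (hD : ∀ u, D u ↔ g < s.DH u)
    {A B : ℕ → Prop} (hAB : N.IsVertexCover A B) : N.weight C D ≤ N.weight A B := by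
  classical
  have upper : N.weight C D ≤
      ∑ u ∈ Finset.range N.K, min (N.inflow s.F u) (N.wH u) := by
    have e1 : ∑ u ∈ Finset.range N.K, (if C u then N.wV u else 0) =
        ∑ u ∈ Finset.range N.K, (if C u then N.outflow s.F u else 0) := by
      refine Finset.sum_congr rfl fun u hu => ?_
      rw [Finset.mem_range] at hu
      split_ifs with h1
      · have h2 := h.E_eq u hu
        have h3 := h.E_nonneg u
        have h4 : ¬ 0 < s.E u := fun hE => by have := (hd u hu).1 hE; have := (hC u).1 h1; omega
        linarith
      · rfl
    have e2 : ∑ c ∈ Finset.range N.K, (if N.ins c ∧ C (N.vid c) then s.F c else 0) =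
        ∑ c ∈ Finset.range N.K, (if N.ins c ∧ ¬ D (N.hid c) then s.F c else 0) := by
      refine Finset.sum_congr rfl fun c hc => ?_
      rw [Finset.mem_range] at hc
      by_cases hi : N.ins c
      · have h1 := h.forward c hc hi
        have h2 := h.backward c hc hi
        have h3 := hV _ (N.vid_lt c hc hi)
        have h4 := hH _ (N.hid_lt c hc hi)
        rcases (h.F_nonneg c).eq_or_lt with h5 | h5
        · simp [← h5]
        · have h6 := h2 h5
          simp only [hi, true_and]
          congr 1
          rw [hC, hD, eq_iff_iff]
          constructor <;> intro <;> omega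
      · simp [hi]
    unfold weight
    rw [e1, sum_outflow s.F C, e2,
      ← sum_inflow s.F (fun u => ¬ D u), ← Finset.sum_add_distrib]
    refine Finset.sum_le_sum fun u hu => ?_
    rw [Finset.mem_range] at hu
    have h1 := h.G_eq u hu
    have h2 := hH u hu
    by_cases h3 : D u
    · rw [if_neg (by simpa using h3), if_pos h3, zero_add, le_min_iff]
      refine ⟨?_, le_rfl⟩
      by_contra h4
      have := h.unsaturated u (by linarith)
      have := (hD u).1 h3
      omega
    · rw [if_pos h3, if_neg h3, add_zero, le_min_iff]
      refine ⟨le_rfl, ?_⟩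
      by_contra h4
      have := (hd u hu).2 (by linarith)
      have := mt (hD u).2 h3
      omega
  have lower : ∑ u ∈ Finset.range N.K, min (N.inflow s.F u) (N.wH u) ≤ N.weight A B := by
    have e1 : ∑ u ∈ Finset.range N.K, min (N.inflow s.F u) (N.wH u) ≤
        ∑ u ∈ Finset.range N.K, (if ¬ B u then N.inflow s.F u else 0) +
        ∑ u ∈ Finset.range N.K, (if B u then N.wH u else 0) := by
      rw [← Finset.sum_add_distrib]
      refine Finset.sum_le_sum fun u _ => ?_
      by_cases hB : B u <;> simp [hB]
    have e2 : ∑ c ∈ Finset.range N.K, (if N.ins c ∧ ¬ B (N.hid c) then s.F c else 0) ≤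
        ∑ c ∈ Finset.range N.K, (if N.ins c ∧ A (N.vid c) then s.F c else 0) := by
      refine Finset.sum_le_sum fun c hc => ?_
      rw [Finset.mem_range] at hc
      have h1 := h.F_nonneg c
      split_ifs with h2 h3 h3
      · exact le_rfl
      · exact absurd ⟨h2.1, (hAB c hc h2.1).resolve_right h2.2⟩ h3
      · exact h1
      · exact le_rfl
    have e3 : ∑ u ∈ Finset.range N.K, (if A u then N.outflow s.F u else 0) ≤
        ∑ u ∈ Finset.range N.K, (if A u then N.wV u else 0) := by
      refine Finset.sum_le_sum fun u hu => ?_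
      have h1 := h.E_eq u (Finset.mem_range.1 hu)
      have h2 := h.E_nonneg u
      split_ifs
      · linarith
      · exact le_rfl
    rw [sum_inflow (N := N) s.F (fun u => ¬ B u)] at e1
    rw [sum_outflow] at e3
    unfold weight
    linarith
  exact upper.trans lower

/-- The preflow with which the method starts. -/
def initial (N : BipartiteGraph) (s : Preflow) : Prop :=
  s.E = N.wV ∧ s.G = (fun u => - N.wH u) ∧ s.F = (fun _ => 0) ∧ s.DV = (fun _ => 0) ∧
    s.DH = (fun _ => 0)

theorem Inv.of_initial {s : Preflow} (h : N.initial s) (hV : ∀ u, 0 ≤ N.wV u) : N.Inv cap s := by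
  obtain ⟨h1, h2, h3, h4, h5⟩ := h
  constructor <;> simp [h1, h2, h3, h4, h5, hV, outflow, inflow]

theorem potential_initial {s : Preflow} (h : N.initial s) :
    N.potential (2 * N.K + 2) s < (2 * N.K + 2) ^ 4 := by
  obtain ⟨-, -, h3, h4, h5⟩ := h
  have hA : N.admissible s = ∅ := by simp [admissible, h3]
  have hS : N.activeSum s = 0 := by simp [activeSum, h4, h5]
  have hR : N.room (2 * N.K + 2) s = N.K * (2 * N.K + 2) + N.K * (2 * N.K + 2) := by
    simp [room, h4, h5]
  unfold potential
  rw [hA, hS, hR]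
  simp only [Finset.card_empty, mul_zero, add_zero]
  generalize N.K = k
  ring_nf
  nlinarith [sq_nonneg k]

theorem exists_gap (s : Preflow) :
    ∃ g, 1 ≤ g ∧ g ≤ 2 * N.K + 2 ∧ (∀ u < N.K, s.DV u ≠ g) ∧ ∀ u < N.K, s.DH u ≠ g := by
  obtain ⟨g, hg, hg'⟩ := Finset.exists_mem_notMem_of_card_lt_card
    (s := (Finset.range N.K).image s.DV ∪ (Finset.range N.K).image s.DH)
    (t := Finset.Icc 1 (2 * N.K + 2)) (by
      refine (Finset.card_union_le _ _).trans_lt ?_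
      have h1 := Finset.card_image_le (s := Finset.range N.K) (f := s.DV)
      have h2 := Finset.card_image_le (s := Finset.range N.K) (f := s.DH)
      simp only [Finset.card_range, Nat.card_Icc] at *
      omega)
  rw [Finset.mem_Icc] at hg
  simp only [Finset.mem_union, Finset.mem_image, Finset.mem_range, not_or, not_exists,
    not_and] at hg'
  exact ⟨g, hg.1, hg.2, hg'.1, hg'.2⟩

end BipartiteGraph

open Set

/-! ### Polygons as unions of grid cells -/

theorem mem_segment_vertical {x a b : ℝ} {p : Point} :
    p ∈ segment ℝ (x, a) (x, b) ↔ p.1 = x ∧ p.2 ∈ uIcc a b := by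
  rw [← Prod.image_mk_segment_right, segment_eq_uIcc]
  constructor
  · rintro ⟨y, hy, rfl⟩; exact ⟨rfl, hy⟩
  · rintro ⟨h1, h2⟩; exact ⟨p.2, h2, by rw [← h1]⟩

theorem mem_segment_horizontal {y a b : ℝ} {p : Point} :
    p ∈ segment ℝ (a, y) (b, y) ↔ p.2 = y ∧ p.1 ∈ uIcc a b := by
  rw [← Prod.image_mk_segment_left, segment_eq_uIcc]
  constructor
  · rintro ⟨x, hx, rfl⟩; exact ⟨rfl, hx⟩
  · rintro ⟨h1, h2⟩; exact ⟨p.1, h2, by rw [← h1]⟩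

/-- A connected set that avoids the frontier of `P` lies inside or outside of `P`. -/
theorem IsPreconnected.subset_or_disjoint_of_frontier {α : Type*} [TopologicalSpace α]
    {S P : Set α} (hS : IsPreconnected S) (h : Disjoint S (frontier P)) :
    S ⊆ interior P ∨ Disjoint S (closure P) := by
  have h1 : S ⊆ interior P ∪ (closure P)ᶜ := by
    intro x hx
    have h2 := disjoint_left.1 h hx
    rw [frontier, mem_sdiff, not_and_not_right] at h2
    by_cases h3 : x ∈ closure P
    exacts [Or.inl (h2 h3), Or.inr h3]
  refine (hS.subset_or_subset isOpen_interior isClosed_closure.isOpen_compl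
    (disjoint_compl_right_iff_subset.2 (interior_subset.trans subset_closure)) h1).imp_right ?_
  exact subset_compl_iff_disjoint_right.1

theorem isPreconnected_rectangle (a b c d : ℝ) : IsPreconnected (Ioo a b ×ˢ Ioo c d) :=
  isPreconnected_Ioo.prod isPreconnected_Ioo

section Flip

variable {P : Set Point} {x₁ x₂ y₀ y₁ y₂ : ℝ}

/-- Two rectangles on both sides of a segment without frontier points are on the same side of the
frontier. -/
theorem rectangle_subset_iff_of_disjoint (hx : x₁ < x₂) (h₀ : y₀ < y₁) (h₂ : y₁ < y₂)
    (hd₀ : Disjoint (Ioo x₁ x₂ ×ˢ Ioo y₀ y₁) (frontier P))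
    (hd₂ : Disjoint (Ioo x₁ x₂ ×ˢ Ioo y₁ y₂) (frontier P))
    (hd : Disjoint (Ioo x₁ x₂ ×ˢ {y₁}) (frontier P)) :
    Ioo x₁ x₂ ×ˢ Ioo y₁ y₂ ⊆ P ↔ Ioo x₁ x₂ ×ˢ Ioo y₀ y₁ ⊆ P := by
  have hU : Disjoint (Ioo x₁ x₂ ×ˢ Ioo y₀ y₂) (frontier P) := by
    rw [disjoint_left] at *
    rintro ⟨x, y⟩ ⟨h1, h2⟩
    rcases lt_trichotomy y y₁ with h3 | h3 | h3
    · exact hd₀ ⟨h1, h2.1, h3⟩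
    · exact hd ⟨h1, h3⟩
    · exact hd₂ ⟨h1, h3, h2.2⟩
  obtain ⟨x, hx⟩ := exists_between hx
  obtain ⟨y, hy⟩ := exists_between h₀
  obtain ⟨z, hz⟩ := exists_between h₂
  rcases (isPreconnected_rectangle _ _ _ _).subset_or_disjoint_of_frontier hU with h | h
  · refine iff_of_true (fun p hp => ?_) (fun p hp => ?_)
    · exact interior_subset (h ⟨hp.1, h₀.trans hp.2.1, hp.2.2⟩)
    · exact interior_subset (h ⟨hp.1, hp.2.1, hp.2.2.trans h₂⟩)
  · refine iff_of_false (fun h' => ?_) (fun h' => ?_)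
    · exact h.notMem_of_mem_left (a := (x, z)) ⟨hx, h₀.trans hz.1, hz.2⟩
        (subset_closure (h' ⟨hx, hz⟩))
    · exact h.notMem_of_mem_left (a := (x, y)) ⟨hx, hy.1, hy.2.trans h₂⟩
        (subset_closure (h' ⟨hx, hy⟩))

/-- Two rectangles on both sides of a segment of frontier points are on different sides of the
frontier, because `P` is closed and has no lower-dimensional parts. -/
theorem rectangle_subset_iff_of_subset_frontier (hc : closure (interior P) = P)
    (hx : x₁ < x₂) (h₀ : y₀ < y₁) (h₂ : y₁ < y₂)
    (hd₀ : Disjoint (Ioo x₁ x₂ ×ˢ Ioo y₀ y₁) (frontier P))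
    (hd₂ : Disjoint (Ioo x₁ x₂ ×ˢ Ioo y₁ y₂) (frontier P))
    (hs : Ioo x₁ x₂ ×ˢ {y₁} ⊆ frontier P) :
    Ioo x₁ x₂ ×ˢ Ioo y₁ y₂ ⊆ P ↔ ¬ Ioo x₁ x₂ ×ˢ Ioo y₀ y₁ ⊆ P := by
  have hP : IsClosed P := hc ▸ isClosed_closure
  obtain ⟨x, hx⟩ := exists_between hx
  have hm : ((x, y₁) : Point) ∈ frontier P := hs ⟨hx, rfl⟩
  have hopen : IsOpen (Ioo x₁ x₂ ×ˢ Ioo y₀ y₂) := isOpen_Ioo.prod isOpen_Ioo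
  have hxm : ((x, y₁) : Point) ∈ Ioo x₁ x₂ ×ˢ Ioo y₀ y₂ := ⟨hx, h₀, h₂⟩
  constructor
  · intro hup hlow
    -- then the rectangle would be a neighbourhood of `(x, y₁)` within `P`
    refine hm.2 (mem_interior.2 ⟨_, ?_, hopen, hxm⟩)
    rintro ⟨u, v⟩ ⟨h1, h2⟩
    rcases lt_trichotomy v y₁ with h3 | h3 | h3
    · exact hlow ⟨h1, h2.1, h3⟩
    · subst h3; exact hP.frontier_subset (hs ⟨h1, rfl⟩)
    · exact hup ⟨h1, h3, h2.2⟩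
  · intro hlow
    by_contra hup
    have d₀ := ((isPreconnected_rectangle _ _ _ _).subset_or_disjoint_of_frontier hd₀).resolve_left
      fun h => hlow (h.trans interior_subset)
    have d₂ := ((isPreconnected_rectangle _ _ _ _).subset_or_disjoint_of_frontier hd₂).resolve_left
      fun h => hup (h.trans interior_subset)
    -- then `interior P` would meet the rectangle only in a horizontal line
    have h1 : ((x, y₁) : Point) ∈ closure (interior P) := hc.symm ▸ hP.frontier_subset hm
    obtain ⟨⟨u, v⟩, huv, hi⟩ := mem_closure_iff.1 h1 _ hopen hxm
    have h3 : ∀ w ∈ Ioo x₁ x₂ ×ˢ Ioo y₀ y₂ ∩ interior P, w.2 = y₁ := by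
      rintro ⟨s, t⟩ ⟨⟨h1, h2⟩, h4⟩
      have h5 := subset_closure (interior_subset h4)
      rcases lt_trichotomy t y₁ with h3 | h3 | h3
      · exact absurd h5 (disjoint_left.1 d₀ ⟨h1, h2.1, h3⟩)
      · exact h3
      · exact absurd h5 (disjoint_left.1 d₂ ⟨h1, h3, h2.2⟩)
    have h4 : Prod.mk u ⁻¹' (Ioo x₁ x₂ ×ˢ Ioo y₀ y₂ ∩ interior P) ⊆ {y₁} := fun w hw => h3 _ hw
    have h5 : IsOpen (Prod.mk u ⁻¹' (Ioo x₁ x₂ ×ˢ Ioo y₀ y₂ ∩ interior P)) :=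
      (hopen.inter isOpen_interior).preimage (by fun_prop)
    have h6 := interior_mono h4 (by rw [h5.interior_eq]; exact ⟨huv, hi⟩ :
      v ∈ interior (Prod.mk u ⁻¹' (Ioo x₁ x₂ ×ˢ Ioo y₀ y₂ ∩ interior P)))
    simp at h6

end Flip

/-- The lines `x = X i` and `y = Y j` with `i, j ≤ N` form a grid whose open cells contain no
frontier points of `P` and that surrounds `P`. Cells of width or height zero are allowed, but only in
the last columns and rows. -/
structure IsGrid (P : Set Point) (N : ℕ) (X Y : ℕ → ℝ) : Prop where
  isCompact : IsCompact P
  closure_interior : closure (interior P) = P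
  monoX : ∀ i < N, X i ≤ X (i + 1)
  monoY : ∀ j < N, Y j ≤ Y (j + 1)
  strictX : ∀ i, i + 1 < N → X (i + 1) < X (i + 2) → X i < X (i + 1)
  strictY : ∀ j, j + 1 < N → Y (j + 1) < Y (j + 2) → Y j < Y (j + 1)
  frontier_bdd : ∀ p ∈ frontier P, X 0 ≤ p.1 ∧ p.1 ≤ X N ∧ Y 0 ≤ p.2 ∧ p.2 ≤ Y N
  frontier_grid : ∀ p ∈ frontier P, (∀ i < N, p.1 ∉ Ioo (X i) (X (i + 1))) ∨
    ∀ j < N, p.2 ∉ Ioo (Y j) (Y (j + 1))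

/-- The grid cell `(i, j)` is nondegenerate and contained in `P`. -/
def InCell (P : Set Point) (X Y : ℕ → ℝ) (i j : ℕ) : Prop :=
  X i < X (i + 1) ∧ Y j < Y (j + 1) ∧ Ioo (X i) (X (i + 1)) ×ˢ Ioo (Y j) (Y (j + 1)) ⊆ P

theorem inCell_swap {P : Set Point} {X Y : ℕ → ℝ} {i j : ℕ} :
    InCell (Prod.swap ⁻¹' P) Y X j i ↔ InCell P X Y i j := by
  unfold InCell
  constructor
  · rintro ⟨h1, h2, h3⟩
    exact ⟨h2, h1, fun p hp => h3 (a := p.swap) ⟨hp.2, hp.1⟩⟩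
  · rintro ⟨h1, h2, h3⟩
    exact ⟨h2, h1, fun p hp => h3 (a := p.swap) ⟨hp.2, hp.1⟩⟩

/-- A sequence passes every value between its first and its last term. -/
theorem exists_index_le_lt {f : ℕ → ℝ} {x : ℝ} {n : ℕ} (h0 : f 0 ≤ x) (hn : x < f n) :
    ∃ i < n, f i ≤ x ∧ x < f (i + 1) := by
  induction n with
  | zero => exact absurd hn (not_lt.2 h0)
  | succ n ih =>
    by_cases h : x < f n
    · obtain ⟨i, hi, h'⟩ := ih h
      exact ⟨i, by omega, h'⟩
    · exact ⟨n, by omega, not_lt.1 h, hn⟩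

namespace IsGrid

variable {P : Set Point} {N : ℕ} {X Y : ℕ → ℝ}

theorem swap (h : IsGrid P N X Y) : IsGrid (Prod.swap ⁻¹' P) N Y X := by
  have e : Prod.swap ⁻¹' P = (Homeomorph.prodComm ℝ ℝ) ⁻¹' P := rfl
  have hf : ∀ p, p ∈ frontier (Prod.swap ⁻¹' P) → p.swap ∈ frontier P := by
    intro p hp
    rw [e, ← Homeomorph.preimage_frontier] at hp
    exact hp
  refine ⟨?_, ?_, h.monoY, h.monoX, h.strictY, h.strictX, fun p hp => ?_, fun p hp => ?_⟩
  · rw [e, Homeomorph.isCompact_preimage]; exact h.isCompact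
  · rw [e, ← Homeomorph.preimage_interior, ← Homeomorph.preimage_closure, h.closure_interior]
  · obtain ⟨h1, h2, h3, h4⟩ := h.frontier_bdd _ (hf p hp)
    exact ⟨h3, h4, h1, h2⟩
  · exact (h.frontier_grid _ (hf p hp)).symm

variable (h : IsGrid P N X Y)
include h

theorem isClosed : IsClosed P := h.isCompact.isClosed

theorem X_mono {i j : ℕ} (hij : i ≤ j) (hj : j ≤ N) : X i ≤ X j := by
  induction j, hij using Nat.le_induction with
  | base => exact le_rfl
  | succ j _ ih => exact (ih (by omega)).trans (h.monoX j (by omega))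

theorem X_lt {i j : ℕ} (hij : i ≤ j) (hj : j < N) (hlt : X j < X (j + 1)) :
    X i < X (i + 1) := by
  induction j, hij using Nat.le_induction with
  | base => exact hlt
  | succ j _ ih => exact ih (by omega) (h.strictX j hj hlt)

theorem disjoint_cell {i j : ℕ} (hi : i < N) (hj : j < N) :
    Disjoint (Ioo (X i) (X (i + 1)) ×ˢ Ioo (Y j) (Y (j + 1))) (frontier P) := by
  rw [disjoint_left]
  rintro p ⟨h1, h2⟩ hp
  rcases h.frontier_grid p hp with h3 | h3
  exacts [h3 i hi h1, h3 j hj h2]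

/-- A cell that contains a point of `P` in its interior is contained in `P`. -/
theorem inCell_of_mem {i j : ℕ} (hi : i < N) (hj : j < N) {p : Point} (hp : p ∈ P)
    (h1 : p.1 ∈ Ioo (X i) (X (i + 1))) (h2 : p.2 ∈ Ioo (Y j) (Y (j + 1))) : InCell P X Y i j := by
  refine ⟨h1.1.trans h1.2, h2.1.trans h2.2, ?_⟩
  rcases (isPreconnected_rectangle _ _ _ _).subset_or_disjoint_of_frontier
    (h.disjoint_cell hi hj) with h3 | h3
  · exact h3.trans interior_subset
  · exact absurd (subset_closure hp) (disjoint_left.1 h3 ⟨h1, h2⟩)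

theorem closedCell_subset {i j : ℕ} (hc : InCell P X Y i j) :
    Icc (X i) (X (i + 1)) ×ˢ Icc (Y j) (Y (j + 1)) ⊆ P := by
  have h1 := closure_mono hc.2.2
  rwa [closure_prod_eq, closure_Ioo hc.1.ne, closure_Ioo hc.2.1.ne, h.isClosed.closure_eq] at h1

theorem le_fst {p : Point} (hp : p ∈ P) : X 0 ≤ p.1 := by
  by_contra hlt
  have hd : Disjoint (Iio (X 0) ×ˢ (univ : Set ℝ)) (frontier P) := by
    rw [disjoint_left]
    rintro q ⟨h1, -⟩ hq
    exact absurd h1 (not_lt.2 (h.frontier_bdd q hq).1)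
  rcases (isPreconnected_Iio.prod isPreconnected_univ).subset_or_disjoint_of_frontier hd with h1 | h1
  · -- a half plane is not bounded
    obtain ⟨m, hm⟩ := (h.isCompact.image continuous_fst).bddBelow
    have h2 : min m (X 0) - 1 < X 0 := by linarith [min_le_right m (X 0)]
    have h3 := hm ⟨_, interior_subset (h1 (a := (min m (X 0) - 1, 0)) ⟨h2, mem_univ _⟩), rfl⟩
    simp only at h3
    linarith [min_le_left m (X 0)]
  · exact h1.notMem_of_mem_left (a := p) ⟨not_le.1 hlt, mem_univ _⟩ (subset_closure hp)

theorem fst_le {p : Point} (hp : p ∈ P) : p.1 ≤ X N := by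
  by_contra hlt
  have hd : Disjoint (Ioi (X N) ×ˢ (univ : Set ℝ)) (frontier P) := by
    rw [disjoint_left]
    rintro q ⟨h1, -⟩ hq
    exact absurd h1 (not_lt.2 (h.frontier_bdd q hq).2.1)
  rcases (isPreconnected_Ioi.prod isPreconnected_univ).subset_or_disjoint_of_frontier hd with h1 | h1
  · obtain ⟨m, hm⟩ := (h.isCompact.image continuous_fst).bddAbove
    have h2 : X N < max m (X N) + 1 := by linarith [le_max_right m (X N)]
    have h3 := hm ⟨_, interior_subset (h1 (a := (max m (X N) + 1, 0)) ⟨h2, mem_univ _⟩), rfl⟩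
    simp only at h3
    linarith [le_max_left m (X N)]
  · exact h1.notMem_of_mem_left (a := p) ⟨not_le.1 hlt, mem_univ _⟩ (subset_closure hp)

/-- `P` is the union of the closed cells contained in it. -/
theorem exists_cell {p : Point} (hp : p ∈ P) : ∃ i < N, ∃ j < N, InCell P X Y i j ∧
    p.1 ∈ Icc (X i) (X (i + 1)) ∧ p.2 ∈ Icc (Y j) (Y (j + 1)) := by
  set S : Set (ℕ × ℕ) := {c | c.1 < N ∧ c.2 < N ∧ InCell P X Y c.1 c.2} with hS
  set Z : Set Point := ⋃ c ∈ S,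
    Icc (X c.1) (X (c.1 + 1)) ×ˢ Icc (Y c.2) (Y (c.2 + 1)) with hZ
  have hfin : S.Finite := ((finite_Iio N).prod (finite_Iio N)).subset fun c hc => ⟨hc.1, hc.2.1⟩
  have hZc : IsClosed Z := hfin.isClosed_biUnion fun c _ => isClosed_Icc.prod isClosed_Icc
  -- the points off the grid lines are dense
  have hdense : ∀ f : ℕ → ℝ, Dense (f '' Iic N)ᶜ := fun f =>
    ((finite_Iic N).image f).countable.dense_compl ℝ
  have hD := (hdense X).prod (hdense Y)
  have h1 : interior P ∩ (X '' Iic N)ᶜ ×ˢ (Y '' Iic N)ᶜ ⊆ Z := by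
    rintro q ⟨hq, hqX, hqY⟩
    have hqP := interior_subset hq
    have ne : ∀ {f : ℕ → ℝ} {x : ℝ}, x ∈ (f '' Iic N)ᶜ → ∀ i ≤ N, f i ≠ x :=
      fun hx i hi he => hx ⟨i, hi, he⟩
    obtain ⟨i, hi, hi1, hi2⟩ := exists_index_le_lt (h.le_fst hqP)
      (lt_of_le_of_ne (h.fst_le hqP) (ne hqX N le_rfl).symm)
    have hqs : q.swap ∈ Prod.swap ⁻¹' P := hqP
    obtain ⟨j, hj, hj1, hj2⟩ := exists_index_le_lt (h.swap.le_fst hqs)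
      (lt_of_le_of_ne (h.swap.fst_le hqs) (ne hqY N le_rfl).symm)
    have hc := h.inCell_of_mem hi hj hqP ⟨lt_of_le_of_ne hi1 (ne hqX i hi.le), hi2⟩
      ⟨lt_of_le_of_ne hj1 (ne hqY j hj.le), hj2⟩
    exact mem_biUnion (show (i, j) ∈ S from ⟨hi, hj, hc⟩) ⟨⟨hi1, hi2.le⟩, hj1, hj2.le⟩
  have h2 : P ⊆ Z := by
    rw [← h.closure_interior]
    refine closure_minimal ((hD.open_subset_closure_inter isOpen_interior).trans ?_) hZc
    exact closure_minimal h1 hZc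
  obtain ⟨c, hc, hpc⟩ := mem_iUnion₂.1 (h2 hp)
  exact ⟨c.1, hc.1, c.2, hc.2.1, hc.2.2, hpc.1, hpc.2⟩

/-- A cell of the lowest row belongs to `P` if and only if its bottom side is on the boundary. -/
theorem inCell_zero {i : ℕ} (hi : i < N) (hN : 0 < N) (hX : X i < X (i + 1)) (hY : Y 0 < Y 1)
    (hE : Ioo (X i) (X (i + 1)) ×ˢ {Y 0} ⊆ frontier P ∨
      Disjoint (Ioo (X i) (X (i + 1)) ×ˢ {Y 0}) (frontier P)) :
    InCell P X Y i 0 ↔ Ioo (X i) (X (i + 1)) ×ˢ {Y 0} ⊆ frontier P := by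
  -- the rectangle below the lowest row of cells is outside of `P`
  have hd : Disjoint (Ioo (X i) (X (i + 1)) ×ˢ Ioo (Y 0 - 1) (Y 0)) (frontier P) := by
    rw [disjoint_left]
    rintro q ⟨-, h1⟩ hq
    exact absurd h1.2 (not_lt.2 (h.frontier_bdd q hq).2.2.1)
  obtain ⟨x, hx⟩ := exists_between hX
  have hn : ¬ Ioo (X i) (X (i + 1)) ×ˢ Ioo (Y 0 - 1) (Y 0) ⊆ P := by
    intro hs
    have hm : ((x, Y 0 - 1 / 2) : Point) ∈ P := hs ⟨hx, by norm_num, by norm_num⟩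
    have h2 := h.swap.le_fst (p := (Y 0 - 1 / 2, x)) hm
    norm_num at h2
  have h0 : Y 0 - 1 < Y 0 := by linarith
  unfold InCell
  rw [and_iff_right hX, and_iff_right hY]
  rcases hE with hE | hE
  · rw [rectangle_subset_iff_of_subset_frontier h.closure_interior hX h0 hY hd
      (h.disjoint_cell hi hN) hE]
    exact iff_of_true hn hE
  · rw [rectangle_subset_iff_of_disjoint hX h0 hY hd (h.disjoint_cell hi hN) hE]
    refine iff_of_false hn fun hs => ?_
    exact hE.notMem_of_mem_left (a := (x, Y 0)) ⟨hx, rfl⟩ (hs ⟨hx, rfl⟩)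

/-- Membership in `P` changes from a cell to the one above it if and only if their common side is on
the boundary. -/
theorem inCell_succ {i j : ℕ} (hi : i < N) (hj : j + 1 < N) (hX : X i < X (i + 1))
    (hY : Y (j + 1) < Y (j + 2))
    (hE : Ioo (X i) (X (i + 1)) ×ˢ {Y (j + 1)} ⊆ frontier P ∨
      Disjoint (Ioo (X i) (X (i + 1)) ×ˢ {Y (j + 1)}) (frontier P)) :
    InCell P X Y i (j + 1) ↔
      ¬ (InCell P X Y i j ↔ Ioo (X i) (X (i + 1)) ×ˢ {Y (j + 1)} ⊆ frontier P) := by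
  have hY0 := h.strictY j hj hY
  obtain ⟨x, hx⟩ := exists_between hX
  unfold InCell
  rw [and_iff_right hX, and_iff_right hX, and_iff_right hY, and_iff_right hY0]
  rcases hE with hE | hE
  · rw [rectangle_subset_iff_of_subset_frontier h.closure_interior hX hY0 hY
      (h.disjoint_cell hi (by omega)) (h.disjoint_cell hi hj) hE]
    simp [hE]
  · rw [rectangle_subset_iff_of_disjoint hX hY0 hY (h.disjoint_cell hi (by omega))
      (h.disjoint_cell hi hj) hE]
    have : ¬ Ioo (X i) (X (i + 1)) ×ˢ {Y (j + 1)} ⊆ frontier P := fun hs =>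
      hE.notMem_of_mem_left (a := (x, Y (j + 1))) ⟨hx, rfl⟩ (hs ⟨hx, rfl⟩)
    simp [this]

/-- Cells whose midlines are connected by a vertical segment in `P` belong to the same vertical run
of cells. -/
theorem inCell_of_vertical {i j k l : ℕ} {x : ℝ} (hi : i < N) (hx : x ∈ Ioo (X i) (X (i + 1)))
    (hjk : j ≤ k) (hkl : k ≤ l) (hl : l < N) (hlt : Y l < Y (l + 1))
    (hP : ∀ t ∈ Icc ((Y j + Y (j + 1)) / 2) ((Y l + Y (l + 1)) / 2), (x, t) ∈ P) :
    InCell P X Y i k := by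
  have h1 := h.swap.X_mono hjk (by omega)
  have h2 := h.swap.X_mono (i := j + 1) (j := k + 1) (by omega) (by omega)
  have h3 := h.swap.X_mono hkl (by omega)
  have h4 := h.swap.X_mono (i := k + 1) (j := l + 1) (by omega) (by omega)
  have h5 := h.swap.X_lt hkl hl hlt
  refine h.inCell_of_mem hi (by omega) (hP ((Y k + Y (k + 1)) / 2) ⟨by linarith, by linarith⟩)
    hx ⟨?_, ?_⟩ <;> simp only <;> linarith

omit h in
/-- Within a run of cells all vertical segments are contained in `P`. -/
theorem vertical_of_inCell (h : IsGrid P N X Y) {i j l : ℕ} {x : ℝ}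
    (hx : x ∈ Icc (X i) (X (i + 1)))
    (hc : ∀ k, j ≤ k → k ≤ l → InCell P X Y i k) {t : ℝ} (h1 : Y j ≤ t) (h2 : t ≤ Y (l + 1))
    (hjl : j ≤ l) : (x, t) ∈ P := by
  rcases h2.eq_or_lt with h2 | h2
  · have := h.closedCell_subset (hc l hjl le_rfl)
    exact this ⟨hx, by rw [h2]; exact (hc l hjl le_rfl).2.1.le, h2.le⟩
  · obtain ⟨m, hm, h3, h4⟩ := exists_index_le_lt (f := fun m => Y (j + m)) (n := l + 1 - j) h1
      (by simpa [show j + (l + 1 - j) = l + 1 by omega] using h2)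
    exact h.closedCell_subset (hc (j + m) (by omega) (by omega)) ⟨hx, h3, h4.le⟩

end IsGrid

/-! ### Lower bound for the length of the cameras -/

open MeasureTheory in
/-- If the points of finitely many open intervals, placed at heights `y v`, are all connected within
`P` by vertical segments to horizontal segments `s` with `a s ≤ x ≤ b s` at height `h s`, but not to
each other, then the total length of the intervals is at most that of the segments. -/
theorem sum_width_le_sum_length {ι κ : Type*} {P : Set Point} (hP : IsClosed P) (V : Finset ι)
    (S : Finset κ) (l r y : ι → ℝ) (a b h : κ → ℝ) (hlr : ∀ v ∈ V, l v ≤ r v)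
    (hab : ∀ s ∈ S, a s ≤ b s)
    (hcov : ∀ v ∈ V, ∀ x ∈ Ioo (l v) (r v), ∃ s ∈ S, x ∈ Icc (a s) (b s) ∧
      ∀ t ∈ uIcc (h s) (y v), (x, t) ∈ P)
    (hdisj : ∀ v ∈ V, ∀ w ∈ V, v ≠ w → ∀ x ∈ Ioo (l v) (r v), x ∈ Ioo (l w) (r w) →
      ¬ ∀ t ∈ uIcc (y v) (y w), (x, t) ∈ P) :
    ∑ v ∈ V, (r v - l v) ≤ ∑ s ∈ S, (b s - a s) := by
  set U : κ → ι → Set ℝ := fun s v =>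
    Ioo (l v) (r v) ∩ (Icc (a s) (b s) ∩ ⋂ t ∈ uIcc (h s) (y v), {x | (x, t) ∈ P}) with hU
  have hmeas : ∀ s v, MeasurableSet (U s v) := fun s v =>
    measurableSet_Ioo.inter (measurableSet_Icc.inter (isClosed_biInter fun t _ =>
      hP.preimage (by fun_prop : Continuous fun x : ℝ => ((x, t) : Point))).measurableSet)
  have h1 : ∀ v ∈ V, ENNReal.ofReal (r v - l v) ≤ ∑ s ∈ S, volume (U s v) := by
    intro v hv
    rw [← Real.volume_Ioo]
    refine (measure_mono fun x hx => ?_).trans (measure_biUnion_finset_le S fun s => U s v)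
    obtain ⟨s, hs, h2, h3⟩ := hcov v hv x hx
    exact mem_biUnion hs ⟨hx, h2, mem_iInter₂.2 h3⟩
  have h2 : ∀ s ∈ S, ∑ v ∈ V, volume (U s v) ≤ ENNReal.ofReal (b s - a s) := by
    intro s _
    rw [← Real.volume_Icc, ← measure_biUnion_finset (fun v hv w hw hvw => ?_)
      (fun v _ => hmeas s v)]
    · refine measure_mono (iUnion₂_subset fun v _ x hx => hx.2.1)
    · refine disjoint_left.2 fun x hxv hxw => ?_
      refine hdisj v hv w hw hvw x hxv.1 hxw.1 fun t ht => ?_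
      rcases uIcc_subset_uIcc_union_uIcc (b := h s) ht with ht | ht
      · rw [uIcc_comm] at ht; exact mem_iInter₂.1 hxv.2.2 t ht
      · exact mem_iInter₂.1 hxw.2.2 t ht
  have h3 : ∑ v ∈ V, ENNReal.ofReal (r v - l v) ≤ ∑ s ∈ S, ENNReal.ofReal (b s - a s) := by
    refine (Finset.sum_le_sum h1).trans ?_
    rw [Finset.sum_comm]
    exact Finset.sum_le_sum h2
  rw [← ENNReal.ofReal_sum_of_nonneg fun v hv => sub_nonneg.2 (hlr v hv),
    ← ENNReal.ofReal_sum_of_nonneg fun s hs => sub_nonneg.2 (hab s hs)] at h3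
  exact (ENNReal.ofReal_le_ofReal_iff (Finset.sum_nonneg fun s hs => sub_nonneg.2 (hab s hs))).1 h3

/-! ### Covers and vertex covers -/

theorem inCell_swap_eq {P : Set Point} {X Y : ℕ → ℝ} {j : ℕ} :
    InCell (Prod.swap ⁻¹' P) Y X j = fun i => InCell P X Y i j :=
  funext fun _ => propext inCell_swap

open Classical in
/-- The first index of the maximal interval of indices that ends in `j` and on which, except possibly
at `j`, the predicate `p` holds. -/
noncomputable def runStart (p : ℕ → Prop) : ℕ → ℕ
  | 0 => 0
  | j + 1 => if p j then runStart p j else j + 1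

theorem runStart_le (p : ℕ → Prop) (j : ℕ) : runStart p j ≤ j := by
  induction j with
  | zero => exact le_rfl
  | succ j ih => rw [runStart]; split_ifs <;> omega

theorem of_runStart_le {p : ℕ → Prop} {j k : ℕ} (h1 : runStart p j ≤ k) (h2 : k < j) : p k := by
  induction j with
  | zero => omega
  | succ j ih =>
    rw [runStart] at h1
    split_ifs at h1 with h
    · rcases Nat.lt_succ_iff_lt_or_eq.1 h2 with h2 | rfl
      exacts [ih h1 h2, h]
    · omega

theorem runStart_eq {p : ℕ → Prop} {j l : ℕ} (hjl : j ≤ l) (h : ∀ k, j ≤ k → k < l → p k) :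
    runStart p l = runStart p j := by
  induction l, hjl using Nat.le_induction with
  | base => rfl
  | succ l hl ih =>
    rw [runStart, if_pos (h l hl (by omega))]
    exact ih fun k h1 h2 => h k h1 (by omega)

theorem runStart_runStart (p : ℕ → Prop) (j : ℕ) : runStart p (runStart p j) = runStart p j :=
  (runStart_eq (runStart_le p j) fun _ => of_runStart_le).symm

theorem of_runStart_eq {p : ℕ → Prop} {j : ℕ} (h : p j) : p (runStart p j) := by
  rcases (runStart_le p j).eq_or_lt with h1 | h1
  · rwa [h1]
  · exact of_runStart_le le_rfl h1

/-- The number of the cell `(i, j)` of an `N × N` grid is `i * N + j`. -/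
theorem cell_lt {i j N : ℕ} (hi : i < N) (hj : j < N) : i * N + j < N * N := by
  have := Nat.mul_le_mul_right N (Nat.succ_le_of_lt hi)
  rw [Nat.succ_mul] at this
  omega

theorem cell_div {i j N : ℕ} (hj : j < N) : (i * N + j) / N = i := by
  rw [Nat.add_comm, Nat.add_mul_div_right _ _ (by omega), Nat.div_eq_of_lt hj, Nat.zero_add]

theorem cell_mod {i j N : ℕ} (hj : j < N) : (i * N + j) % N = j := by
  rw [Nat.add_comm, Nat.add_mul_mod_self_right, Nat.mod_eq_of_lt hj]

section CellIndex

variable {c N : ℕ} (hc : c < N * N)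
include hc

theorem pos_of_lt_mul_self : 0 < N := Nat.pos_of_ne_zero (by rintro rfl; simp at hc)

theorem div_lt_of_lt_mul_self : c / N < N := Nat.div_lt_of_lt_mul hc

theorem mod_lt_of_lt_mul_self : c % N < N := Nat.mod_lt _ (pos_of_lt_mul_self hc)

end CellIndex

section GridGraph

variable (P : Set Point) (N : ℕ) (X Y : ℕ → ℝ)

/-- The cell `c` is contained in `P`. -/
def cellIn (c : ℕ) : Prop := InCell P X Y (c / N) (c % N)

/-- The first cell of the vertical run of the cell `c`. -/
noncomputable def cellV (c : ℕ) : ℕ := c / N * N + runStart (InCell P X Y (c / N)) (c % N)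

/-- The first cell of the horizontal run of the cell `c`. -/
noncomputable def cellH (c : ℕ) : ℕ := runStart (fun i => InCell P X Y i (c % N)) (c / N) * N + c % N

open Classical in
/-- The bipartite graph whose nodes are the maximal vertical and horizontal runs of cells, represented
by their first cells and weighted by the length of the first side, which is crossed by all lines in the
direction of the run. Every cell joins the two runs it belongs to; numbers that do not represent a run
have weight `0`. -/
noncomputable def gridGraph : BipartiteGraph where
  K := N * N
  ins := cellIn P N X Y
  vid := cellV P N X Y
  hid := cellH P N X Y
  wV c := if c < N * N ∧ cellIn P N X Y c ∧ cellV P N X Y c = c then X (c / N + 1) - X (c / N) else 0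
  wH c := if c < N * N ∧ cellIn P N X Y c ∧ cellH P N X Y c = c then Y (c % N + 1) - Y (c % N) else 0
  vid_lt _ hc _ := cell_lt (div_lt_of_lt_mul_self hc)
    ((runStart_le _ _).trans_lt (mod_lt_of_lt_mul_self hc))
  hid_lt _ hc _ := cell_lt ((runStart_le _ _).trans_lt (div_lt_of_lt_mul_self hc))
    (mod_lt_of_lt_mul_self hc)

/-- The camera along the bottom side of a cell. -/
noncomputable def camV (c : ℕ) : Seg := ((X (c / N), Y (c % N)), (X (c / N + 1), Y (c % N)))

/-- The camera along the left side of a cell. -/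
noncomputable def camH (c : ℕ) : Seg := ((X (c / N), Y (c % N)), (X (c / N), Y (c % N + 1)))

/-- `T` consists of the cameras that guard the vertical runs in `C` and the horizontal runs in `D`. A
vertical run is guarded by the horizontal camera along the bottom side of its first cell, a horizontal
run by the vertical camera along the left side of its first cell. -/
def IsCameraSet (C D : ℕ → Prop) (T : Finset Seg) : Prop :=
  ∀ s, s ∈ T ↔ (∃ c < N * N, cellIn P N X Y c ∧ cellV P N X Y c = c ∧ C c ∧ s = camV N X Y c) ∨
    ∃ c < N * N, cellIn P N X Y c ∧ cellH P N X Y c = c ∧ D c ∧ s = camH N X Y c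

end GridGraph

theorem Seg.length_of_horizontal {s : Seg} (h : s.1.2 = s.2.2) (hlt : s.1.1 ≤ s.2.1) :
    s.length = s.2.1 - s.1.1 := by
  rw [Seg.length, h, sub_self, zero_pow two_ne_zero, add_zero, Real.sqrt_sq (sub_nonneg.2 hlt)]

theorem Seg.length_of_vertical {s : Seg} (h : s.1.1 = s.2.1) (hlt : s.1.2 ≤ s.2.2) :
    s.length = s.2.2 - s.1.2 := by
  rw [Seg.length, h, sub_self, zero_pow two_ne_zero, zero_add, Real.sqrt_sq (sub_nonneg.2 hlt)]

theorem Seg.length_nonneg (s : Seg) : 0 ≤ s.length := Real.sqrt_nonneg _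

theorem Seg.carrier_of_horizontal {s : Seg} (h : s.1.2 = s.2.2) (hlt : s.1.1 ≤ s.2.1) {p : Point} :
    p ∈ s.carrier ↔ p.2 = s.1.2 ∧ p.1 ∈ Icc s.1.1 s.2.1 := by
  obtain ⟨⟨a, b⟩, c, d⟩ := s
  simp only at h hlt ⊢
  subst h
  rw [Seg.carrier, mem_segment_horizontal, uIcc_of_le hlt]

theorem Seg.carrier_of_vertical {s : Seg} (h : s.1.1 = s.2.1) (hlt : s.1.2 ≤ s.2.2) {p : Point} :
    p ∈ s.carrier ↔ p.1 = s.1.1 ∧ p.2 ∈ Icc s.1.2 s.2.2 := by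
  obtain ⟨⟨a, b⟩, c, d⟩ := s
  simp only at h hlt ⊢
  subst h
  rw [Seg.carrier, mem_segment_vertical, uIcc_of_le hlt]

theorem Seg.sees_of_horizontal {P : Set Point} {s : Seg} (h : s.1.2 = s.2.2) (hlt : s.1.1 < s.2.1)
    {p : Point} : s.Sees P p ↔
      p.1 ∈ Icc s.1.1 s.2.1 ∧ ∀ t ∈ uIcc s.1.2 p.2, (p.1, t) ∈ P := by
  have hne : s.2.1 - s.1.1 ≠ 0 := (sub_pos.2 hlt).ne'
  have hz : s.2.2 - s.1.2 = 0 := by rw [h, sub_self]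
  unfold Seg.Sees
  constructor
  · rintro ⟨q, hq, h1, h2⟩
    rw [hz, mul_zero, add_zero, mul_eq_zero, or_iff_left hne, sub_eq_zero] at h1
    obtain ⟨h3, h4⟩ := (Seg.carrier_of_horizontal h hlt.le).1 hq
    rw [h1]
    refine ⟨h4, fun t ht => h2 ?_⟩
    have e1 : p = (q.1, p.2) := by rw [← h1]
    have e2 : q = (q.1, s.1.2) := by rw [← h3]
    rw [e1, e2, mem_segment_vertical, uIcc_comm]
    exact ⟨rfl, ht⟩
  · rintro ⟨h1, h2⟩
    refine ⟨(p.1, s.1.2), (Seg.carrier_of_horizontal h hlt.le).2 ⟨rfl, h1⟩, by simp [hz],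
      fun q hq => ?_⟩
    obtain ⟨h3, h4⟩ := (mem_segment_vertical (x := p.1) (a := p.2)).1 hq
    have := h2 q.2 (by rwa [uIcc_comm])
    rwa [← h3] at this

theorem Seg.sees_of_vertical {P : Set Point} {s : Seg} (h : s.1.1 = s.2.1) (hlt : s.1.2 < s.2.2)
    {p : Point} : s.Sees P p ↔
      p.2 ∈ Icc s.1.2 s.2.2 ∧ ∀ t ∈ uIcc s.1.1 p.1, (t, p.2) ∈ P := by
  have hne : s.2.2 - s.1.2 ≠ 0 := (sub_pos.2 hlt).ne'
  have hz : s.2.1 - s.1.1 = 0 := by rw [h, sub_self]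
  unfold Seg.Sees
  constructor
  · rintro ⟨q, hq, h1, h2⟩
    rw [hz, mul_zero, zero_add, mul_eq_zero, or_iff_left hne, sub_eq_zero] at h1
    obtain ⟨h3, h4⟩ := (Seg.carrier_of_vertical h hlt.le).1 hq
    rw [h1]
    refine ⟨h4, fun t ht => h2 ?_⟩
    have e1 : p = (p.1, q.2) := by rw [← h1]
    have e2 : q = (s.1.1, q.2) := by rw [← h3]
    rw [e1, e2, mem_segment_horizontal, uIcc_comm]
    exact ⟨rfl, ht⟩
  · rintro ⟨h1, h2⟩
    refine ⟨(s.1.1, p.2), (Seg.carrier_of_vertical h hlt.le).2 ⟨rfl, h1⟩, by simp [hz],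
      fun q hq => ?_⟩
    obtain ⟨h3, h4⟩ := (mem_segment_horizontal (y := p.2) (a := p.1)).1 hq
    have := h2 q.1 (by rwa [uIcc_comm])
    rwa [← h3] at this

namespace IsGrid

variable {P : Set Point} {N : ℕ} {X Y : ℕ → ℝ} (h : IsGrid P N X Y)
include h

/-- The midpoint of an open interval between grid lines. -/
local notation "mid" => fun (f : ℕ → ℝ) (i : ℕ) => (f i + f (i + 1)) / 2

/-- Columns do not overlap. -/
theorem column_unique {i k : ℕ} (hi : i < N) (hk : k < N) {x : ℝ} (h1 : x ∈ Ioo (X i) (X (i + 1)))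
    (h2 : x ∈ Ioo (X k) (X (k + 1))) : i = k := by
  rcases lt_trichotomy i k with h3 | h3 | h3
  · exact absurd ((h1.2.trans_le (h.X_mono (i := i + 1) h3 hk.le)).trans h2.1) (lt_irrefl _)
  · exact h3
  · exact absurd ((h2.2.trans_le (h.X_mono (i := k + 1) h3 hi.le)).trans h1.1) (lt_irrefl _)

omit h in
theorem inCell_of_runStart {i j k : ℕ} (hc : InCell P X Y i j)
    (h1 : runStart (InCell P X Y i) j ≤ k) (h2 : k ≤ j) : InCell P X Y i k := by
  rcases h2.eq_or_lt with rfl | h2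
  exacts [hc, of_runStart_le h1 h2]

/-- A point of a cell is connected to the midline and to the bottom side of the first cell of the
vertical run. -/
theorem vertical_mem {i j : ℕ} (hc : InCell P X Y i j) {x y t : ℝ} (hx : x ∈ Icc (X i) (X (i + 1)))
    (hy : y ∈ Icc (Y j) (Y (j + 1))) (hj : j < N)
    (ht : t ∈ uIcc y (mid Y (runStart (InCell P X Y i) j)) ∨
      t ∈ uIcc (Y (runStart (InCell P X Y i) j)) y) : (x, t) ∈ P := by
  have h1 := runStart_le (InCell P X Y i) j
  have h2 := inCell_of_runStart hc le_rfl h1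
  have h3 := h.swap.X_mono h1 hj.le
  have h4 := h.swap.X_mono (i := runStart (InCell P X Y i) j + 1) (j := j + 1) (by omega) hj
  have h5 := h2.2.1
  refine h.vertical_of_inCell (j := runStart (InCell P X Y i) j) (l := j) hx
    (fun k h1 h2 => inCell_of_runStart hc h1 h2) ?_ ?_ h1
  · rcases ht with ht | ht
    · refine le_trans ?_ ht.1; simp only [le_inf_iff]; constructor <;> linarith [hy.1]
    · refine le_trans ?_ ht.1; simp only [le_inf_iff]; constructor <;> linarith [hy.1]
  · rcases ht with ht | ht
    · refine ht.2.trans ?_; simp only [sup_le_iff]; constructor <;> linarith [hy.2]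
    · refine ht.2.trans ?_; simp only [sup_le_iff]; constructor <;> linarith [hy.2]

/-- Two cells whose midlines are connected by a vertical segment in `P` have the same run. -/
theorem runStart_eq_of_vertical {i j l : ℕ} (hi : i < N) (hj : j < N) (hl : l < N)
    (hjc : InCell P X Y i j) (hlc : InCell P X Y i l) {x : ℝ} (hx : x ∈ Ioo (X i) (X (i + 1)))
    (hP : ∀ t ∈ uIcc (mid Y j) (mid Y l), (x, t) ∈ P) :
    runStart (InCell P X Y i) j = runStart (InCell P X Y i) l := by
  rcases le_total j l with h1 | h1
  · refine (runStart_eq h1 fun k h2 h3 => ?_).symm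
    exact h.inCell_of_vertical hi hx h2 h3.le hl hlc.2.1 fun t ht => hP t (Icc_subset_uIcc ht)
  · refine runStart_eq h1 fun k h2 h3 => ?_
    exact h.inCell_of_vertical hi hx h2 h3.le hj hjc.2.1 fun t ht => hP t (Icc_subset_uIcc' ht)

/-- Every cover is at least as long as some vertex cover of runs is heavy. The vertex cover consists of
the vertical runs all of whose vertical lines meet a horizontal camera within `P`, and of the
horizontal runs all of whose horizontal lines meet a vertical camera. If neither run of a cell were
chosen, then a vertical and a horizontal line without such a camera would cross in a point of the cell
that is not seen. -/
theorem exists_vertexCover_weight_le {T : Finset Seg} (hT : IsCover P T) :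
    ∃ A B, (gridGraph P N X Y).IsVertexCover A B ∧ (gridGraph P N X Y).weight A B ≤ totalLength T := by
  classical
  set A : ℕ → Prop := fun c => ∀ x ∈ Ioo (X (c / N)) (X (c / N + 1)), ∃ s ∈ T, s.1.2 = s.2.2 ∧
    x ∈ Icc s.1.1 s.2.1 ∧ ∀ t ∈ uIcc s.1.2 (mid Y (c % N)), (x, t) ∈ P with hA
  set B : ℕ → Prop := fun c => ∀ y ∈ Ioo (Y (c % N)) (Y (c % N + 1)), ∃ s ∈ T, s.1.2 ≠ s.2.2 ∧
    y ∈ Icc s.1.2 s.2.2 ∧ ∀ t ∈ uIcc s.1.1 (mid X (c / N)), (t, y) ∈ P with hB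
  have hver : ∀ s ∈ T, s.1.2 ≠ s.2.2 → s.1.1 = s.2.1 ∧ s.1.2 < s.2.2 := fun s hs hne =>
    (hT.isOrthogonal s hs).resolve_right fun h' => hne h'.1
  have hhor : ∀ s ∈ T, s.1.2 = s.2.2 → s.1.1 < s.2.1 := fun s hs he =>
    ((hT.isOrthogonal s hs).resolve_left fun h' => h'.2.ne he).2
  refine ⟨A, B, fun c hc hin => ?_, ?_⟩
  · change InCell P X Y (c / N) (c % N) at hin
    change c < N * N at hc
    have hi := div_lt_of_lt_mul_self hc
    have hj := mod_lt_of_lt_mul_self hc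
    have ev : (gridGraph P N X Y).vid c / N = c / N := cell_div ((runStart_le _ _).trans_lt hj)
    have ev' : (gridGraph P N X Y).vid c % N = runStart (InCell P X Y (c / N)) (c % N) :=
      cell_mod ((runStart_le _ _).trans_lt hj)
    have eh : (gridGraph P N X Y).hid c / N = runStart (fun i => InCell P X Y i (c % N)) (c / N) :=
      cell_div hj
    have eh' : (gridGraph P N X Y).hid c % N = c % N := cell_mod hj
    -- otherwise some point of the cell is not seen
    by_contra hnot
    simp only [hA, hB, ev, ev', eh, eh', not_or] at hnot
    obtain ⟨hnA, hnB⟩ := hnot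
    push Not at hnA hnB
    obtain ⟨x, hx, hnA⟩ := hnA
    obtain ⟨y, hy, hnB⟩ := hnB
    obtain ⟨s, hs, hsee⟩ := hT.sees (x, y) (hin.2.2 ⟨hx, hy⟩)
    by_cases he : s.1.2 = s.2.2
    · obtain ⟨h1, h2⟩ := (Seg.sees_of_horizontal he (hhor s hs he)).1 hsee
      obtain ⟨t, ht, hn⟩ := hnA s hs he h1
      refine hn ?_
      rcases uIcc_subset_uIcc_union_uIcc (b := y) ht with ht | ht
      · exact h2 t ht
      · exact h.vertical_mem hin (Ioo_subset_Icc_self hx) (Ioo_subset_Icc_self hy) hj (Or.inl ht)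
    · obtain ⟨h0, hlt⟩ := hver s hs he
      obtain ⟨h1, h2⟩ := (Seg.sees_of_vertical h0 hlt).1 hsee
      obtain ⟨t, ht, hn⟩ := hnB s hs he h1
      refine hn ?_
      rcases uIcc_subset_uIcc_union_uIcc (b := x) ht with ht | ht
      · exact h2 t ht
      · have := h.swap.vertical_mem (inCell_swap.2 hin) (Ioo_subset_Icc_self hy)
          (Ioo_subset_Icc_self hx) hi (t := t)
        simp only [inCell_swap_eq] at this
        exact this (Or.inl ht)
  · set V := {c ∈ Finset.range (N * N) | (cellIn P N X Y c ∧ cellV P N X Y c = c) ∧ A c} with hVdef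
    set H := {c ∈ Finset.range (N * N) | (cellIn P N X Y c ∧ cellH P N X Y c = c) ∧ B c} with hHdef
    have e1 : ∑ c ∈ Finset.range (N * N), (if A c then (gridGraph P N X Y).wV c else 0) =
        ∑ c ∈ V, (X (c / N + 1) - X (c / N)) := by
      rw [hVdef, Finset.sum_filter]
      refine Finset.sum_congr rfl fun c hc => ?_
      rw [Finset.mem_range] at hc
      by_cases h1 : A c <;> simp [h1, gridGraph, hc]
    have e2 : ∑ c ∈ Finset.range (N * N), (if B c then (gridGraph P N X Y).wH c else 0) =
        ∑ c ∈ H, (Y (c % N + 1) - Y (c % N)) := by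
      rw [hHdef, Finset.sum_filter]
      refine Finset.sum_congr rfl fun c hc => ?_
      rw [Finset.mem_range] at hc
      by_cases h1 : B c <;> simp [h1, gridGraph, hc]
    have l1 : ∑ c ∈ V, (X (c / N + 1) - X (c / N)) ≤
        ∑ s ∈ T with s.1.2 = s.2.2, (s.2.1 - s.1.1) := by
      refine sum_width_le_sum_length h.isClosed V _ (fun c => X (c / N)) (fun c => X (c / N + 1))
        (fun c => mid Y (c % N)) (fun s : Seg => s.1.1) (fun s => s.2.1) (fun s => s.1.2)
        (fun c hc => ?_) (fun s hs => ?_) (fun c hc x hx => ?_) (fun c hc d hd hcd x hxc hxd hn => ?_)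
      · exact (Finset.mem_filter.1 hc).2.1.1.1.le
      · obtain ⟨h1, h2⟩ := Finset.mem_filter.1 hs
        exact (hhor s h1 h2).le
      · obtain ⟨s, hs, h1, h2⟩ := (Finset.mem_filter.1 hc).2.2 x hx
        exact ⟨s, Finset.mem_filter.2 ⟨hs, h1⟩, h2⟩
      · obtain ⟨hc1, ⟨hc2, hc3⟩, -⟩ := Finset.mem_filter.1 hc
        obtain ⟨hd1, ⟨hd2, hd3⟩, -⟩ := Finset.mem_filter.1 hd
        rw [Finset.mem_range] at hc1 hd1
        have e := h.column_unique (div_lt_of_lt_mul_self hc1) (div_lt_of_lt_mul_self hd1) hxc hxd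
        unfold cellIn at hc2 hd2
        rw [← e] at hd2
        have := h.runStart_eq_of_vertical (div_lt_of_lt_mul_self hc1) (mod_lt_of_lt_mul_self hc1)
          (mod_lt_of_lt_mul_self hd1) hc2 hd2 hxc hn
        unfold cellV at hc3 hd3
        rw [← e] at hd3
        omega
    have l2 : ∑ c ∈ H, (Y (c % N + 1) - Y (c % N)) ≤
        ∑ s ∈ T with ¬ s.1.2 = s.2.2, (s.2.2 - s.1.2) := by
      refine sum_width_le_sum_length h.swap.isClosed H _ (fun c => Y (c % N))
        (fun c => Y (c % N + 1)) (fun c => mid X (c / N)) (fun s : Seg => s.1.2) (fun s => s.2.2)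
        (fun s => s.1.1)
        (fun c hc => ?_) (fun s hs => ?_) (fun c hc x hx => ?_) (fun c hc d hd hcd x hxc hxd hn => ?_)
      · exact (Finset.mem_filter.1 hc).2.1.1.2.1.le
      · obtain ⟨h1, h2⟩ := Finset.mem_filter.1 hs
        exact (hver s h1 h2).2.le
      · obtain ⟨s, hs, h1, h2⟩ := (Finset.mem_filter.1 hc).2.2 x hx
        exact ⟨s, Finset.mem_filter.2 ⟨hs, h1⟩, h2⟩
      · obtain ⟨hc1, ⟨hc2, hc3⟩, -⟩ := Finset.mem_filter.1 hc
        obtain ⟨hd1, ⟨hd2, hd3⟩, -⟩ := Finset.mem_filter.1 hd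
        rw [Finset.mem_range] at hc1 hd1
        have e := h.swap.column_unique (mod_lt_of_lt_mul_self hc1) (mod_lt_of_lt_mul_self hd1) hxc hxd
        unfold cellIn at hc2 hd2
        rw [← e] at hd2
        have := h.swap.runStart_eq_of_vertical (mod_lt_of_lt_mul_self hc1)
          (div_lt_of_lt_mul_self hc1) (div_lt_of_lt_mul_self hd1) (inCell_swap.2 hc2)
          (inCell_swap.2 hd2) hxc hn
        simp only [inCell_swap_eq] at this
        unfold cellH at hc3 hd3
        rw [← e] at hd3
        rw [← hc3, ← hd3, this] at hcd
        exact hcd rfl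
    have e3 : totalLength T = ∑ s ∈ T with s.1.2 = s.2.2, (s.2.1 - s.1.1) +
        ∑ s ∈ T with ¬ s.1.2 = s.2.2, (s.2.2 - s.1.2) := by
      rw [totalLength, ← Finset.sum_filter_add_sum_filter_not T fun s => s.1.2 = s.2.2]
      congr 1
      · refine Finset.sum_congr rfl fun s hs => ?_
        obtain ⟨h1, h2⟩ := Finset.mem_filter.1 hs
        exact Seg.length_of_horizontal h2 (hhor s h1 h2).le
      · refine Finset.sum_congr rfl fun s hs => ?_
        obtain ⟨h1, h2⟩ := Finset.mem_filter.1 hs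
        exact Seg.length_of_vertical (hver s h1 h2).1 (hver s h1 h2).2.le
    unfold BipartiteGraph.weight
    change ∑ c ∈ Finset.range (N * N), (if A c then (gridGraph P N X Y).wV c else 0) +
      ∑ c ∈ Finset.range (N * N), (if B c then (gridGraph P N X Y).wH c else 0) ≤ _
    rw [e1, e2, e3]
    exact add_le_add l1 l2

theorem camV_subset {c : ℕ} (hc : cellIn P N X Y c) : (camV N X Y c).carrier ⊆ P := by
  intro p hp
  obtain ⟨h1, h2⟩ := (Seg.carrier_of_horizontal rfl hc.1.le).1 hp
  exact h.closedCell_subset hc ⟨h2, by rw [h1]; exact ⟨le_rfl, hc.2.1.le⟩⟩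

theorem camH_subset {c : ℕ} (hc : cellIn P N X Y c) : (camH N X Y c).carrier ⊆ P := by
  intro p hp
  obtain ⟨h1, h2⟩ := (Seg.carrier_of_vertical rfl hc.2.1.le).1 hp
  exact h.closedCell_subset hc ⟨by rw [h1]; exact ⟨le_rfl, hc.1.le⟩, h2⟩

/-- The cameras of a vertex cover of runs are a cover. -/
theorem isCover_of_isVertexCover {C D : ℕ → Prop} (hCD : (gridGraph P N X Y).IsVertexCover C D)
    {T : Finset Seg} (hT : IsCameraSet P N X Y C D T) : IsCover P T := by
  refine ⟨fun s hs => ?_, fun s hs => ?_, fun p hp => ?_⟩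
  · rcases (hT s).1 hs with ⟨c, -, h1, -, -, rfl⟩ | ⟨c, -, h1, -, -, rfl⟩
    · exact Or.inr ⟨rfl, h1.1⟩
    · exact Or.inl ⟨rfl, h1.2.1⟩
  · rcases (hT s).1 hs with ⟨c, -, h1, -, -, rfl⟩ | ⟨c, -, h1, -, -, rfl⟩
    exacts [h.camV_subset h1, h.camH_subset h1]
  · obtain ⟨i, hi, j, hj, hc, hpi, hpj⟩ := h.exists_cell hp
    have hcK := cell_lt hi hj
    have hin : cellIn P N X Y (i * N + j) := by rwa [cellIn, cell_div hj, cell_mod hj]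
    rcases hCD _ hcK hin with hC | hD
    · have ev : cellV P N X Y (i * N + j) = i * N + runStart (InCell P X Y i) j := by
        rw [cellV, cell_div hj, cell_mod hj]
      have hr : runStart (InCell P X Y i) j < N := (runStart_le _ _).trans_lt hj
      have h1 : cellIn P N X Y (i * N + runStart (InCell P X Y i) j) := by
        rw [cellIn, cell_div hr, cell_mod hr]; exact of_runStart_eq hc
      refine ⟨camV N X Y (i * N + runStart (InCell P X Y i) j), (hT _).2 (Or.inl
        ⟨_, cell_lt hi hr, h1, ?_, by rw [← ev]; exact hC, rfl⟩), ?_⟩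
      · rw [cellV, cell_div hr, cell_mod hr, runStart_runStart]
      · refine (Seg.sees_of_horizontal rfl h1.1).2 ?_
        simp only [camV, cell_div hr, cell_mod hr]
        exact ⟨hpi, fun t ht => h.vertical_mem hc hpi hpj hj (Or.inr ht)⟩
    · have eh : cellH P N X Y (i * N + j) = runStart (fun i => InCell P X Y i j) i * N + j := by
        rw [cellH, cell_div hj, cell_mod hj]
      have hr : runStart (fun i => InCell P X Y i j) i < N := (runStart_le _ _).trans_lt hi
      have h1 : cellIn P N X Y (runStart (fun i => InCell P X Y i j) i * N + j) := by
        rw [cellIn, cell_div hj, cell_mod hj]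
        exact of_runStart_eq (p := fun i => InCell P X Y i j) hc
      refine ⟨camH N X Y (runStart (fun i => InCell P X Y i j) i * N + j), (hT _).2 (Or.inr
        ⟨_, cell_lt hr hj, h1, ?_, by rw [← eh]; exact hD, rfl⟩), ?_⟩
      · rw [cellH, cell_div hj, cell_mod hj, runStart_runStart]
      · refine (Seg.sees_of_vertical rfl h1.2.1).2 ?_
        simp only [camH, cell_div hj, cell_mod hj]
        refine ⟨hpj, fun t ht => ?_⟩
        have := h.swap.vertical_mem (inCell_swap.2 hc) hpj hpi hi (t := t)
        simp only [inCell_swap_eq] at this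
        exact this (Or.inr ht)

omit h in
/-- The cameras of a set of runs have at most the total weight of the runs. -/
theorem totalLength_le_weight {C D : ℕ → Prop} {T : Finset Seg} (hT : IsCameraSet P N X Y C D T) :
    totalLength T ≤ (gridGraph P N X Y).weight C D := by
  classical
  set V := {c ∈ Finset.range (N * N) | (cellIn P N X Y c ∧ cellV P N X Y c = c) ∧ C c} with hVdef
  set H := {c ∈ Finset.range (N * N) | (cellIn P N X Y c ∧ cellH P N X Y c = c) ∧ D c} with hHdef
  have hsub : T ⊆ V.image (camV N X Y) ∪ H.image (camH N X Y) := by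
    intro s hs
    rw [Finset.mem_union, Finset.mem_image, Finset.mem_image]
    rcases (hT s).1 hs with ⟨c, h1, h2, h3, h4, rfl⟩ | ⟨c, h1, h2, h3, h4, rfl⟩
    · exact Or.inl ⟨c, Finset.mem_filter.2 ⟨Finset.mem_range.2 h1, ⟨h2, h3⟩, h4⟩, rfl⟩
    · exact Or.inr ⟨c, Finset.mem_filter.2 ⟨Finset.mem_range.2 h1, ⟨h2, h3⟩, h4⟩, rfl⟩
  have e1 : ∑ c ∈ Finset.range (N * N), (if C c then (gridGraph P N X Y).wV c else 0) =
      ∑ c ∈ V, (camV N X Y c).length := by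
    rw [hVdef, Finset.sum_filter]
    refine Finset.sum_congr rfl fun c hc => ?_
    rw [Finset.mem_range] at hc
    by_cases h1 : C c
    · by_cases h2 : cellIn P N X Y c ∧ cellV P N X Y c = c
      · rw [Seg.length_of_horizontal rfl h2.1.1.le]; simp [h1, h2, gridGraph, hc, camV]
      · simp [h1, h2, gridGraph]
    · simp [h1]
  have e2 : ∑ c ∈ Finset.range (N * N), (if D c then (gridGraph P N X Y).wH c else 0) =
      ∑ c ∈ H, (camH N X Y c).length := by
    rw [hHdef, Finset.sum_filter]
    refine Finset.sum_congr rfl fun c hc => ?_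
    rw [Finset.mem_range] at hc
    by_cases h1 : D c
    · by_cases h2 : cellIn P N X Y c ∧ cellH P N X Y c = c
      · rw [Seg.length_of_vertical rfl h2.1.2.1.le]; simp [h1, h2, gridGraph, hc, camH]
      · simp [h1, h2, gridGraph]
    · simp [h1]
  unfold BipartiteGraph.weight
  change _ ≤ ∑ c ∈ Finset.range (N * N), (if C c then (gridGraph P N X Y).wV c else 0) +
    ∑ c ∈ Finset.range (N * N), (if D c then (gridGraph P N X Y).wH c else 0)
  rw [e1, e2]
  have hnn : ∀ s : Seg, 0 ≤ s.length := Seg.length_nonneg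
  calc totalLength T ≤ ∑ s ∈ V.image (camV N X Y) ∪ H.image (camH N X Y), s.length :=
        Finset.sum_le_sum_of_subset_of_nonneg hsub fun s _ _ => hnn s
    _ ≤ ∑ s ∈ V.image (camV N X Y), s.length + ∑ s ∈ H.image (camH N X Y), s.length := by
        rw [← Finset.sum_union_inter]
        exact le_add_of_nonneg_right (Finset.sum_nonneg fun s _ => hnn s)
    _ ≤ _ := add_le_add (Finset.sum_image_le_of_nonneg fun s _ => hnn s)
        (Finset.sum_image_le_of_nonneg fun s _ => hnn s)

/-- The cameras of a minimum-weight vertex cover of runs are an optimal cover. -/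
theorem isOptimalCover {C D : ℕ → Prop} (hCD : (gridGraph P N X Y).IsVertexCover C D)
    (hmin : ∀ A B, (gridGraph P N X Y).IsVertexCover A B →
      (gridGraph P N X Y).weight C D ≤ (gridGraph P N X Y).weight A B)
    {T : Finset Seg} (hT : IsCameraSet P N X Y C D T) : IsOptimalCover P T := by
  refine ⟨h.isCover_of_isVertexCover hCD hT, fun T' hT' => ?_⟩
  obtain ⟨A, B, hAB, hw⟩ := h.exists_vertexCover_weight_le hT'
  exact (totalLength_le_weight hT).trans ((hmin A B hAB).trans hw)

end IsGrid

/-! ### The boundary as an array of edges -/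

/-- The position of the first vertex of the `i`-th cycle in the list of all vertices. -/
def offset (B : List (List Point)) (i : ℕ) : ℕ := ((B.map List.length).take i).sum

theorem offset_zero (B : List (List Point)) : offset B 0 = 0 := by simp [offset]

theorem offset_cons (c : List Point) (B : List (List Point)) (i : ℕ) :
    offset (c :: B) (i + 1) = c.length + offset B i := by simp [offset]

theorem offset_succ {B : List (List Point)} {i : ℕ} (hi : i < B.length) :
    offset B (i + 1) = offset B i + (B.getD i []).length := by
  unfold offset
  rw [List.sum_take_succ _ _ (by simpa using hi)]
  simp [hi]

theorem offset_length (B : List (List Point)) : offset B B.length = numVertices B := by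
  unfold offset numVertices
  rw [List.take_of_length_le (by simp)]

/-- The `l`-th vertex of the `i`-th cycle in the list of all vertices. -/
theorem getD_flatten {B : List (List Point)} {i l : ℕ} (hi : i < B.length)
    (hl : l < (B.getD i []).length) :
    B.flatten.getD (offset B i + l) 0 = (B.getD i []).getD l 0 := by
  induction B generalizing i with
  | nil => simp at hi
  | cons c B ih =>
    cases i with
    | zero =>
      simp only [List.getD_cons_zero] at hl ⊢
      rw [offset_zero, List.flatten_cons, zero_add, List.getD_append _ _ _ _ hl]
    | succ i =>
      simp only [List.getD_cons_succ] at hl ⊢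
      rw [offset_cons, List.flatten_cons, List.getD_append_right _ _ _ _ (by omega),
        ← ih (by simpa using hi) hl]
      congr 1
      omega

theorem exists_eq_offset_add {B : List (List Point)} {a : ℕ} (ha : a < numVertices B) :
    ∃ i < B.length, ∃ l < (B.getD i []).length, a = offset B i + l := by
  induction B generalizing a with
  | nil => simp [numVertices] at ha
  | cons c B ih =>
    by_cases h : a < c.length
    · exact ⟨0, by simp, a, by simpa using h, by simp [offset_zero]⟩
    · obtain ⟨i, hi, l, hl, he⟩ := ih (a := a - c.length) (by
        simp only [numVertices, List.map_cons, List.sum_cons] at ha ⊢; omega)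
      exact ⟨i + 1, by simpa using hi, l, by simpa using hl, by rw [offset_cons]; omega⟩

theorem offset_mono {B : List (List Point)} {i j : ℕ} (hij : i ≤ j) (hj : j ≤ B.length) :
    offset B i ≤ offset B j := by
  induction j, hij using Nat.le_induction with
  | base => exact le_rfl
  | succ j _ ih => rw [offset_succ (by omega)]; have := ih (by omega); omega

/-- The boundary of `P` is the union of the axis-parallel segments from vertex `a` to vertex `nxt a`,
for `a < n`. -/
structure IsBoundary (P : Set Point) (n : ℕ) (xs ys : ℕ → ℝ) (nxt : ℕ → ℕ) : Prop where
  nxt_lt : ∀ a < n, nxt a < n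
  axisParallel : ∀ a < n, xs a = xs (nxt a) ∨ ys a = ys (nxt a)
  mem_frontier : ∀ p, p ∈ frontier P ↔
    ∃ a < n, p ∈ segment ℝ (xs a, ys a) (xs (nxt a), ys (nxt a))

/-- The successor of the last vertex of a cycle is its first vertex; every other vertex is followed
by its successor in the list of all vertices. -/
structure IsNext (B : List (List Point)) (nxt : ℕ → ℕ) : Prop where
  last : ∀ i < B.length, nxt (offset B (i + 1) - 1) = offset B i
  succ : ∀ a < numVertices B, (∀ i < B.length, a ≠ offset B (i + 1) - 1) → nxt a = a + 1

theorem IsNext.nxt_offset_add {B : List (List Point)} {nxt : ℕ → ℕ} (h : IsNext B nxt)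
    (hB : ∀ c ∈ B, 4 ≤ c.length) {i l : ℕ} (hi : i < B.length) (hl : l < (B.getD i []).length) :
    nxt (offset B i + l) = offset B i + (l + 1) % (B.getD i []).length := by
  have hs := offset_succ hi
  have pos : ∀ k < B.length, 4 ≤ (B.getD k []).length := fun k hk => by
    rw [List.getD_eq_getElem _ _ hk]; exact hB _ (List.getElem_mem hk)
  by_cases hl' : l + 1 = (B.getD i []).length
  · rw [hl', Nat.mod_self, Nat.add_zero, show offset B i + l = offset B (i + 1) - 1 by omega]
    exact h.last i hi
  · rw [Nat.mod_eq_of_lt (by omega)]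
    have hn := offset_mono (B := B) (i := i + 1) hi le_rfl
    rw [offset_length] at hn
    rw [h.succ _ (by omega) fun k hk => ?_]
    · omega
    · rcases lt_or_ge k i with hki | hki
      · have h1 := offset_mono (B := B) (i := k + 1) hki hi.le
        have h2 := offset_succ hk
        have h3 := pos k hk
        omega
      · have h1 := offset_mono (B := B) (i := i + 1) (j := k + 1) (by omega) hk
        omega

theorem IsOrthogonalPolygon.isBoundary {P : Set Point} {B : List (List Point)}
    (h : IsOrthogonalPolygon P B) {nxt : ℕ → ℕ} (hn : IsNext B nxt) :
    IsBoundary P (numVertices B) (fun a => (B.flatten.map Prod.fst).getD a 0)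
      (fun a => (B.flatten.map Prod.snd).getD a 0) nxt := by
  have hB : ∀ c ∈ B, 4 ≤ c.length := fun c hc => (h.cycles c hc).four_le
  have hpt : ∀ a, (((B.flatten.map Prod.fst).getD a 0, (B.flatten.map Prod.snd).getD a 0) : Point) =
      B.flatten.getD a 0 := by
    intro a
    have e1 := List.getD_map (l := B.flatten) (n := a) (d := (0 : Point)) (f := Prod.fst)
    have e2 := List.getD_map (l := B.flatten) (n := a) (d := (0 : Point)) (f := Prod.snd)
    rw [Prod.fst_zero] at e1
    rw [Prod.snd_zero] at e2
    rw [e1, e2]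
  have hmem : ∀ {i}, i < B.length → B.getD i [] ∈ B := fun hi => by
    rw [List.getD_eq_getElem _ _ hi]; exact List.getElem_mem hi
  have hv : ∀ {i l}, i < B.length → l < (B.getD i []).length →
      B.flatten.getD (offset B i + l) 0 = cycleVertex (B.getD i []) l ∧
      B.flatten.getD (nxt (offset B i + l)) 0 = cycleVertex (B.getD i []) (l + 1) := by
    intro i l hi hl
    rw [hn.nxt_offset_add hB hi hl, getD_flatten hi hl,
      getD_flatten hi (Nat.mod_lt _ (by omega))]
    exact ⟨by rw [cycleVertex, Nat.mod_eq_of_lt hl], rfl⟩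
  have hlt : ∀ {i l}, i < B.length → l < (B.getD i []).length →
      offset B i + l < numVertices B := by
    intro i l hi hl
    have h1 := offset_mono (B := B) (i := i + 1) hi le_rfl
    rw [offset_length, offset_succ hi] at h1
    omega
  refine ⟨fun a ha => ?_, fun a ha => ?_, fun p => ?_⟩
  · obtain ⟨i, hi, l, hl, rfl⟩ := exists_eq_offset_add ha
    rw [hn.nxt_offset_add hB hi hl]
    exact hlt hi (Nat.mod_lt _ (by omega))
  · obtain ⟨i, hi, l, hl, rfl⟩ := exists_eq_offset_add ha
    have h1 := (h.cycles _ (hmem hi)).axisParallel l hl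
    rw [← (hv hi hl).1, ← (hv hi hl).2, ← hpt, ← hpt] at h1
    exact h1
  · simp only [hpt]
    rw [h.frontier_eq]
    constructor
    · rintro ⟨c, hc, l, hl, hp⟩
      obtain ⟨i, hi, rfl⟩ := List.getElem_of_mem hc
      rw [← List.getD_eq_getElem _ [] hi] at hl hp
      refine ⟨_, hlt hi hl, ?_⟩
      rw [(hv hi hl).1, (hv hi hl).2]
      exact hp
    · rintro ⟨a, ha, hp⟩
      obtain ⟨i, hi, l, hl, rfl⟩ := exists_eq_offset_add ha
      rw [(hv hi hl).1, (hv hi hl).2] at hp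
      exact ⟨_, hmem hi, l, hl, hp⟩

/-- `z` is the next larger value after `u` among `x 0`, ..., `x (n - 1)`, or `u` if there is none. -/
structure IsStep (n : ℕ) (x : ℕ → ℝ) (u z : ℝ) : Prop where
  le : u ≤ z
  gap : ∀ a < n, x a ≤ u ∨ u < z ∧ z ≤ x a
  attained : z = u ∨ ∃ a < n, x a = z

/-- `X 0, ..., X n` lists the values of `x 0, ..., x (n - 1)` in increasing order, the largest one
being repeated at the end. -/
structure IsSorting (n : ℕ) (x X : ℕ → ℝ) : Prop where
  first_le : ∀ a < n, X 0 ≤ x a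
  step : ∀ i < n, IsStep n x (X i) (X (i + 1))

namespace IsSorting

variable {n : ℕ} {x X : ℕ → ℝ} (h : IsSorting n x X)
include h

/-- Every step decreases the number of larger values, until none is left. -/
theorem le_last : ∀ a < n, x a ≤ X n := by
  classical
  have key : ∀ i ≤ n, {a ∈ Finset.range n | X i < x a}.card ≤ n - i := by
    intro i
    induction i with
    | zero =>
      intro _
      exact (Finset.card_filter_le _ _).trans (Finset.card_range _).le
    | succ i ih =>
      intro hi
      have hst := h.step i hi
      have h1 := ih (by omega)
      rcases hst.attained with he | ⟨a, ha, he⟩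
      · have : {a ∈ Finset.range n | X (i + 1) < x a} = ∅ := by
          refine Finset.filter_false_of_mem fun a ha hlt => ?_
          rcases hst.gap a (Finset.mem_range.1 ha) with h2 | h2
          exacts [by linarith, by linarith [h2.1]]
        rw [this]; simp
      · by_cases hlt : X i < X (i + 1)
        · have : {a ∈ Finset.range n | X (i + 1) < x a}.card <
              {a ∈ Finset.range n | X i < x a}.card := by
            refine Finset.card_lt_card (Finset.ssubset_iff_of_subset (fun b hb => ?_) |>.2
              ⟨a, ?_, ?_⟩)
            · rw [Finset.mem_filter] at hb ⊢
              exact ⟨hb.1, hlt.trans hb.2⟩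
            · rw [Finset.mem_filter, Finset.mem_range]; exact ⟨ha, he ▸ hlt⟩
            · rw [Finset.mem_filter, he]; exact fun hb => lt_irrefl _ hb.2
          omega
        · have : {a ∈ Finset.range n | X (i + 1) < x a} = ∅ := by
            refine Finset.filter_false_of_mem fun a ha hlt' => ?_
            rcases hst.gap a (Finset.mem_range.1 ha) with h2 | h2
            · linarith [hst.le]
            · exact hlt h2.1
          rw [this]; simp
  intro a ha
  by_contra hlt
  have h1 := key n le_rfl
  rw [Nat.sub_self, Nat.le_zero, Finset.card_eq_zero] at h1
  have : a ∈ {a ∈ Finset.range n | X n < x a} :=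
    Finset.mem_filter.2 ⟨Finset.mem_range.2 ha, not_le.1 hlt⟩
  rw [h1] at this
  simp at this

/-- Repetitions occur only at the end. -/
theorem strict {i : ℕ} (hi : i + 1 < n) (hlt : X (i + 1) < X (i + 2)) : X i < X (i + 1) := by
  obtain ⟨a, ha, he⟩ := (h.step (i + 1) hi).attained.resolve_left hlt.ne'
  rcases (h.step i (by omega)).gap a ha with h1 | h1
  · have h2 := (h.step i (by omega)).le
    linarith
  · exact h1.1

end IsSorting

namespace IsBoundary

variable {P : Set Point} {n : ℕ} {xs ys X Y : ℕ → ℝ} {nxt : ℕ → ℕ}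
  (h : IsBoundary P n xs ys nxt) (hX : IsSorting n xs X) (hY : IsSorting n ys Y)
include h hX

/-- No edge extends beyond the grid. -/
theorem fst_mem {a : ℕ} (ha : a < n) {p : Point} (h1 : p.1 ∈ uIcc (xs a) (xs (nxt a))) :
    X 0 ≤ p.1 ∧ p.1 ≤ X n := by
  have h2 := h.nxt_lt a ha
  exact ⟨(le_inf (hX.first_le a ha) (hX.first_le _ h2)).trans h1.1,
    h1.2.trans (sup_le (hX.le_last a ha) (hX.le_last _ h2))⟩

include hY

/-- The lines through the vertices form a grid. -/
theorem isGrid (hP : IsCompact P) (hc : closure (interior P) = P) : IsGrid P n X Y := by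
  have key : ∀ p ∈ frontier P, ∃ a < n, (p.1 ∈ uIcc (xs a) (xs (nxt a)) ∧
      p.2 ∈ uIcc (ys a) (ys (nxt a))) ∧ (p.1 = xs a ∨ p.2 = ys a) := by
    intro p hp
    obtain ⟨a, ha, hs⟩ := (h.mem_frontier p).1 hp
    refine ⟨a, ha, ?_⟩
    rcases h.axisParallel a ha with he | he
    · rw [← he] at hs ⊢
      obtain ⟨h1, h2⟩ := mem_segment_vertical.1 hs
      exact ⟨⟨by rw [h1]; exact left_mem_uIcc, h2⟩, Or.inl h1⟩
    · rw [← he] at hs ⊢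
      obtain ⟨h1, h2⟩ := mem_segment_horizontal.1 hs
      exact ⟨⟨h2, by rw [h1]; exact left_mem_uIcc⟩, Or.inr h1⟩
  refine ⟨hP, hc, fun i hi => (hX.step i hi).le, fun i hi => (hY.step i hi).le,
    fun i hi => hX.strict hi, fun i hi => hY.strict hi, fun p hp => ?_, fun p hp => ?_⟩
  · obtain ⟨a, ha, ⟨h1, h2⟩, -⟩ := key p hp
    obtain ⟨h3, h4⟩ := h.fst_mem hX ha h1
    have h5 := h.nxt_lt a ha
    exact ⟨h3, h4, (le_inf (hY.first_le a ha) (hY.first_le _ h5)).trans h2.1,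
      h2.2.trans (sup_le (hY.le_last a ha) (hY.le_last _ h5))⟩
  · obtain ⟨a, ha, -, h1 | h1⟩ := key p hp
    · refine Or.inl fun i hi hm => ?_
      rw [h1] at hm
      rcases (hX.step i hi).gap a ha with h2 | h2
      exacts [absurd hm.1 (not_lt.2 h2), absurd hm.2 (not_lt.2 h2.2)]
    · refine Or.inr fun i hi hm => ?_
      rw [h1] at hm
      rcases (hY.step i hi).gap a ha with h2 | h2
      exacts [absurd hm.1 (not_lt.2 h2), absurd hm.2 (not_lt.2 h2.2)]

end IsBoundary

/-- The edge from `a` to `nxt a` is horizontal, at height `y`, and extends over the interval from `u`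
to `v`. -/
def Spans (xs ys : ℕ → ℝ) (nxt : ℕ → ℕ) (u v y : ℝ) (a : ℕ) : Prop :=
  ys a = y ∧ ys (nxt a) = y ∧
    ((xs a ≤ u ∧ v ≤ xs (nxt a)) ∨ (xs (nxt a) ≤ u ∧ v ≤ xs a))

namespace IsBoundary

variable {P : Set Point} {n : ℕ} {xs ys X : ℕ → ℝ} {nxt : ℕ → ℕ}
  (h : IsBoundary P n xs ys nxt) (hX : IsSorting n xs X)
include h

theorem subset_frontier {u v y : ℝ} {a : ℕ} (ha : a < n) (hs : Spans xs ys nxt u v y a) :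
    Ioo u v ×ˢ {y} ⊆ frontier P := by
  rintro ⟨s, t⟩ ⟨h1, h2⟩
  obtain rfl : t = y := h2
  obtain ⟨e1, e2, h3⟩ := hs
  refine (h.mem_frontier _).2 ⟨a, ha, ?_⟩
  rw [e1, e2, mem_segment_horizontal]
  refine ⟨rfl, ?_⟩
  simp only [mem_uIcc]
  rcases h3 with h3 | h3
  · exact Or.inl ⟨h3.1.trans h1.1.le, h1.2.le.trans h3.2⟩
  · exact Or.inr ⟨h3.1.trans h1.1.le, h1.2.le.trans h3.2⟩

include hX

theorem disjoint_frontier {i : ℕ} (hi : i < n) {y : ℝ}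
    (hs : ¬ ∃ a < n, Spans xs ys nxt (X i) (X (i + 1)) y a) :
    Disjoint (Ioo (X i) (X (i + 1)) ×ˢ {y}) (frontier P) := by
  rw [disjoint_left]
  rintro ⟨s, t⟩ ⟨h1, h2⟩ hp
  obtain rfl : t = y := h2
  obtain ⟨a, ha, hseg⟩ := (h.mem_frontier _).1 hp
  have g1 := (hX.step i hi).gap a ha
  have g2 := (hX.step i hi).gap _ (h.nxt_lt a ha)
  obtain ⟨h3, h4⟩ := h1
  simp only at h3 h4
  rcases h.axisParallel a ha with he | he
  · rw [← he] at hseg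
    have h5 := (mem_segment_vertical.1 hseg).1
    simp only at h5
    rcases g1 with g1 | g1
    exacts [by linarith, by linarith [g1.2]]
  · rw [← he] at hseg
    obtain ⟨h5, h6⟩ := mem_segment_horizontal.1 hseg
    simp only at h5 h6
    refine hs ⟨a, ha, h5.symm, he ▸ h5.symm, ?_⟩
    rw [mem_uIcc] at h6
    rcases h6 with h6 | h6
    · left
      constructor
      · rcases g1 with g1 | g1
        exacts [g1, by linarith [g1.2]]
      · rcases g2 with g2 | g2
        exacts [by linarith, g2.2]
    · right
      constructor
      · rcases g2 with g2 | g2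
        exacts [g2, by linarith [g2.2]]
      · rcases g1 with g1 | g1
        exacts [by linarith, g1.2]

/-- The rule by which the algorithm decides which cells are contained in `P`, from bottom to top. -/
theorem inCell_iff {Y : ℕ → ℝ} (hY : IsSorting n ys Y) (hP : IsCompact P)
    (hc : closure (interior P) = P) {i j : ℕ} (hi : i < n) (hj : j < n) :
    InCell P X Y i j ↔ X i < X (i + 1) ∧ Y j < Y (j + 1) ∧
      ¬ ((j ≠ 0 ∧ InCell P X Y i (j - 1)) ↔
        ∃ a < n, Spans xs ys nxt (X i) (X (i + 1)) (Y j) a) := by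
  have hg := h.isGrid hX hY hP hc
  by_cases hXi : X i < X (i + 1)
  swap
  · exact iff_of_false (fun h => hXi h.1) fun h => hXi h.1
  by_cases hYj : Y j < Y (j + 1)
  swap
  · exact iff_of_false (fun h => hYj h.2.1) fun h => hYj h.2.1
  obtain ⟨x, hx⟩ := exists_between hXi
  have hE : Ioo (X i) (X (i + 1)) ×ˢ {Y j} ⊆ frontier P ↔
      ∃ a < n, Spans xs ys nxt (X i) (X (i + 1)) (Y j) a := by
    constructor
    · intro hs
      by_contra hn
      exact disjoint_left.1 (h.disjoint_frontier hX hi hn) (show (x, Y j) ∈ _ from ⟨hx, rfl⟩)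
        (hs ⟨hx, rfl⟩)
    · rintro ⟨a, ha, hs⟩
      exact h.subset_frontier ha hs
  have hE' : Ioo (X i) (X (i + 1)) ×ˢ {Y j} ⊆ frontier P ∨
      Disjoint (Ioo (X i) (X (i + 1)) ×ˢ {Y j}) (frontier P) := by
    rw [hE]
    by_cases hs : ∃ a < n, Spans xs ys nxt (X i) (X (i + 1)) (Y j) a
    exacts [Or.inl hs, Or.inr (h.disjoint_frontier hX hi hs)]
  rw [and_iff_right hXi, and_iff_right hYj, ← hE]
  cases j with
  | zero => rw [hg.inCell_zero hi hj hXi hYj hE']; simp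
  | succ j => rw [hg.inCell_succ hi hj hXi hYj hE']; simp

end IsBoundary

/-! ### The program -/

attribute [simp] nat_setNat real_setReal nat_setReal real_setNat NatExpr.eval RealExpr.eval
  Test.Holds ForProg.den ForProg.Ok ForProg.counters ForProg.natWrites ForProg.realWrites

/-! The arrays of naturals hold: the lengths and positions of the cycles, the successors of the
vertices, the number of cells (in cell `0`), the column and row of each cell, whether it is in the
polygon (`1` or `0`), two auxiliary bits, the first cells of its vertical and horizontal run, the labels
of the push-relabel method for both sides of the graph, the labels that occur, and a label that does not
occur (in cell `0`). The arrays of reals hold the sorted coordinates and the excesses and the flow of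
the push-relabel method. -/

notation "aLen" => (1 : ℕ)
notation "aOffset" => (12 : ℕ)
notation "aNext" => (13 : ℕ)
notation "aSize" => (14 : ℕ)
notation "aCol" => (15 : ℕ)
notation "aRow" => (16 : ℕ)
notation "aIn" => (17 : ℕ)
notation "aFlag" => (18 : ℕ)
notation "aPrev" => (19 : ℕ)
notation "aVid" => (20 : ℕ)
notation "aHid" => (21 : ℕ)
notation "aDV" => (22 : ℕ)
notation "aDH" => (23 : ℕ)
notation "aOcc" => (24 : ℕ)
notation "aGap" => (25 : ℕ)
notation "rX" => (6 : ℕ)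
notation "rY" => (7 : ℕ)
notation "rE" => (8 : ℕ)
notation "rG" => (9 : ℕ)
notation "rF" => (10 : ℕ)

/-- The value of a loop counter. -/
@[simp] def cnt (v : ℕ) : NatExpr := .get ctr (.lit v)

namespace ForProg

/-- Compute the positions of the cycles in the list of all vertices. -/
def offsets : ForProg :=
  loop 0 0 (setNat aOffset (.add (cnt 0) (.lit 1)) (.add (.get aOffset (cnt 0)) (.get aLen (cnt 0))))

/-- Compute the successor of each vertex on its cycle. -/
def successors : ForProg :=
  seq (loop 0 1 (setNat aNext (cnt 0) (.add (cnt 0) (.lit 1))))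
    (loop 0 0 (setNat aNext (.sub (.get aOffset (.add (cnt 0) (.lit 1))) (.lit 1))
      (.get aOffset (cnt 0))))

/-- Find the minimum of the array `src`. -/
def findMin (src dst : ℕ) : ForProg :=
  seq (setReal dst (.lit 0) (.get src (.lit 0)))
    (loop 0 1 (branch (.realLt (.get src (cnt 0)) (.get dst (.lit 0)))
      (setReal dst (.lit 0) (.get src (cnt 0))) skip))

/-- Find the next larger value of the array `src`. -/
def findNext (src dst : ℕ) : ForProg :=
  seq (setReal dst (.add (cnt 0) (.lit 1)) (.get dst (cnt 0)))
    (loop 1 1 (branch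
      (.and (.realLt (.get dst (cnt 0)) (.get src (cnt 1)))
        (.not (.and (.realLt (.get dst (cnt 0)) (.get dst (.add (cnt 0) (.lit 1))))
          (.not (.realLt (.get src (cnt 1)) (.get dst (.add (cnt 0) (.lit 1))))))))
      (setReal dst (.add (cnt 0) (.lit 1)) (.get src (cnt 1))) skip))

/-- Sort the array `src` into `dst`, without repetitions. -/
def sort (src dst : ℕ) : ForProg := seq (findMin src dst) (loop 0 1 (findNext src dst))

/-- Compute the square of the number of vertices. -/
def square : ForProg :=
  loop 0 1 (setNat aSize (.lit 0) (.add (.get aSize (.lit 0)) (.get bnd (.lit 1))))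

/-- Compute the columns and rows of the cells. -/
def coordinates : ForProg :=
  loop 0 2 (branch (.natEq (cnt 0) (.lit 0)) skip
    (branch (.natEq (.add (.get aRow (.sub (cnt 0) (.lit 1))) (.lit 1)) (.get bnd (.lit 1)))
      (seq (setNat aCol (cnt 0) (.add (.get aCol (.sub (cnt 0) (.lit 1))) (.lit 1)))
        (setNat aRow (cnt 0) (.lit 0)))
      (seq (setNat aCol (cnt 0) (.get aCol (.sub (cnt 0) (.lit 1))))
        (setNat aRow (cnt 0) (.add (.get aRow (.sub (cnt 0) (.lit 1))) (.lit 1))))))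

/-- The test whether the polygon edge of counter `1` covers the bottom side of the cell of
counter `0`. -/
def spansTest : Test :=
  .and (.realEq (.get 1 (cnt 1)) (.get rY (.get aRow (cnt 0))))
    (.and (.realEq (.get 1 (.get aNext (cnt 1))) (.get rY (.get aRow (cnt 0))))
      (.not (.and
        (.not (.and (.not (.realLt (.get rX (.get aCol (cnt 0))) (.get 0 (cnt 1))))
          (.not (.realLt (.get 0 (.get aNext (cnt 1)))
            (.get rX (.add (.get aCol (cnt 0)) (.lit 1)))))))
        (.not (.and (.not (.realLt (.get rX (.get aCol (cnt 0))) (.get 0 (.get aNext (cnt 1)))))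
          (.not (.realLt (.get 0 (cnt 1)) (.get rX (.add (.get aCol (cnt 0)) (.lit 1))))))))))

/-- Test whether some polygon edge covers the bottom side of a cell. -/
def findEdge : ForProg :=
  seq (setNat aFlag (.lit 0) (.lit 0))
    (loop 1 1 (branch spansTest (setNat aFlag (.lit 0) (.lit 1)) skip))

/-- Decide whether a cell is contained in the polygon. -/
def decideCell : ForProg :=
  seq (setNat aPrev (.lit 0) (.lit 0))
    (seq (branch (.natEq (.get aRow (cnt 0)) (.lit 0)) skip
        (setNat aPrev (.lit 0) (.get aIn (.sub (cnt 0) (.lit 1)))))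
      (branch (.and (.realLt (.get rX (.get aCol (cnt 0)))
            (.get rX (.add (.get aCol (cnt 0)) (.lit 1))))
          (.and (.realLt (.get rY (.get aRow (cnt 0)))
            (.get rY (.add (.get aRow (cnt 0)) (.lit 1))))
          (.not (.natEq (.get aPrev (.lit 0)) (.get aFlag (.lit 0))))))
        (setNat aIn (cnt 0) (.lit 1)) (setNat aIn (cnt 0) (.lit 0))))

/-- Decide which cells are contained in the polygon. -/
def inside : ForProg := loop 0 2 (seq findEdge decideCell)

/-- Compute the first cell of the vertical run of a cell. -/
def setVid : ForProg :=
  branch (.and (.not (.natEq (.get aRow (cnt 0)) (.lit 0)))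
      (.natEq (.get aIn (.sub (cnt 0) (.lit 1))) (.lit 1)))
    (setNat aVid (cnt 0) (.get aVid (.sub (cnt 0) (.lit 1))))
    (setNat aVid (cnt 0) (cnt 0))

/-- Compute the first cell of the horizontal run of a cell. -/
def setHid : ForProg :=
  branch (.and (.not (.natEq (.get aCol (cnt 0)) (.lit 0)))
      (.natEq (.get aIn (.sub (cnt 0) (.get bnd (.lit 1)))) (.lit 1)))
    (setNat aHid (cnt 0) (.get aHid (.sub (cnt 0) (.get bnd (.lit 1)))))
    (setNat aHid (cnt 0) (cnt 0))

/-- Compute the weight of the vertical run that starts in a cell. -/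
def setWeightV : ForProg :=
  branch (.and (.natEq (.get aIn (cnt 0)) (.lit 1)) (.natEq (.get aVid (cnt 0)) (cnt 0)))
    (setReal rE (cnt 0) (.sub (.get rX (.add (.get aCol (cnt 0)) (.lit 1)))
      (.get rX (.get aCol (cnt 0))))) (setReal rE (cnt 0) .zero)

/-- Compute the negative of the weight of the horizontal run that starts in a cell. -/
def setWeightH : ForProg :=
  branch (.and (.natEq (.get aIn (cnt 0)) (.lit 1)) (.natEq (.get aHid (cnt 0)) (cnt 0)))
    (setReal rG (cnt 0) (.sub (.get rY (.get aRow (cnt 0)))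
      (.get rY (.add (.get aRow (cnt 0)) (.lit 1))))) (setReal rG (cnt 0) .zero)

/-- Compute the bipartite graph of the runs. -/
def runs : ForProg := loop 0 2 (seq (seq setVid setHid) (seq setWeightV setWeightH))

/-- The left node of the cell of counter `0`. -/
@[simp] def vidE : NatExpr := .get aVid (cnt 0)

/-- The right node of the cell of counter `0`. -/
@[simp] def hidE : NatExpr := .get aHid (cnt 0)

/-- Push along a cell from its left node. -/
def pushVCell : ForProg :=
  branch (.and (.natEq (.get aIn (cnt 0)) (.lit 1)) (.and (.realLt .zero (.get rE vidE))
      (.natEq (.get aDV vidE) (.add (.get aDH hidE) (.lit 1)))))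
    (seq (setReal rF (cnt 0) (.add (.get rF (cnt 0)) (.get rE vidE)))
      (seq (setReal rG hidE (.add (.get rG hidE) (.get rE vidE))) (setReal rE vidE .zero))) skip

/-- Push along a cell from its right node. -/
def pushHCell : ForProg :=
  branch (.and (.natEq (.get aIn (cnt 0)) (.lit 1)) (.and (.realLt .zero (.get rG hidE))
      (.and (.realLt .zero (.get rF (cnt 0)))
        (.natEq (.get aDH hidE) (.add (.get aDV vidE) (.lit 1))))))
    (branch (.realLt (.get rF (cnt 0)) (.get rG hidE))
      (seq (setReal rE vidE (.add (.get rE vidE) (.get rF (cnt 0))))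
        (seq (setReal rG hidE (.sub (.get rG hidE) (.get rF (cnt 0)))) (setReal rF (cnt 0) .zero)))
      (seq (setReal rE vidE (.add (.get rE vidE) (.get rG hidE)))
        (seq (setReal rF (cnt 0) (.sub (.get rF (cnt 0)) (.get rG hidE)))
          (setReal rG hidE .zero)))) skip

/-- Lift a node, where the excess is stored in `e` and the label in `d`. -/
def liftNode (e d : ℕ) : ForProg :=
  branch (.and (.realLt .zero (.get e (cnt 0))) (.natLt (.get d (cnt 0)) (.get bnd (.lit 3))))
    (setNat d (cnt 0) (.add (.get d (cnt 0)) (.lit 1))) skip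

/-- One round of the push-relabel method. -/
def pushRelabelRound : ForProg :=
  seq (loop 0 2 pushVCell) (seq (loop 0 2 (liftNode rE aDV))
    (seq (loop 0 2 pushHCell) (loop 0 2 (liftNode rG aDH))))

/-- The push-relabel method. -/
def pushRelabel : ForProg := loop 1 3 (loop 2 3 (loop 3 3 (loop 4 3 pushRelabelRound)))

/-- Mark the labels that occur. -/
def occurring : ForProg :=
  loop 0 2 (seq (setNat aOcc (.get aDV (cnt 0)) (.lit 1)) (setNat aOcc (.get aDH (cnt 0)) (.lit 1)))

/-- Find a positive label that does not occur. -/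
def findGap : ForProg :=
  loop 0 3 (branch (.natEq (.get aOcc (.add (cnt 0) (.lit 1))) (.lit 0))
    (setNat aGap (.lit 0) (.add (cnt 0) (.lit 1))) skip)

/-- Append a segment to the output, which is stored in the arrays `2` of naturals and `2`, ..., `5` of
reals. -/
def emit (x y z w : RealExpr) : ForProg :=
  seq (setReal 2 (.get 2 (.lit 0)) x) (seq (setReal 3 (.get 2 (.lit 0)) y)
    (seq (setReal 4 (.get 2 (.lit 0)) z) (seq (setReal 5 (.get 2 (.lit 0)) w)
      (setNat 2 (.lit 0) (.add (.get 2 (.lit 0)) (.lit 1))))))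

/-- Output the camera of the vertical run that starts in a cell, if it is selected. -/
def outputV : ForProg :=
  branch (.and (.natEq (.get aIn (cnt 0)) (.lit 1)) (.and (.natEq (.get aVid (cnt 0)) (cnt 0))
      (.natLt (.get aDV (cnt 0)) (.get aGap (.lit 0)))))
    (emit (.get rX (.get aCol (cnt 0))) (.get rY (.get aRow (cnt 0)))
      (.get rX (.add (.get aCol (cnt 0)) (.lit 1))) (.get rY (.get aRow (cnt 0)))) skip

/-- Output the camera of the horizontal run that starts in a cell, if it is selected. -/
def outputH : ForProg :=
  branch (.and (.natEq (.get aIn (cnt 0)) (.lit 1)) (.and (.natEq (.get aHid (cnt 0)) (cnt 0))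
      (.natLt (.get aGap (.lit 0)) (.get aDH (cnt 0)))))
    (emit (.get rX (.get aCol (cnt 0))) (.get rY (.get aRow (cnt 0)))
      (.get rX (.get aCol (cnt 0))) (.get rY (.add (.get aRow (cnt 0)) (.lit 1)))) skip

/-- Output the cameras. -/
def output : ForProg := loop 0 2 (seq outputV outputH)

/-! ### Correctness of the preparation -/

theorem offsets_spec {B : List (List Point)} {σ : State} (h0 : σ.nat aOffset 0 = 0)
    (hb : σ.nat bnd 0 = B.length) (hl : ∀ i < B.length, σ.nat aLen i = (B.getD i []).length) :
    ∀ i ≤ B.length, (offsets.den σ).nat aOffset i = offset B i := by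
  have := loop_induction (v := 0) (b := 0) (σ := σ) (p := setNat aOffset (.add (cnt 0) (.lit 1))
    (.add (.get aOffset (cnt 0)) (.get aLen (cnt 0)))) (by simp)
    (fun i τ => ∀ k ≤ i, τ.nat aOffset k = offset B k) ?_ ?_
  · rw [hb] at this
    exact this
  · intro k hk
    obtain rfl : k = 0 := by omega
    simp [h0, offset_zero]
  · intro i τ hi hf hbd hc hI k hk
    rw [hb] at hi
    have h1 : τ.nat aLen = σ.nat aLen := hf.nat _ (by decide) (by simp)
    have h2 := offset_succ hi
    simp [hc]
    split_ifs with h3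
    · rw [hI i le_rfl, h1, hl i hi, h3, h2]
    · exact hI k (by omega)

/-- The second loop corrects the entry of the last vertex of each cycle. -/
theorem successors_spec {B : List (List Point)} {σ : State} (hB : ∀ c ∈ B, 4 ≤ c.length)
    (hb : σ.nat bnd 0 = B.length) (hb' : σ.nat bnd 1 = numVertices B)
    (ho : ∀ i ≤ B.length, σ.nat aOffset i = offset B i) :
    IsNext B ((successors.den σ).nat aNext) := by
  have h1 := loop_induction (v := 0) (b := 1) (σ := σ)
    (p := setNat aNext (cnt 0) (.add (cnt 0) (.lit 1))) (by simp)
    (fun i τ => ∀ k < i, τ.nat aNext k = k + 1) (by simp) (by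
      intro i τ hi hf hbd hc hI k hk
      simp [hc]
      split_ifs with h3
      · rw [h3]
      · exact hI k (by omega))
  have hfr := den_frame (loop 0 1 (setNat aNext (cnt 0) (.add (cnt 0) (.lit 1)))) (by simp) σ
  set ρ := (loop 0 1 (setNat aNext (cnt 0) (.add (cnt 0) (.lit 1)))).den σ with hρ
  have hbρ : ρ.nat bnd = σ.nat bnd := hfr.nat _ (by decide) (by simp)
  have hoρ : ρ.nat aOffset = σ.nat aOffset := hfr.nat _ (by decide) (by simp)
  rw [hb'] at h1
  have pos : ∀ k < B.length, 4 ≤ (B.getD k []).length := fun k hk => by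
    rw [List.getD_eq_getElem _ _ hk]; exact hB _ (List.getElem_mem hk)
  have h2 := loop_induction (v := 0) (b := 0) (σ := ρ)
    (p := setNat aNext (.sub (.get aOffset (.add (cnt 0) (.lit 1))) (.lit 1))
      (.get aOffset (cnt 0))) (by simp)
    (fun i τ => (∀ k < i, τ.nat aNext (offset B (k + 1) - 1) = offset B k) ∧
      ∀ a < numVertices B, (∀ k < i, a ≠ offset B (k + 1) - 1) → τ.nat aNext a = a + 1)
    (by simpa using h1) (by
      intro i τ hi hf hbd hc hI
      rw [hbρ, hb] at hi
      have h3 : τ.nat aOffset = σ.nat aOffset := (hf.nat _ (by decide) (by simp)).trans hoρ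
      refine ⟨fun k hk => ?_, fun a ha hne => ?_⟩
      · simp [hc, h3, ho _ hi, ho _ hi.le]
        split_ifs with h4
        · rcases Nat.lt_succ_iff_lt_or_eq.1 hk with hk | rfl
          · have e1 := offset_mono (B := B) (i := k + 1) (j := i) hk hi.le
            have e2 := offset_succ hi
            have e3 := pos i hi
            have e4 := pos k (by omega)
            have e5 := offset_succ (B := B) (i := k) (by omega)
            omega
          · rfl
        · rcases Nat.lt_succ_iff_lt_or_eq.1 hk with hk | rfl
          · exact hI.1 k hk
          · exact absurd rfl h4
      · have h4 := hne i (by omega)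
        simp [hc, h3, ho _ hi, h4]
        exact hI.2 a ha fun k hk => hne k (by omega))
  rw [hbρ, hb] at h2
  exact ⟨h2.1, h2.2⟩

theorem findMin_spec {src dst : ℕ} (hne : src ≠ dst) (σ : State) :
    ∀ a < σ.nat bnd 1, ((findMin src dst).den σ).real dst 0 ≤ σ.real src a := by
  refine loop_induction (v := 0) (b := 1) (σ := (setReal dst (.lit 0) (.get src (.lit 0))).den σ)
    (p := branch (.realLt (.get src (cnt 0)) (.get dst (.lit 0)))
      (setReal dst (.lit 0) (.get src (cnt 0))) skip) (by simp)
    (fun i τ => ∀ a < i, τ.real dst 0 ≤ σ.real src a) (by simp) ?_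
  intro i τ hi hf hbd hc hI a ha
  have h1 : τ.real src = σ.real src := by
    rw [hf.real src (by simpa using hne), den, real_setReal_of_ne _ _ _ hne]
  simp only [den, Test.Holds, cnt, NatExpr.eval, RealExpr.eval, hc, h1, real_setNat]
  rcases Nat.lt_succ_iff_lt_or_eq.1 ha with ha | rfl
  · split_ifs with h2
    · simp only [real_setReal, and_self, if_true]; exact h2.le.trans (hI a ha)
    · exact hI a ha
  · split_ifs with h2
    · simp
    · exact not_lt.1 h2

theorem findNext_spec {src dst : ℕ} (hne : src ≠ dst) (σ : State) {i : ℕ} (hc : σ.nat ctr 0 = i) :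
    IsStep (σ.nat bnd 1) (σ.real src) (σ.real dst i) (((findNext src dst).den σ).real dst (i + 1)) ∧
      ∀ k ≠ i + 1, ((findNext src dst).den σ).real dst k = σ.real dst k := by
  refine loop_induction (v := 1) (b := 1)
    (σ := (setReal dst (.add (cnt 0) (.lit 1)) (.get dst (cnt 0))).den σ) (p := branch
      (.and (.realLt (.get dst (cnt 0)) (.get src (cnt 1)))
        (.not (.and (.realLt (.get dst (cnt 0)) (.get dst (.add (cnt 0) (.lit 1))))
          (.not (.realLt (.get src (cnt 1)) (.get dst (.add (cnt 0) (.lit 1))))))))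
      (setReal dst (.add (cnt 0) (.lit 1)) (.get src (cnt 1))) skip) (by simp)
    (fun m τ => IsStep m (σ.real src) (σ.real dst i) (τ.real dst (i + 1)) ∧
      ∀ k ≠ i + 1, τ.real dst k = σ.real dst k) ?_ ?_
  · refine ⟨?_, fun k hk => by simp [hc, hk]⟩
    have : ((den (setReal dst ((cnt 0).add (NatExpr.lit 1)) (RealExpr.get dst (cnt 0))) σ).setNat
        ctr 1 0).real dst (i + 1) = σ.real dst i := by simp [hc]
    rw [this]
    exact ⟨le_rfl, by simp, Or.inl rfl⟩
  · intro m τ hm hf hbd hc1 hI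
    have h1 : τ.real src = σ.real src := by
      rw [hf.real src (by simpa using hne), den, real_setReal_of_ne _ _ _ hne]
    have h2 : τ.nat ctr 0 = i := by rw [hf.counter 0 (by simp)]; simpa using hc
    obtain ⟨hI, hk⟩ := hI
    have h3 : τ.real dst i = σ.real dst i := hk i (by omega)
    simp only [den, Test.Holds, cnt, NatExpr.eval, RealExpr.eval, hc1, h2, h1, h3, real_setNat]
    split_ifs with h4
    · rw [not_and, not_not] at h4
      refine ⟨?_, fun k hk' => by simp [hk', hk k hk']⟩
      rw [real_setReal, if_pos ⟨rfl, rfl⟩]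
      refine ⟨h4.1.le, fun a ha => ?_, Or.inr ⟨m, by omega, rfl⟩⟩
      rcases Nat.lt_succ_iff_lt_or_eq.1 ha with ha | rfl
      · rcases hI.gap a ha with h5 | h5
        · exact Or.inl h5
        · exact Or.inr ⟨h4.1, (h4.2 h5.1).le.trans h5.2⟩
      · exact Or.inr ⟨h4.1, le_rfl⟩
    · refine ⟨⟨hI.le, fun a ha => ?_, hI.attained.imp_right fun ⟨a, ha, h⟩ => ⟨a, by omega, h⟩⟩, hk⟩
      rcases Nat.lt_succ_iff_lt_or_eq.1 ha with ha | rfl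
      · exact hI.gap a ha
      · by_contra h5
        rw [not_or, not_le, not_and, not_le] at h5
        exact h4 ⟨h5.1, fun h => h.2 (h5.2 h.1)⟩

theorem sort_spec {src dst : ℕ} (hne : src ≠ dst) (σ : State) :
    IsSorting (σ.nat bnd 1) (σ.real src) (((sort src dst).den σ).real dst) := by
  have hok : (findMin src dst).Ok := by simp [findMin]
  have h1 := findMin_spec hne σ
  have hf := den_frame (findMin src dst) hok σ
  set ρ := (findMin src dst).den σ with hρ
  have hb : ρ.nat bnd = σ.nat bnd := den_bnd _ hok σ
  have hs : ρ.real src = σ.real src := hf.real src (by simpa [findMin] using hne)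
  have h2 := loop_induction (v := 0) (b := 1) (σ := ρ) (p := findNext src dst)
    (by simp [findNext])
    (fun i τ => (∀ k < i, IsStep (σ.nat bnd 1) (σ.real src) (τ.real dst k) (τ.real dst (k + 1))) ∧
      τ.real dst 0 = ρ.real dst 0) (by simp) (by
      intro i τ hi hfτ hbτ hc hI
      obtain ⟨h3, h4⟩ := findNext_spec hne τ hc
      rw [hbτ, hb, hfτ.real src (by simpa [findNext] using hne), hs] at h3
      refine ⟨fun k hk => ?_, ?_⟩
      · simp only [real_setNat]
        rw [h4 k (by omega)]
        rcases Nat.lt_succ_iff_lt_or_eq.1 hk with hk | rfl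
        · rw [h4 (k + 1) (by omega)]; exact hI.1 k hk
        · exact h3
      · simp only [real_setNat]
        rw [h4 0 (by omega)]; exact hI.2)
  rw [hb] at h2
  refine ⟨fun a ha => ?_, h2.1⟩
  have h3 := h1 a ha
  rw [← h2.2] at h3
  exact h3

theorem square_spec {σ : State} (h0 : σ.nat aSize 0 = 0) :
    (square.den σ).nat aSize 0 = σ.nat bnd 1 * σ.nat bnd 1 := by
  refine loop_induction (v := 0) (b := 1) (σ := σ)
    (p := setNat aSize (.lit 0) (.add (.get aSize (.lit 0)) (.get bnd (.lit 1)))) (by simp)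
    (fun i τ => τ.nat aSize 0 = i * σ.nat bnd 1) (by simp [h0]) ?_
  intro i τ hi hf hbd hc hI
  simp [hI, hbd, Nat.succ_mul]

end ForProg

/-! ### Correctness of the grid computation -/

namespace ForProg

theorem coordinates_spec {σ : State} {N : ℕ} (hN : σ.nat bnd 1 = N) (hK : σ.nat bnd 2 = N * N)
    (hc0 : σ.nat aCol 0 = 0) (hr0 : σ.nat aRow 0 = 0) :
    ∀ c < N * N, (coordinates.den σ).nat aCol c = c / N ∧ (coordinates.den σ).nat aRow c = c % N := by
  have h := loop_induction (v := 0) (b := 2) (σ := σ)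
    (p := branch (.natEq (cnt 0) (.lit 0)) skip
    (branch (.natEq (.add (.get aRow (.sub (cnt 0) (.lit 1))) (.lit 1)) (.get bnd (.lit 1)))
      (seq (setNat aCol (cnt 0) (.add (.get aCol (.sub (cnt 0) (.lit 1))) (.lit 1)))
        (setNat aRow (cnt 0) (.lit 0)))
      (seq (setNat aCol (cnt 0) (.get aCol (.sub (cnt 0) (.lit 1))))
        (setNat aRow (cnt 0) (.add (.get aRow (.sub (cnt 0) (.lit 1))) (.lit 1)))))) (by simp)
    (fun i τ => (∀ c < i, τ.nat aCol c = c / N ∧ τ.nat aRow c = c % N) ∧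
      (i = 0 → τ.nat aCol 0 = 0 ∧ τ.nat aRow 0 = 0)) (by simp [hc0, hr0]) ?_
  · rw [hK] at h; exact h.1
  intro i τ hi hf hbd hc hI
  rw [hK] at hi
  have hNp := pos_of_lt_mul_self hi
  refine ⟨fun c hci => ?_, by omega⟩
  simp only [den, Test.Holds, cnt, NatExpr.eval, hc, hbd, hN]
  by_cases h0 : i = 0
  · subst h0
    obtain rfl : c = 0 := by omega
    simpa using hI.2 rfl
  · have h1 := hI.1 (i - 1) (by omega)
    rw [if_neg h0, h1.1, h1.2]
    have h2 : i - 1 = (i - 1) / N * N + (i - 1) % N := by rw [Nat.mul_comm, Nat.div_add_mod]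
    have h3 := Nat.mod_lt (i - 1) hNp
    rcases Nat.lt_succ_iff_lt_or_eq.1 hci with hci | rfl
    · split_ifs with h4 <;> simp [hc, hci.ne] <;> exact hI.1 c hci
    · split_ifs with h4
      · have h5 : c = ((c - 1) / N + 1) * N + 0 := by rw [Nat.succ_mul]; omega
        have e1 := cell_div (i := (c - 1) / N + 1) hNp
        have e2 := cell_mod (i := (c - 1) / N + 1) hNp
        rw [← h5] at e1 e2
        simp [hc, e1, e2]
      · have h5 : c = (c - 1) / N * N + ((c - 1) % N + 1) := by omega
        have e1 := cell_div (i := (c - 1) / N) (j := (c - 1) % N + 1) (N := N) (by omega)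
        have e2 := cell_mod (i := (c - 1) / N) (j := (c - 1) % N + 1) (N := N) (by omega)
        rw [← h5] at e1 e2
        simp [hc, e1, e2, h1]

theorem spansTest_holds {τ : State} {a c : ℕ} (ha : τ.nat ctr 1 = a) (hc : τ.nat ctr 0 = c) :
    spansTest.Holds τ ↔ Spans (τ.real 0) (τ.real 1) (τ.nat aNext) (τ.real rX (τ.nat aCol c))
      (τ.real rX (τ.nat aCol c + 1)) (τ.real rY (τ.nat aRow c)) a := by
  simp only [spansTest, Test.Holds, RealExpr.eval, NatExpr.eval, cnt, ha, hc, Spans, not_lt]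
  tauto

open Classical in
theorem findEdge_spec {σ : State} {c : ℕ} (hc : σ.nat ctr 0 = c) :
    (findEdge.den σ).nat aFlag 0 = if ∃ a < σ.nat bnd 1, Spans (σ.real 0) (σ.real 1)
      (σ.nat aNext) (σ.real rX (σ.nat aCol c)) (σ.real rX (σ.nat aCol c + 1))
      (σ.real rY (σ.nat aRow c)) a then 1 else 0 := by
  refine loop_induction (v := 1) (b := 1) (σ := (setNat aFlag (.lit 0) (.lit 0)).den σ)
    (p := branch spansTest (setNat aFlag (.lit 0) (.lit 1)) skip) (by simp)
    (fun i τ => τ.nat aFlag 0 = if ∃ a < i, Spans (σ.real 0) (σ.real 1)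
      (σ.nat aNext) (σ.real rX (σ.nat aCol c)) (σ.real rX (σ.nat aCol c + 1))
      (σ.real rY (σ.nat aRow c)) a then 1 else 0) (by simp) ?_
  intro i τ hi hf hbd hci hI
  have hr : τ.real = σ.real := funext fun k => hf.real k (by simp)
  have hn : ∀ k, k ≠ ctr → k ≠ aFlag → τ.nat k = σ.nat k := fun k h1 h2 =>
    (hf.nat k h1 (by simpa using h2)).trans (nat_setNat_of_ne _ _ _ h2)
  have hc' : τ.nat ctr 0 = c := by rw [hf.counter 0 (by simp)]; simpa using hc
  simp only [den, spansTest_holds hci hc', hr, hn aNext (by decide) (by decide),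
    hn aCol (by decide) (by decide), hn aRow (by decide) (by decide)]
  by_cases h : Spans (σ.real 0) (σ.real 1) (σ.nat aNext) (σ.real rX (σ.nat aCol c))
      (σ.real rX (σ.nat aCol c + 1)) (σ.real rY (σ.nat aRow c)) i
  · rw [if_pos h, if_pos ⟨i, by omega, h⟩]; simp
  · rw [if_neg h]
    simp only [nat_setNat, hI]
    rw [if_neg (by decide)]
    congr 1
    rw [eq_iff_iff]
    refine exists_congr fun a => and_congr_left fun ha => ?_
    constructor
    · omega
    · intro h1
      rcases Nat.lt_succ_iff_lt_or_eq.1 h1 with h1 | rfl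
      exacts [h1, absurd ha h]

/-- The data of the polygon and the grid in a memory. -/
structure HasGrid (P : Set Point) (N : ℕ) (X Y : ℕ → ℝ) (σ : State) : Prop where
  bnd_one : σ.nat bnd 1 = N
  bnd_two : σ.nat bnd 2 = N * N
  X_eq : σ.real rX = X
  Y_eq : σ.real rY = Y
  boundary : IsBoundary P N (σ.real 0) (σ.real 1) (σ.nat aNext)
  sortX : IsSorting N (σ.real 0) X
  sortY : IsSorting N (σ.real 1) Y
  col : ∀ c < N * N, σ.nat aCol c = c / N
  row : ∀ c < N * N, σ.nat aRow c = c % N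

theorem HasGrid.congr {P : Set Point} {N : ℕ} {X Y : ℕ → ℝ} {σ τ : State}
    (h : HasGrid P N X Y σ) (hn : ∀ k ∈ [10, 13, 15, 16], τ.nat k = σ.nat k)
    (hr : ∀ k ∈ [0, 1, 6, 7], τ.real k = σ.real k) : HasGrid P N X Y τ := by
  simp only [List.mem_cons, List.not_mem_nil, or_false, forall_eq_or_imp, forall_eq] at hn hr
  obtain ⟨n1, n2, n3, n4⟩ := hn
  obtain ⟨r1, r2, r3, r4⟩ := hr
  exact ⟨by rw [n1]; exact h.bnd_one, by rw [n1]; exact h.bnd_two, by rw [r3]; exact h.X_eq,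
    by rw [r4]; exact h.Y_eq, by rw [r1, r2, n2]; exact h.boundary, by rw [r1]; exact h.sortX,
    by rw [r2]; exact h.sortY, by rw [n3]; exact h.col, by rw [n4]; exact h.row⟩

theorem Frame.hasGrid {P : Set Point} {N : ℕ} {X Y : ℕ → ℝ} {σ τ : State} {p : ForProg}
    (hf : Frame p σ τ) (h : HasGrid P N X Y σ) (hn : ∀ k ∈ [10, 13, 15, 16], k ∉ p.natWrites)
    (hr : ∀ k ∈ [0, 1, 6, 7], k ∉ p.realWrites) : HasGrid P N X Y τ :=
  h.congr (fun k hk => hf.nat k (by rintro rfl; simp at hk) (hn k hk)) fun k hk =>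
    hf.real k (hr k hk)

section

variable {P : Set Point} {N : ℕ} {X Y : ℕ → ℝ} (hP : IsCompact P)
  (hcl : closure (interior P) = P)
include hP hcl

open Classical in
theorem inside_spec {σ : State} (h : HasGrid P N X Y σ) :
    ∀ c < N * N, (inside.den σ).nat aIn c = if cellIn P N X Y c then 1 else 0 := by
  have hh := loop_induction (v := 0) (b := 2) (σ := σ) (p := seq findEdge decideCell)
    (by simp [findEdge, decideCell])
    (fun i τ => ∀ c < i, τ.nat aIn c = if cellIn P N X Y c then 1 else 0) (by simp) ?_
  · rw [h.bnd_two] at hh; exact hh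
  intro i τ hi hf hbd hc hI
  rw [h.bnd_two] at hi
  have hτ : HasGrid P N X Y τ := hf.hasGrid h (by simp [findEdge, decideCell])
    (by simp [findEdge, decideCell])
  have h1 := findEdge_spec hc
  have hf1 := den_frame findEdge (by simp [findEdge]) τ
  rw [hτ.bnd_one, hτ.X_eq, hτ.Y_eq, hτ.col i hi, hτ.row i hi] at h1
  have hρ : HasGrid P N X Y (findEdge.den τ) := hf1.hasGrid hτ (by simp [findEdge])
    (by simp [findEdge])
  have hcρ : (findEdge.den τ).nat ctr 0 = i := by
    rw [hf1.counter 0 (by simp [findEdge])]; exact hc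
  have hinρ : (findEdge.den τ).nat aIn = τ.nat aIn := hf1.nat _ (by decide) (by simp [findEdge])
  have hcell := hτ.boundary.inCell_iff hτ.sortX hτ.sortY hP hcl (div_lt_of_lt_mul_self hi)
    (mod_lt_of_lt_mul_self hi)
  simp only [den]
  generalize findEdge.den τ = ρ at *
  have hNp := pos_of_lt_mul_self hi
  -- the cell below a cell that is not in the lowest row
  have hbelow : i % N ≠ 0 → cellIn P N X Y (i - 1) = InCell P X Y (i / N) (i % N - 1) := by
    intro h0
    have e : i - 1 = i / N * N + (i % N - 1) := by
      have := Nat.div_add_mod i N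
      rw [Nat.mul_comm] at this
      omega
    have hlt : i % N - 1 < N := by have := Nat.mod_lt i hNp; omega
    rw [cellIn, e, cell_div hlt, cell_mod hlt]
  have hprev : (if i % N = 0 then 0 else if cellIn P N X Y (i - 1) then 1 else 0) =
      if i % N ≠ 0 ∧ InCell P X Y (i / N) (i % N - 1) then 1 else 0 := by
    by_cases h0 : i % N = 0
    · simp [h0]
    · rw [if_neg h0, hbelow h0]; simp [h0]
  have hii : i % N ≠ 0 → τ.nat aIn (i - 1) = if cellIn P N X Y (i - 1) then 1 else 0 := by
    intro h0
    refine hI _ ?_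
    have : i ≠ 0 := by rintro rfl; simp at h0
    omega
  have hval : (decideCell.den ρ).nat aIn = Function.update (τ.nat aIn) i
      (if cellIn P N X Y i then 1 else 0) := by
    have hcond : cellIn P N X Y i ↔ X (i / N) < X (i / N + 1) ∧ Y (i % N) < Y (i % N + 1) ∧
        ¬ (if i % N = 0 then 0 else if cellIn P N X Y (i - 1) then 1 else 0) = ρ.nat aFlag 0 := by
      rw [cellIn, hcell, h1, hprev]
      by_cases q1 : i % N ≠ 0 ∧ InCell P X Y (i / N) (i % N - 1) <;>
        by_cases q2 : ∃ a < N, Spans (τ.real 0) (τ.real 1) (τ.nat aNext) (X (i / N))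
          (X (i / N + 1)) (Y (i % N)) a <;> simp only [q1, q2, if_true, if_false] <;> simp
    funext k
    rw [Function.update_apply]
    by_cases h0 : i % N = 0
    · rw [if_pos h0] at hcond
      by_cases q : cellIn P N X Y i
      · have q' := hcond.1 q
        simp [decideCell, hcρ, hρ.row i hi, hρ.col i hi, hρ.X_eq, hρ.Y_eq, h0, q] at q' ⊢
        rw [if_pos q']; simp [hinρ]
      · have q' := mt hcond.2 q
        simp [decideCell, hcρ, hρ.row i hi, hρ.col i hi, hρ.X_eq, hρ.Y_eq, h0, q] at q' ⊢
        rw [if_neg (by tauto)]; simp [hinρ]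
    · rw [if_neg h0, ← hii h0] at hcond
      by_cases q : cellIn P N X Y i
      · have q' := hcond.1 q
        simp [decideCell, hcρ, hρ.row i hi, hρ.col i hi, hρ.X_eq, hρ.Y_eq, h0, hinρ, q] at q' ⊢
        rw [if_pos q']; simp [hinρ]
      · have q' := mt hcond.2 q
        simp [decideCell, hcρ, hρ.row i hi, hρ.col i hi, hρ.X_eq, hρ.Y_eq, h0, hinρ, q] at q' ⊢
        rw [if_neg (by tauto)]; simp [hinρ]
  intro c hci
  rw [nat_setNat_of_ne _ _ _ (by decide), hval, Function.update_apply]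
  split_ifs with e1 e2 e3
  · rfl
  · rw [← e1] at e2; contradiction
  · rw [← e1] at e2; contradiction
  · rfl
  · rw [hI c (by omega), if_pos ‹_›]
  · rw [hI c (by omega), if_neg ‹_›]

end

open Classical in
theorem cellV_eq (P : Set Point) {N : ℕ} (X Y : ℕ → ℝ) {c : ℕ} (hc : c < N * N) :
    cellV P N X Y c =
      if c % N ≠ 0 ∧ cellIn P N X Y (c - 1) then cellV P N X Y (c - 1) else c := by
  have hdm : c / N * N + c % N = c := by rw [Nat.mul_comm]; exact Nat.div_add_mod c N
  unfold cellV cellIn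
  have hm := mod_lt_of_lt_mul_self hc
  generalize c / N = q at *
  generalize hr : c % N = r at *
  cases r with
  | zero => simp [runStart]; omega
  | succ r =>
    have e : c - 1 = q * N + r := by omega
    rw [e, cell_div (by omega), cell_mod (by omega), runStart]
    by_cases h : InCell P X Y q r
    · simp [h]
    · simp [h]; omega

open Classical in
theorem cellH_eq (P : Set Point) {N : ℕ} (X Y : ℕ → ℝ) {c : ℕ} (hc : c < N * N) :
    cellH P N X Y c =
      if c / N ≠ 0 ∧ cellIn P N X Y (c - N) then cellH P N X Y (c - N) else c := by
  have hdm : c / N * N + c % N = c := by rw [Nat.mul_comm]; exact Nat.div_add_mod c N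
  unfold cellH cellIn
  have hm := mod_lt_of_lt_mul_self hc
  generalize hq : c / N = q at *
  generalize c % N = r at *
  cases q with
  | zero => simp [runStart]; omega
  | succ q =>
    have e : c - N = q * N + r := by rw [Nat.succ_mul] at hdm; omega
    rw [e, cell_div hm, cell_mod hm, runStart]
    by_cases h : InCell P X Y q r
    · simp [h]
    · simp [h]; omega

/-- The membership of the cells in a memory. -/
def HasCells (P : Set Point) (N : ℕ) (X Y : ℕ → ℝ) (σ : State) : Prop :=
  ∀ c < N * N, σ.nat aIn c = 1 ↔ cellIn P N X Y c

open Classical in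
theorem den_branch_setNat (b : Test) (k : ℕ) (i e e' : NatExpr) (σ : State) :
    (branch b (setNat k i e) (setNat k i e')).den σ =
      σ.setNat k (i.eval σ) (if b.Holds σ then e.eval σ else e'.eval σ) := by
  simp only [den]; split_ifs <;> rfl

open Classical in
theorem den_branch_setReal (b : Test) (k : ℕ) (i : NatExpr) (e e' : RealExpr) (σ : State) :
    (branch b (setReal k i e) (setReal k i e')).den σ =
      σ.setReal k (i.eval σ) (if b.Holds σ then e.eval σ else e'.eval σ) := by
  simp only [den]; split_ifs <;> rfl

/-- The first cells of the runs in a memory. -/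
def HasRuns (P : Set Point) (N : ℕ) (X Y : ℕ → ℝ) (m : ℕ) (σ : State) : Prop :=
  ∀ c < m, σ.nat aVid c = cellV P N X Y c ∧ σ.nat aHid c = cellH P N X Y c

/-- One iteration extends the computation of the runs to the next cell. -/
theorem setRuns_spec {P : Set Point} {N : ℕ} {X Y : ℕ → ℝ} {σ : State} (h : HasGrid P N X Y σ)
    (hin : HasCells P N X Y σ) {c : ℕ} (hc : c < N * N) (hcnt : σ.nat ctr 0 = c)
    (hr : HasRuns P N X Y c σ) : HasRuns P N X Y (c + 1) ((seq setVid setHid).den σ) := by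
  classical
  have hNp := pos_of_lt_mul_self hc
  have hV : (setVid.den σ).nat aVid = Function.update (σ.nat aVid) c (cellV P N X Y c) := by
    funext k
    rw [setVid, den_branch_setNat, cellV_eq P X Y hc]
    have h2 : c % N ≠ 0 → c - 1 < c := by
      intro h0
      have : c ≠ 0 := by rintro rfl; simp at h0
      omega
    by_cases h0 : c % N = 0
    · simp [hcnt, h.row c hc, h0, Function.update_apply]
    · simp [hcnt, h.row c hc, h0, Function.update_apply, hin (c - 1) (by omega),
        (hr (c - 1) (h2 h0)).1]
  have hf := den_frame setVid (by simp [setVid]) σ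
  have hH : (setHid.den (setVid.den σ)).nat aHid =
      Function.update (σ.nat aHid) c (cellH P N X Y c) := by
    funext k
    have e1 : (setVid.den σ).nat ctr 0 = c := by rw [hf.counter 0 (by simp [setVid])]; exact hcnt
    have e2 : (setVid.den σ).nat aCol = σ.nat aCol := hf.nat _ (by decide) (by simp [setVid])
    have e3 : (setVid.den σ).nat aIn = σ.nat aIn := hf.nat _ (by decide) (by simp [setVid])
    have e4 : (setVid.den σ).nat aHid = σ.nat aHid := hf.nat _ (by decide) (by simp [setVid])
    have e5 : (setVid.den σ).nat bnd = σ.nat bnd := hf.nat _ (by decide) (by simp [setVid])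
    rw [setHid, den_branch_setNat, cellH_eq P X Y hc]
    have h2 : c / N ≠ 0 → c - N < c := by
      intro h0
      have : c ≠ 0 := by rintro rfl; simp at h0
      omega
    by_cases h0 : c / N = 0
    · simp [e1, e2, e4, h.col c hc, h0, Function.update_apply]
    · simp [e1, e2, e3, e4, e5, h.bnd_one, h.col c hc, h0, Function.update_apply,
        hin (c - N) (by omega), (hr (c - N) (h2 h0)).2]
  have hf' := den_frame setHid (by simp [setHid]) (setVid.den σ)
  intro k hk
  rw [den, hH, hf'.nat aVid (by decide) (by simp [setHid]), hV]
  rcases Nat.lt_succ_iff_lt_or_eq.1 hk with hk | rfl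
  · rw [Function.update_of_ne hk.ne, Function.update_of_ne hk.ne]; exact hr k hk
  · simp

open Classical in
theorem setWeights_spec {P : Set Point} {N : ℕ} {X Y : ℕ → ℝ} {σ : State} (h : HasGrid P N X Y σ)
    (hin : HasCells P N X Y σ) {c : ℕ} (hc : c < N * N) (hcnt : σ.nat ctr 0 = c)
    (hr : HasRuns P N X Y (c + 1) σ) :
    ((seq setWeightV setWeightH).den σ).real rE =
      Function.update (σ.real rE) c ((gridGraph P N X Y).wV c) ∧
    ((seq setWeightV setWeightH).den σ).real rG =
      Function.update (σ.real rG) c (- (gridGraph P N X Y).wH c) := by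
  obtain ⟨h1, h2⟩ := hr c (by omega)
  constructor
  · funext k
    rw [den, (den_frame setWeightH (by simp [setWeightH]) _).real rE (by simp [setWeightH]),
      setWeightV, den_branch_setReal]
    simp [hcnt, hin c hc, h1, h.col c hc, h.X_eq, Function.update_apply, gridGraph, hc]
  · funext k
    have hf := den_frame setWeightV (by simp [setWeightV]) σ
    change (setWeightH.den (setWeightV.den σ)).real rG k = _
    have e1 : (setWeightV.den σ).nat = σ.nat := by
      rw [setWeightV, den_branch_setReal, nat_setReal]
    have e2 : (setWeightV.den σ).real rY = σ.real rY := hf.real _ (by simp [setWeightV])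
    have e3 : (setWeightV.den σ).real rG = σ.real rG := hf.real _ (by simp [setWeightV])
    rw [setWeightH, den_branch_setReal]
    simp only [cnt, NatExpr.eval, Test.Holds, RealExpr.eval, e1, e2, e3, hcnt, hin c hc, h2,
      h.row c hc, h.Y_eq, Function.update_apply, gridGraph, hc, real_setReal, true_and]
    by_cases q : cellIn P N X Y c ∧ cellH P N X Y c = c <;> simp [q]

theorem runs_spec {P : Set Point} {N : ℕ} {X Y : ℕ → ℝ} {σ : State} (h : HasGrid P N X Y σ)
    (hin : HasCells P N X Y σ) (hE : σ.real rE = 0) (hG : σ.real rG = 0) :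
    HasRuns P N X Y (N * N) (runs.den σ) ∧
    (runs.den σ).real rE = (gridGraph P N X Y).wV ∧
    (runs.den σ).real rG = fun c => - (gridGraph P N X Y).wH c := by
  classical
  have ok : (seq setVid setHid).Ok ∧ (seq setWeightV setWeightH).Ok := by
    simp [setVid, setHid, setWeightV, setWeightH]
  have hh := loop_induction (v := 0) (b := 2) (σ := σ)
    (p := seq (seq setVid setHid) (seq setWeightV setWeightH))
    (by simp [setVid, setHid, setWeightV, setWeightH])
    (fun i τ => HasRuns P N X Y i τ ∧
      (∀ c, τ.real rE c = if c < i then (gridGraph P N X Y).wV c else 0) ∧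
      ∀ c, τ.real rG c = if c < i then - (gridGraph P N X Y).wH c else 0)
      (by simp [hE, hG, HasRuns]) ?_
  · rw [h.bnd_two] at hh
    refine ⟨hh.1, funext fun c => ?_, funext fun c => ?_⟩
    · refine (hh.2.1 c).trans ?_
      by_cases hc : c < N * N <;> simp [hc, gridGraph]
    · refine (hh.2.2 c).trans ?_
      by_cases hc : c < N * N <;> simp [hc, gridGraph]
  intro i τ hi hf hbd hc hI
  rw [h.bnd_two] at hi
  have hτ : HasGrid P N X Y τ := hf.hasGrid h (by simp [setVid, setHid, setWeightV, setWeightH])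
    (by simp [setVid, setHid, setWeightV, setWeightH])
  have hinτ : HasCells P N X Y τ := by
    unfold HasCells
    rw [hf.nat aIn (by decide) (by simp [setVid, setHid, setWeightV, setWeightH])]; exact hin
  have hf1 := den_frame _ ok.1 τ
  have hf2 := den_frame _ ok.2 ((seq setVid setHid).den τ)
  have hρ : HasGrid P N X Y ((seq setVid setHid).den τ) :=
    hf1.hasGrid hτ (by simp [setVid, setHid]) (by simp [setVid, setHid])
  have hinρ : HasCells P N X Y ((seq setVid setHid).den τ) := by
    unfold HasCells; rw [hf1.nat aIn (by decide) (by simp [setVid, setHid])]; exact hinτ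
  have hcρ : ((seq setVid setHid).den τ).nat ctr 0 = i := by
    rw [hf1.counter 0 (by simp [setVid, setHid])]; exact hc
  have hr := setRuns_spec hτ hinτ hi hc hI.1
  obtain ⟨h1, h2⟩ := setWeights_spec hρ hinρ hi hcρ hr
  rw [hf1.real rE (by simp [setVid, setHid])] at h1
  rw [hf1.real rG (by simp [setVid, setHid])] at h2
  rw [den.eq_4 (seq setVid setHid)]
  refine ⟨fun c hci => ?_, fun c => ?_, fun c => ?_⟩
  · rw [nat_setNat_of_ne _ _ _ (by decide), nat_setNat_of_ne _ _ _ (by decide),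
      hf2.nat _ (by decide) (by simp [setWeightV, setWeightH]),
      hf2.nat _ (by decide) (by simp [setWeightV, setWeightH])]
    exact hr c hci
  · rw [real_setNat, h1, Function.update_apply]
    by_cases e : c = i
    · simp [e]
    · rw [if_neg e, hI.2.1 c]
      congr 1; rw [eq_iff_iff]; omega
  · rw [real_setNat, h2, Function.update_apply]
    by_cases e : c = i
    · simp [e]
    · rw [if_neg e, hI.2.2 c]
      congr 1; rw [eq_iff_iff]; omega

end ForProg

/-! ### Correctness of the push-relabel method -/

namespace ForProg

/-- The preflow stored in a memory. -/
def flowOf (σ : State) : Preflow := ⟨σ.real rE, σ.real rG, σ.real rF, σ.nat aDV, σ.nat aDH⟩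

/-- The bipartite graph `N` and the maximum label are stored in a memory. -/
structure HasGraph (N : BipartiteGraph) (σ : State) : Prop where
  bnd_two : σ.nat bnd 2 = N.K
  bnd_three : σ.nat bnd 3 = 2 * N.K + 2
  ins : ∀ c < N.K, σ.nat aIn c = 1 ↔ N.ins c
  vid : ∀ c < N.K, N.ins c → σ.nat aVid c = N.vid c
  hid : ∀ c < N.K, N.ins c → σ.nat aHid c = N.hid c

/-- The program does not change the bipartite graph. -/
def KeepsGraph (p : ForProg) : Prop := ∀ k ∈ [10, 17, 20, 21], k ∉ p.natWrites

theorem Frame.hasGraph {N : BipartiteGraph} {p : ForProg} {σ τ : State} (hf : Frame p σ τ)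
    (h : HasGraph N σ) (hp : p.KeepsGraph) : HasGraph N τ := by
  simp only [KeepsGraph, List.mem_cons, List.not_mem_nil, or_false, forall_eq_or_imp,
    forall_eq] at hp
  obtain ⟨n1, n2, n3, n4⟩ := hp
  have e1 := hf.nat bnd (by decide) n1
  exact ⟨by rw [e1]; exact h.bnd_two, by rw [e1]; exact h.bnd_three,
    by rw [hf.nat aIn (by decide) n2]; exact h.ins, by rw [hf.nat aVid (by decide) n3]; exact h.vid,
    by rw [hf.nat aHid (by decide) n4]; exact h.hid⟩

theorem flowOf_setNat_ctr (σ : State) (v x : ℕ) : flowOf (σ.setNat ctr v x) = flowOf σ := by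
  simp [flowOf, nat_setNat_of_ne]

/-- A loop over all cells is a sweep. -/
theorem flowOf_loop_two {N : BipartiteGraph} {p : ForProg} (hok : (loop 0 2 p).Ok)
    (hp : p.KeepsGraph) {f : ℕ → Preflow → Preflow}
    (h : ∀ τ, HasGraph N τ → τ.nat ctr 0 < N.K →
      flowOf (p.den τ) = f (τ.nat ctr 0) (flowOf τ))
    {σ : State} (hσ : HasGraph N σ) :
    flowOf ((loop 0 2 p).den σ) = BipartiteGraph.sweep f N.K (flowOf σ) := by
  have hh := loop_induction (v := 0) (b := 2) (σ := σ) (p := p) hok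
    (fun i τ => flowOf τ = BipartiteGraph.sweep f i (flowOf σ)) (flowOf_setNat_ctr _ _ _) ?_
  · rw [hσ.bnd_two] at hh; exact hh
  intro i τ hi hf hbd hc hI
  rw [hσ.bnd_two] at hi
  have hτ : HasGraph N τ := hf.hasGraph hσ hp
  rw [flowOf_setNat_ctr, h τ hτ (by omega), hc, hI]
  rfl

theorem flowOf_pushVCell {N : BipartiteGraph} {τ : State} (h : HasGraph N τ)
    (hc : τ.nat ctr 0 < N.K) : flowOf (pushVCell.den τ) = N.pushV (τ.nat ctr 0) (flowOf τ) := by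
  generalize hcc : τ.nat ctr 0 = c at *
  have h1 := h.ins c hc
  unfold BipartiteGraph.pushV pushVCell
  by_cases hin : N.ins c
  · have h2 := h.vid c hc hin
    have h3 := h.hid c hc hin
    by_cases hq : 0 < τ.real rE (N.vid c) ∧ τ.nat aDV (N.vid c) = τ.nat aDH (N.hid c) + 1
    · rw [if_pos ⟨hin, hq⟩]
      simp only [den]
      rw [if_pos (by simpa [hcc, h1, hin, h2, h3] using hq)]
      ext k <;> simp [flowOf, hcc, h2, h3, Function.update_apply]
    · rw [if_neg fun hh => hq hh.2]
      simp only [den]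
      rw [if_neg (by simpa [hcc, h1, hin, h2, h3] using hq)]
  · rw [if_neg fun hh => hin hh.1]
    simp only [den]
    rw [if_neg (by simp [hcc, h1, hin])]

theorem flowOf_pushHCell {N : BipartiteGraph} {τ : State} (h : HasGraph N τ)
    (hc : τ.nat ctr 0 < N.K) : flowOf (pushHCell.den τ) = N.pushH (τ.nat ctr 0) (flowOf τ) := by
  generalize hcc : τ.nat ctr 0 = c at *
  have h1 := h.ins c hc
  unfold BipartiteGraph.pushH pushHCell
  by_cases hin : N.ins c
  · have h2 := h.vid c hc hin
    have h3 := h.hid c hc hin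
    by_cases hq : 0 < τ.real rG (N.hid c) ∧ 0 < τ.real rF c ∧
        τ.nat aDH (N.hid c) = τ.nat aDV (N.vid c) + 1
    · rw [if_pos ⟨hin, hq⟩]
      simp only [den]
      rw [if_pos (by simpa [hcc, h1, hin, h2, h3] using hq)]
      by_cases hFG : τ.real rF c < τ.real rG (N.hid c)
      · rw [if_pos (by simpa [hcc, h3] using hFG),
          if_pos (show (flowOf τ).F c < (flowOf τ).G (N.hid c) from hFG)]
        ext k <;> simp [flowOf, hcc, h2, h3, Function.update_apply]
      · rw [if_neg (by simpa [hcc, h3] using hFG),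
          if_neg (show ¬ (flowOf τ).F c < (flowOf τ).G (N.hid c) from hFG)]
        ext k <;> simp [flowOf, hcc, h2, h3, Function.update_apply]
    · rw [if_neg fun hh => hq hh.2]
      simp only [den]
      rw [if_neg (by simpa [hcc, h1, hin, h2, h3] using hq)]
  · rw [if_neg fun hh => hin hh.1]
    simp only [den]
    rw [if_neg (by simp [hcc, h1, hin])]

theorem flowOf_liftV {N : BipartiteGraph} {τ : State} (h : HasGraph N τ) :
    flowOf ((liftNode rE aDV).den τ) =
      BipartiteGraph.liftV (2 * N.K + 2) (τ.nat ctr 0) (flowOf τ) := by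
  generalize hcc : τ.nat ctr 0 = c
  unfold BipartiteGraph.liftV liftNode
  by_cases hq : 0 < τ.real rE c ∧ τ.nat aDV c < 2 * N.K + 2
  · rw [if_pos (show 0 < (flowOf τ).E c ∧ (flowOf τ).DV c < 2 * N.K + 2 from hq)]
    simp only [den]
    rw [if_pos (by simpa [hcc, h.bnd_three] using hq)]
    ext k <;> simp [flowOf, hcc, Function.update_apply]
  · rw [if_neg (show ¬ (0 < (flowOf τ).E c ∧ (flowOf τ).DV c < 2 * N.K + 2) from hq)]
    simp only [den]
    rw [if_neg (by simpa [hcc, h.bnd_three] using hq)]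

theorem flowOf_liftH {N : BipartiteGraph} {τ : State} (h : HasGraph N τ) :
    flowOf ((liftNode rG aDH).den τ) =
      BipartiteGraph.liftH (2 * N.K + 2) (τ.nat ctr 0) (flowOf τ) := by
  generalize hcc : τ.nat ctr 0 = c
  unfold BipartiteGraph.liftH liftNode
  by_cases hq : 0 < τ.real rG c ∧ τ.nat aDH c < 2 * N.K + 2
  · rw [if_pos (show 0 < (flowOf τ).G c ∧ (flowOf τ).DH c < 2 * N.K + 2 from hq)]
    simp only [den]
    rw [if_pos (by simpa [hcc, h.bnd_three] using hq)]
    ext k <;> simp [flowOf, hcc, Function.update_apply]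
  · rw [if_neg (show ¬ (0 < (flowOf τ).G c ∧ (flowOf τ).DH c < 2 * N.K + 2) from hq)]
    simp only [den]
    rw [if_neg (by simpa [hcc, h.bnd_three] using hq)]

theorem flowOf_round {N : BipartiteGraph} {σ : State} (h : HasGraph N σ) :
    flowOf (pushRelabelRound.den σ) = N.round (2 * N.K + 2) (flowOf σ) := by
  have k1 : (loop 0 2 pushVCell).Ok ∧ (loop 0 2 pushVCell).KeepsGraph := by
    simp [pushVCell, KeepsGraph]
  have k2 : (loop 0 2 (liftNode rE aDV)).Ok ∧ (loop 0 2 (liftNode rE aDV)).KeepsGraph := by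
    simp [liftNode, KeepsGraph]
  have k3 : (loop 0 2 pushHCell).Ok ∧ (loop 0 2 pushHCell).KeepsGraph := by
    simp [pushHCell, KeepsGraph]
  have k4 : (loop 0 2 (liftNode rG aDH)).Ok ∧ (loop 0 2 (liftNode rG aDH)).KeepsGraph := by
    simp [liftNode, KeepsGraph]
  have h1 := (den_frame _ k1.1 σ).hasGraph h k1.2
  have h2 := (den_frame _ k2.1 _).hasGraph h1 k2.2
  have h3 := (den_frame _ k3.1 _).hasGraph h2 k3.2
  change flowOf ((loop 0 2 (liftNode rG aDH)).den ((loop 0 2 pushHCell).den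
    ((loop 0 2 (liftNode rE aDV)).den ((loop 0 2 pushVCell).den σ)))) = _
  rw [flowOf_loop_two k4.1 k4.2 (fun τ hτ _ => flowOf_liftH hτ) h3,
    flowOf_loop_two k3.1 k3.2 (fun τ hτ hc => flowOf_pushHCell hτ hc) h2,
    flowOf_loop_two k2.1 k2.2 (fun τ hτ _ => flowOf_liftV hτ) h1,
    flowOf_loop_two k1.1 k1.2 (fun τ hτ hc => flowOf_pushVCell hτ hc) h]
  rfl

/-- A loop whose body does not use its counter is an iteration. -/
theorem flowOf_loop_three {N : BipartiteGraph} {p : ForProg} {v : ℕ} (hok : (loop v 3 p).Ok)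
    (hp : p.KeepsGraph) {f : Preflow → Preflow}
    (h : ∀ τ, HasGraph N τ → flowOf (p.den τ) = f (flowOf τ)) {σ : State} (hσ : HasGraph N σ) :
    flowOf ((loop v 3 p).den σ) = f^[2 * N.K + 2] (flowOf σ) := by
  have hh := loop_induction (v := v) (b := 3) (σ := σ) (p := p) hok
    (fun i τ => flowOf τ = f^[i] (flowOf σ)) (flowOf_setNat_ctr _ _ _) ?_
  · rw [hσ.bnd_three] at hh; exact hh
  intro i τ hi hf hbd hc hI
  rw [flowOf_setNat_ctr, h τ (hf.hasGraph hσ hp), hI, Function.iterate_succ_apply']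

theorem flowOf_pushRelabel {N : BipartiteGraph} {σ : State} (h : HasGraph N σ) :
    flowOf (pushRelabel.den σ) = (N.round (2 * N.K + 2))^[(2 * N.K + 2) ^ 4] (flowOf σ) := by
  have ok : pushRelabel.Ok := by
    simp [pushRelabel, pushRelabelRound, pushVCell, pushHCell, liftNode]
  have kp : pushRelabelRound.KeepsGraph := by
    simp [KeepsGraph, pushRelabelRound, pushVCell, pushHCell, liftNode]
  have h1 := flowOf_loop_three (v := 1) ok kp (fun τ hτ =>
    flowOf_loop_three (v := 2) ok.2 kp (fun τ hτ =>
      flowOf_loop_three (v := 3) ok.2.2 kp (fun τ hτ =>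
        flowOf_loop_three (v := 4) ok.2.2.2 kp (fun τ hτ => flowOf_round hτ) hτ) hτ) hτ) h
  refine h1.trans ?_
  rw [← Function.iterate_mul, ← Function.iterate_mul, ← Function.iterate_mul]
  exact congrArg (fun m => (N.round (2 * N.K + 2))^[m] (flowOf σ)) (by ring)

/-! ### Correctness of the output -/

theorem occurring_spec {σ : State} (h0 : σ.nat aOcc = 0) (g : ℕ) :
    (occurring.den σ).nat aOcc g = 0 ↔
      ∀ u < σ.nat bnd 2, σ.nat aDV u ≠ g ∧ σ.nat aDH u ≠ g := by
  refine loop_induction (v := 0) (b := 2) (σ := σ)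
    (p := seq (setNat aOcc (.get aDV (cnt 0)) (.lit 1)) (setNat aOcc (.get aDH (cnt 0)) (.lit 1)))
    (by simp)
    (fun i τ => τ.nat aOcc g = 0 ↔ ∀ u < i, σ.nat aDV u ≠ g ∧ σ.nat aDH u ≠ g) (by simp [h0]) ?_
  intro i τ hi hf hbd hc hI
  have e1 : τ.nat aDV = σ.nat aDV := hf.nat _ (by decide) (by simp)
  have e2 : τ.nat aDH = σ.nat aDH := hf.nat _ (by decide) (by simp)
  rw [Nat.forall_lt_succ_right, ← hI]
  by_cases q1 : σ.nat aDV i = g <;> by_cases q2 : σ.nat aDH i = g <;>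
    simp [hc, e1, e2, q1, q2, eq_comm (a := g)]

theorem findGap_spec {σ : State}
    (h : ∃ g, 1 ≤ g ∧ g ≤ σ.nat bnd 3 ∧ σ.nat aOcc g = 0) :
    1 ≤ (findGap.den σ).nat aGap 0 ∧ (findGap.den σ).nat aGap 0 ≤ σ.nat bnd 3 ∧
      σ.nat aOcc ((findGap.den σ).nat aGap 0) = 0 := by
  have hh := loop_induction (v := 0) (b := 3) (σ := σ)
    (p := branch (.natEq (.get aOcc (.add (cnt 0) (.lit 1))) (.lit 0))
      (setNat aGap (.lit 0) (.add (cnt 0) (.lit 1))) skip) (by simp)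
    (fun i τ => (∃ g, 1 ≤ g ∧ g ≤ i ∧ σ.nat aOcc g = 0) → 1 ≤ τ.nat aGap 0 ∧
      τ.nat aGap 0 ≤ i ∧ σ.nat aOcc (τ.nat aGap 0) = 0) ?_ ?_
  · exact hh h
  · rintro ⟨g, h1, h2, -⟩; omega
  · rintro i τ hi hf hbd hc hI ⟨g, h1, h2, h3⟩
    have e1 : τ.nat aOcc = σ.nat aOcc := hf.nat _ (by decide) (by simp)
    simp only [den, Test.Holds, NatExpr.eval, cnt, hc, e1]
    split_ifs with hq
    · simp [hq]
    · obtain ⟨h4, h5, h6⟩ := hI ⟨g, h1, by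
        rcases Nat.lt_succ_iff_lt_or_eq.1 (Nat.lt_succ_of_le h2) with h | rfl
        exacts [by omega, absurd h3 hq], h3⟩
      exact ⟨h4, Nat.le_succ_of_le h5, h6⟩

/-- A segment is appended, provided that the expressions for its coordinates read no array that is
written to before they are evaluated. -/
theorem outputSegs_emit (x y z w : RealExpr) (σ : State)
    (h : ∀ τ : State, τ.nat = σ.nat → (∀ k, k ∉ [2, 3, 4, 5] → τ.real k = σ.real k) →
      x.eval τ = x.eval σ ∧ y.eval τ = y.eval σ ∧ z.eval τ = z.eval σ ∧ w.eval τ = w.eval σ) :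
    outputSegs ((emit x y z w).den σ) =
      outputSegs σ ++ [((x.eval σ, y.eval σ), (z.eval σ, w.eval σ))] := by
  set m := σ.nat 2 0 with hm
  set σ₁ := σ.setReal 2 m (x.eval σ) with h₁
  set σ₂ := σ₁.setReal 3 m (y.eval σ) with h₂
  set σ₃ := σ₂.setReal 4 m (z.eval σ) with h₃
  set σ₄ := σ₃.setReal 5 m (w.eval σ) with h₄
  have e1 : y.eval σ₁ = y.eval σ := (h σ₁ rfl fun k hk => by
    simp at hk; simp [h₁, real_setReal_of_ne, hk]).2.1
  have e2 : z.eval σ₂ = z.eval σ := (h σ₂ rfl fun k hk => by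
    simp at hk; simp [h₁, h₂, real_setReal_of_ne, hk]).2.2.1
  have e3 : w.eval σ₃ = w.eval σ := (h σ₃ rfl fun k hk => by
    simp at hk; simp [h₁, h₂, h₃, real_setReal_of_ne, hk]).2.2.2
  have e : (emit x y z w).den σ = σ₄.setNat 2 0 (m + 1) := by
    have n1 : σ₁.nat = σ.nat := rfl
    have n2 : σ₂.nat = σ.nat := rfl
    have n3 : σ₃.nat = σ.nat := rfl
    have n4 : σ₄.nat = σ.nat := rfl
    simp only [emit, den, NatExpr.eval]
    rw [← hm, ← h₁, n1, ← hm, e1, ← h₂, n2, ← hm, e2, ← h₃, n3, ← hm, e3, ← h₄, n4, ← hm]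
  rw [e]
  unfold outputSegs
  rw [nat_setNat, if_pos ⟨rfl, rfl⟩, List.range_succ, List.map_append, ← hm]
  congr 1
  · refine List.map_congr_left fun i hi => ?_
    have : i ≠ m := (List.mem_range.1 hi).ne
    simp [h₁, h₂, h₃, h₄, this]
  · simp [h₁, h₂, h₃, h₄]

/-- The data of the polygon, the graph and the selected runs in a memory. -/
structure HasSelection (P : Set Point) (N : ℕ) (X Y : ℕ → ℝ) (C D : ℕ → Prop) (σ : State) :
    Prop where
  bnd_two : σ.nat bnd 2 = N * N
  X_eq : σ.real rX = X
  Y_eq : σ.real rY = Y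
  col : ∀ c < N * N, σ.nat aCol c = c / N
  row : ∀ c < N * N, σ.nat aRow c = c % N
  cells : HasCells P N X Y σ
  runs : HasRuns P N X Y (N * N) σ
  selV : ∀ c < N * N, C c ↔ σ.nat aDV c < σ.nat aGap 0
  selH : ∀ c < N * N, D c ↔ σ.nat aGap 0 < σ.nat aDH c

theorem HasSelection.congr {P : Set Point} {N : ℕ} {X Y : ℕ → ℝ} {C D : ℕ → Prop} {σ τ : State}
    (h : HasSelection P N X Y C D σ) (hn : ∀ k ∉ [2, 11], τ.nat k = σ.nat k)
    (hr : ∀ k ∉ [2, 3, 4, 5], τ.real k = σ.real k) : HasSelection P N X Y C D τ := by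
  have n : ∀ k, k ≠ 2 → k ≠ 11 → τ.nat k = σ.nat k := fun k h1 h2 => hn k (by simp [h1, h2])
  refine ⟨?_, ?_, ?_, ?_, ?_, ?_, ?_, ?_, ?_⟩
  · rw [n bnd (by decide) (by decide)]; exact h.bnd_two
  · rw [hr rX (by decide)]; exact h.X_eq
  · rw [hr rY (by decide)]; exact h.Y_eq
  · rw [n aCol (by decide) (by decide)]; exact h.col
  · rw [n aRow (by decide) (by decide)]; exact h.row
  · unfold HasCells; rw [n aIn (by decide) (by decide)]; exact h.cells
  · unfold HasRuns; rw [n aVid (by decide) (by decide), n aHid (by decide) (by decide)]; exact h.runs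
  · rw [n aDV (by decide) (by decide), n aGap (by decide) (by decide)]; exact h.selV
  · rw [n aDH (by decide) (by decide), n aGap (by decide) (by decide)]; exact h.selH

theorem outputV_frame (σ : State) : (∀ k ∉ [2, 11], (outputV.den σ).nat k = σ.nat k) ∧
    (∀ k ∉ [2, 3, 4, 5], (outputV.den σ).real k = σ.real k) ∧
    (outputV.den σ).nat ctr = σ.nat ctr := by
  have hf := den_frame outputV (by simp [outputV, emit]) σ
  refine ⟨fun k hk => ?_, fun k hk => ?_, funext fun v => hf.counter v (by simp [outputV, emit])⟩
  · simp only [List.mem_cons, List.not_mem_nil, or_false, not_or] at hk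
    exact hf.nat k hk.2 (by simpa [outputV, emit] using hk.1)
  · exact hf.real k (by simpa [outputV, emit] using hk)

open Classical in
theorem outputV_spec {P : Set Point} {N : ℕ} {X Y : ℕ → ℝ} {C D : ℕ → Prop} {σ : State}
    (h : HasSelection P N X Y C D σ) {c : ℕ} (hc : σ.nat ctr 0 = c) (hcN : c < N * N) :
    outputSegs (outputV.den σ) = outputSegs σ ++
      if cellIn P N X Y c ∧ cellV P N X Y c = c ∧ C c then [camV N X Y c] else [] := by
  have hcond : (Test.and (.natEq (.get aIn (cnt 0)) (.lit 1))
      (.and (.natEq (.get aVid (cnt 0)) (cnt 0))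
      (.natLt (.get aDV (cnt 0)) (.get aGap (.lit 0))))).Holds σ ↔
      cellIn P N X Y c ∧ cellV P N X Y c = c ∧ C c := by
    simp [hc, h.cells c hcN, (h.runs c hcN).1, h.selV c hcN]
  unfold outputV
  simp only [den]
  by_cases q : cellIn P N X Y c ∧ cellV P N X Y c = c ∧ C c
  · rw [if_pos (hcond.2 q), if_pos q, outputSegs_emit _ _ _ _ _ fun τ h1 h2 => by
      simp [h1, h2 6, h2 7]]
    simp [hc, h.col c hcN, h.row c hcN, h.X_eq, h.Y_eq, camV]
  · rw [if_neg (mt hcond.1 q), if_neg q, List.append_nil]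

open Classical in
theorem outputH_spec {P : Set Point} {N : ℕ} {X Y : ℕ → ℝ} {C D : ℕ → Prop} {σ : State}
    (h : HasSelection P N X Y C D σ) {c : ℕ} (hc : σ.nat ctr 0 = c) (hcN : c < N * N) :
    outputSegs (outputH.den σ) = outputSegs σ ++
      if cellIn P N X Y c ∧ cellH P N X Y c = c ∧ D c then [camH N X Y c] else [] := by
  have hcond : (Test.and (.natEq (.get aIn (cnt 0)) (.lit 1))
      (.and (.natEq (.get aHid (cnt 0)) (cnt 0))
      (.natLt (.get aGap (.lit 0)) (.get aDH (cnt 0))))).Holds σ ↔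
      cellIn P N X Y c ∧ cellH P N X Y c = c ∧ D c := by
    simp [hc, h.cells c hcN, (h.runs c hcN).2, h.selH c hcN]
  unfold outputH
  simp only [den]
  by_cases q : cellIn P N X Y c ∧ cellH P N X Y c = c ∧ D c
  · rw [if_pos (hcond.2 q), if_pos q, outputSegs_emit _ _ _ _ _ fun τ h1 h2 => by
      simp [h1, h2 6, h2 7]]
    simp [hc, h.col c hcN, h.row c hcN, h.X_eq, h.Y_eq, camH]
  · rw [if_neg (mt hcond.1 q), if_neg q, List.append_nil]

open Classical in
/-- The cameras that are output for the cell `c`. -/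
noncomputable def cellCameras (P : Set Point) (N : ℕ) (X Y : ℕ → ℝ) (C D : ℕ → Prop) (c : ℕ) :
    List Seg :=
  (if cellIn P N X Y c ∧ cellV P N X Y c = c ∧ C c then [camV N X Y c] else []) ++
    if cellIn P N X Y c ∧ cellH P N X Y c = c ∧ D c then [camH N X Y c] else []

theorem mem_cellCameras {P : Set Point} {N : ℕ} {X Y : ℕ → ℝ} {C D : ℕ → Prop} {c : ℕ} {s : Seg} :
    s ∈ cellCameras P N X Y C D c ↔
      (cellIn P N X Y c ∧ cellV P N X Y c = c ∧ C c ∧ s = camV N X Y c) ∨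
      (cellIn P N X Y c ∧ cellH P N X Y c = c ∧ D c ∧ s = camH N X Y c) := by
  unfold cellCameras
  rw [List.mem_append]
  refine or_congr ?_ ?_
  · split_ifs with h
    · simp [h]
    · simp only [List.not_mem_nil, false_iff]; tauto
  · split_ifs with h
    · simp [h]
    · simp only [List.not_mem_nil, false_iff]; tauto

theorem output_spec {P : Set Point} {N : ℕ} {X Y : ℕ → ℝ} {C D : ℕ → Prop} {σ : State}
    (h : HasSelection P N X Y C D σ) (h0 : σ.nat 2 0 = 0) :
    outputSegs (output.den σ) = (List.range (N * N)).flatMap (cellCameras P N X Y C D) := by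
  have hh := loop_induction (v := 0) (b := 2) (σ := σ) (p := seq outputV outputH)
    (by simp [outputV, outputH, emit])
    (fun i τ => outputSegs τ = (List.range i).flatMap (cellCameras P N X Y C D))
    (by simp [outputSegs, h0]) ?_
  · rw [h.bnd_two] at hh; exact hh
  intro i τ hi hf hbd hc hI
  rw [h.bnd_two] at hi
  have hτ : HasSelection P N X Y C D τ := by
    refine h.congr (fun k hk => ?_) fun k hk => ?_
    · simp only [List.mem_cons, List.not_mem_nil, or_false, not_or] at hk
      exact hf.nat k hk.2 (by simpa [outputV, outputH, emit] using hk.1)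
    · exact hf.real k (by
        simp only [List.mem_cons, List.not_mem_nil, or_false, not_or] at hk
        simp [outputV, outputH, emit, hk])
  obtain ⟨f1, f2, f3⟩ := outputV_frame τ
  have hρ := hτ.congr f1 f2
  have e : ∀ (τ : State) x, outputSegs (τ.setNat ctr 0 x) = outputSegs τ := by
    intro τ x; simp [outputSegs]
  rw [e, den.eq_4, outputH_spec hρ (by rw [f3]; exact hc) hi, outputV_spec hτ hc hi, hI,
    List.range_succ, List.flatMap_append]
  simp [cellCameras]

/-- The output lists the cameras of the selected runs without repetition, because a camera determines
the cell in which it starts. -/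
theorem cameras_spec {P : Set Point} {N : ℕ} {X Y : ℕ → ℝ} (C D : ℕ → Prop)
    (h : IsGrid P N X Y) :
    ((List.range (N * N)).flatMap (cellCameras P N X Y C D)).Nodup ∧
    IsCameraSet P N X Y C D ((List.range (N * N)).flatMap (cellCameras P N X Y C D)).toFinset := by
  have inj : ∀ {i k}, i < N → k < N → X i < X (i + 1) → X k < X (k + 1) → X i = X k → i = k := by
    intro i k hi hk h1 h2 he
    rcases lt_trichotomy i k with h3 | h3 | h3
    · have := h.X_mono (i := i + 1) h3 hk.le; linarith
    · exact h3
    · have := h.X_mono (i := k + 1) h3 hi.le; linarith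
  have injY : ∀ {i k}, i < N → k < N → Y i < Y (i + 1) → Y k < Y (k + 1) → Y i = Y k → i = k := by
    intro i k hi hk h1 h2 he
    rcases lt_trichotomy i k with h3 | h3 | h3
    · have := h.swap.X_mono (i := i + 1) h3 hk.le; linarith
    · exact h3
    · have := h.swap.X_mono (i := k + 1) h3 hi.le; linarith
  have start : ∀ {c s}, s ∈ cellCameras P N X Y C D c → cellIn P N X Y c ∧
      s.1 = (X (c / N), Y (c % N)) := by
    intro c s hs
    rcases mem_cellCameras.1 hs with ⟨h1, -, -, rfl⟩ | ⟨h1, -, -, rfl⟩ <;> exact ⟨h1, rfl⟩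
  constructor
  · rw [List.nodup_flatMap]
    constructor
    · intro c _
      unfold cellCameras
      split_ifs with h1 h2
      · simp only [List.cons_append, List.nil_append, List.nodup_cons, List.mem_singleton,
          List.not_mem_nil, not_false_eq_true, List.nodup_nil, and_self, and_true]
        intro he
        have h3 := congrArg (fun s : Seg => s.2.2) he
        simp only [camV, camH] at h3
        exact absurd h3 h1.1.2.1.ne
      all_goals simp
    · refine List.Pairwise.imp_of_mem ?_ List.nodup_range
      intro a b ha hb hab
      rw [List.mem_range] at ha hb
      refine List.disjoint_left.2 fun s h1 h2 => hab ?_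
      obtain ⟨i1, e1⟩ := start h1
      obtain ⟨i2, e2⟩ := start h2
      rw [e1, Prod.mk.injEq] at e2
      have d := inj (div_lt_of_lt_mul_self ha) (div_lt_of_lt_mul_self hb) i1.1 i2.1 e2.1
      have m := injY (mod_lt_of_lt_mul_self ha) (mod_lt_of_lt_mul_self hb) i1.2.1 i2.2.1 e2.2
      rw [← Nat.div_add_mod a N, ← Nat.div_add_mod b N, d, m]
  · intro s
    simp only [List.mem_toFinset, List.mem_flatMap, List.mem_range, mem_cellCameras]
    constructor
    · rintro ⟨c, hc, h1 | h1⟩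
      exacts [Or.inl ⟨c, hc, h1⟩, Or.inr ⟨c, hc, h1⟩]
    · rintro (⟨c, hc, h1⟩ | ⟨c, hc, h1⟩)
      exacts [⟨c, hc, Or.inl h1⟩, ⟨c, hc, Or.inr h1⟩]

end ForProg

/-! ### The complete algorithm -/

namespace ForProg

/-- Compute the successors of the vertices, the sorted coordinates and the number of cells. -/
def prepare : ForProg := seq successors (seq (sort 0 rX) (seq (sort 1 rY) square))

/-- Find an optimal cover on the prepared grid. -/
def solve : ForProg :=
  seq coordinates (seq inside (seq runs (seq pushRelabel (seq occurring (seq findGap output)))))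

theorem prepare_ok : prepare.Ok := by
  simp [prepare, successors, sort, findMin, findNext, square]

theorem solve_ok : solve.Ok := by
  simp [solve, coordinates, inside, findEdge, decideCell, runs, setVid, setHid, setWeightV,
    setWeightH, pushRelabel, pushRelabelRound, pushVCell, pushHCell, liftNode, occurring, findGap,
    output, outputV, outputH, emit]

theorem prepare_spec {B : List (List Point)} {σ : State} (hB : ∀ c ∈ B, 4 ≤ c.length)
    (hb : σ.nat bnd 0 = B.length) (hb' : σ.nat bnd 1 = numVertices B)
    (ho : ∀ i ≤ B.length, σ.nat aOffset i = offset B i) (h0 : σ.nat aSize 0 = 0) :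
    IsNext B ((prepare.den σ).nat aNext) ∧
    IsSorting (numVertices B) (σ.real 0) ((prepare.den σ).real rX) ∧
    IsSorting (numVertices B) (σ.real 1) ((prepare.den σ).real rY) ∧
    (prepare.den σ).nat aSize 0 = numVertices B * numVertices B := by
  have h1 := successors_spec hB hb hb' ho
  have f1 := den_frame successors (by simp [successors]) σ
  simp only [prepare, den]
  generalize successors.den σ = ρ₁ at *
  have h2 := sort_spec (src := 0) (dst := rX) (by decide) ρ₁
  have f2 := den_frame (sort 0 rX) (by simp [sort, findMin, findNext]) ρ₁
  generalize (sort 0 rX).den ρ₁ = ρ₂ at *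
  have h3 := sort_spec (src := 1) (dst := rY) (by decide) ρ₂
  have f3 := den_frame (sort 1 rY) (by simp [sort, findMin, findNext]) ρ₂
  generalize (sort 1 rY).den ρ₂ = ρ₃ at *
  have b1 : ρ₁.nat bnd = σ.nat bnd := f1.nat _ (by decide) (by simp [successors])
  have b2 : ρ₂.nat bnd = σ.nat bnd :=
    (f2.nat _ (by decide) (by simp [sort, findMin, findNext])).trans b1
  have b3 : ρ₃.nat bnd = σ.nat bnd :=
    (f3.nat _ (by decide) (by simp [sort, findMin, findNext])).trans b2
  have h4 := square_spec (σ := ρ₃) (by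
    rw [f3.nat _ (by decide) (by simp [sort, findMin, findNext]),
      f2.nat _ (by decide) (by simp [sort, findMin, findNext]),
      f1.nat _ (by decide) (by simp [successors]), h0])
  have f4 := den_frame square (by simp [square]) ρ₃
  rw [b3, hb'] at h4
  rw [b2, hb', f2.real 1 (by simp [sort, findMin, findNext]),
    f1.real 1 (by simp [successors])] at h3
  rw [b1, hb', f1.real 0 (by simp [successors])] at h2
  refine ⟨?_, ?_, ?_, h4⟩
  · rw [f4.nat _ (by decide) (by simp [square]),
      f3.nat _ (by decide) (by simp [sort, findMin, findNext]),
      f2.nat _ (by decide) (by simp [sort, findMin, findNext])]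
    exact h1
  · rw [f4.real _ (by simp [square]), f3.real _ (by simp [sort, findMin, findNext])]
    exact h2
  · rw [f4.real _ (by simp [square])]
    exact h3

theorem gridGraph_wV_nonneg (P : Set Point) (N : ℕ) (X Y : ℕ → ℝ) (u : ℕ) :
    0 ≤ (gridGraph P N X Y).wV u := by
  simp only [gridGraph]
  split_ifs with h
  · exact sub_nonneg.2 h.2.1.1.le
  · exact le_rfl

/-- The labels computed by the push-relabel method have a gap, and the runs on the two sides of the gap
are a vertex cover of minimum weight. -/
theorem solve_spec {P : Set Point} (hP : IsCompact P) (hcl : closure (interior P) = P) {N : ℕ}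
    {σ : State} (hb1 : σ.nat bnd 1 = N) (hb2 : σ.nat bnd 2 = N * N)
    (hb3 : σ.nat bnd 3 = 2 * (N * N) + 2)
    (hbd : IsBoundary P N (σ.real 0) (σ.real 1) (σ.nat aNext))
    (hX : IsSorting N (σ.real 0) (σ.real rX)) (hY : IsSorting N (σ.real 1) (σ.real rY))
    (hn : ∀ k ∈ [2, 15, 16, 22, 23, 24], σ.nat k = 0) (hr : ∀ k ∈ [8, 9, 10], σ.real k = 0) :
    (outputSegs (solve.den σ)).Nodup ∧ IsOptimalCover P (outputSegs (solve.den σ)).toFinset := by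
  generalize eX : σ.real rX = X at hX
  generalize eY : σ.real rY = Y at hY
  have hgrid : IsGrid P N X Y := hbd.isGrid hX hY hP hcl
  have ok := solve_ok
  simp only [List.mem_cons, List.not_mem_nil, or_false, forall_eq_or_imp, forall_eq] at hn hr
  obtain ⟨n2, n15, n16, n22, n23, n24⟩ := hn
  obtain ⟨r8, r9, r10⟩ := hr
  simp only [solve, Ok] at ok
  obtain ⟨ok1, ok2, ok3, ok4, ok5, ok6, ok7⟩ := ok
  simp only [solve, den]
  -- the grid
  have g1 := coordinates_spec hb1 hb2 (by rw [n15]; rfl) (by rw [n16]; rfl)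
  have f1 := den_frame coordinates ok1 σ
  generalize coordinates.den σ = ρ₁ at *
  have w1 : coordinates.realWrites = [] := by simp [coordinates]
  have hg1 : HasGrid P N X Y ρ₁ := by
    have e : ρ₁.real = σ.real := funext fun k => f1.real k (by simp [w1])
    have e' : ρ₁.nat bnd = σ.nat bnd := f1.nat _ (by decide) (by simp [coordinates])
    have e'' : ρ₁.nat aNext = σ.nat aNext := f1.nat _ (by decide) (by simp [coordinates])
    exact ⟨by rw [e', hb1], by rw [e', hb2], by rw [e, eX], by rw [e, eY],
      by rw [e, e'']; exact hbd, by rw [e]; exact hX, by rw [e]; exact hY, fun c hc => (g1 c hc).1,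
      fun c hc => (g1 c hc).2⟩
  -- the cells
  have c2 := inside_spec hP hcl hg1
  have f2 := den_frame inside ok2 ρ₁
  have hg2 : HasGrid P N X Y (inside.den ρ₁) :=
    f2.hasGrid hg1 (by simp [inside, findEdge, decideCell]) (by simp [inside, findEdge, decideCell])
  have hc2 : HasCells P N X Y (inside.den ρ₁) := by
    intro c hc
    rw [c2 c hc]
    split_ifs with h <;> simp [h]
  clear c2
  generalize inside.den ρ₁ = ρ₂ at *
  -- the runs
  have w2 : inside.realWrites = [] := by simp [inside, findEdge, decideCell]
  have R2 : ρ₂.real = σ.real :=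
    funext fun k => (f2.real k (by simp [w2])).trans (f1.real k (by simp [w1]))
  obtain ⟨hr3, hE3, hG3⟩ := runs_spec hg2 hc2 (by rw [R2, r8]) (by rw [R2, r9])
  have f3 := den_frame runs ok3 ρ₂
  have hg3 : HasGrid P N X Y (runs.den ρ₂) :=
    f3.hasGrid hg2 (by simp [runs, setVid, setHid, setWeightV, setWeightH])
      (by simp [runs, setVid, setHid, setWeightV, setWeightH])
  have hc3 : HasCells P N X Y (runs.den ρ₂) := by
    unfold HasCells
    rw [f3.nat aIn (by decide) (by simp [runs, setVid, setHid, setWeightV, setWeightH])]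
    exact hc2
  have N3 : ∀ k, k ∉ [11, 15, 16, 17, 18, 19, 20, 21] → (runs.den ρ₂).nat k = σ.nat k := by
    intro k hk
    simp only [List.mem_cons, List.not_mem_nil, or_false, not_or] at hk
    rw [f3.nat k hk.1 (by simp [runs, setVid, setHid, setWeightV, setWeightH, hk]),
      f2.nat k hk.1 (by simp [inside, findEdge, decideCell, hk]),
      f1.nat k hk.1 (by simp [coordinates, hk])]
  have F3 : (runs.den ρ₂).real rF = 0 := by
    rw [f3.real _ (by simp [runs, setVid, setHid, setWeightV, setWeightH]), R2, r10]
  generalize runs.den ρ₂ = ρ₃ at *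
  -- the flow
  have hG : HasGraph (gridGraph P N X Y) ρ₃ :=
    ⟨hg3.bnd_two, by rw [N3 _ (by decide)]; exact hb3, hc3, fun c hc _ => (hr3 c hc).1,
      fun c hc _ => (hr3 c hc).2⟩
  have hinit : (gridGraph P N X Y).initial (flowOf ρ₃) :=
    ⟨hE3, hG3, F3, (N3 _ (by decide)).trans n22, (N3 _ (by decide)).trans n23⟩
  have hfl := flowOf_pushRelabel hG
  obtain ⟨hI, hD⟩ := BipartiteGraph.iterate_round_spec
    (BipartiteGraph.Inv.of_initial (cap := 2 * (gridGraph P N X Y).K + 2) hinit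
      (gridGraph_wV_nonneg P N X Y)) (BipartiteGraph.potential_initial hinit)
  rw [← hfl] at hI hD
  have f4 := den_frame pushRelabel ok4 ρ₃
  have w4 : ∀ k ∈ pushRelabel.natWrites, k = 22 ∨ k = 23 := by
    simp [pushRelabel, pushRelabelRound, pushVCell, pushHCell, liftNode]
  have x4 : ∀ k ∈ pushRelabel.realWrites, k = 8 ∨ k = 9 ∨ k = 10 := by
    simp [pushRelabel, pushRelabelRound, pushVCell, pushHCell, liftNode]
  have hg4 : HasGrid P N X Y (pushRelabel.den ρ₃) := f4.hasGrid hg3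
    (fun k hk hw => by rcases w4 k hw with rfl | rfl <;> simp at hk)
    (fun k hk hw => by rcases x4 k hw with rfl | rfl | rfl <;> simp at hk)
  have N4 : ∀ k, k ∉ [11, 22, 23] → (pushRelabel.den ρ₃).nat k = ρ₃.nat k := by
    intro k hk
    simp only [List.mem_cons, List.not_mem_nil, or_false, not_or] at hk
    exact f4.nat k hk.1 fun hw => by rcases w4 k hw with rfl | rfl <;> simp at hk
  clear hfl
  generalize pushRelabel.den ρ₃ = ρ₄ at *
  -- the gap
  have o5 := occurring_spec (σ := ρ₄) (by rw [N4 _ (by decide), N3 _ (by decide), n24])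
  have f5 := den_frame occurring ok5 ρ₄
  generalize occurring.den ρ₄ = ρ₅ at *
  have b5 : ρ₅.nat bnd 3 = 2 * (gridGraph P N X Y).K + 2 := by
    rw [f5.nat _ (by decide) (by simp [occurring]), N4 _ (by decide)]; exact hG.bnd_three
  obtain ⟨gap1, gap2, gap3⟩ := findGap_spec (σ := ρ₅) (by
    obtain ⟨g, h1, h2, h3, h4⟩ := (gridGraph P N X Y).exists_gap (flowOf ρ₄)
    refine ⟨g, h1, by rw [b5]; exact h2, (o5 g).2 fun u hu => ?_⟩
    rw [hg4.bnd_two] at hu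
    exact ⟨h3 u hu, h4 u hu⟩)
  have f6 := den_frame findGap ok6 ρ₅
  generalize findGap.den ρ₅ = ρ₆ at *
  have N6 : ∀ k, k ∉ [11, 24, 25] → ρ₆.nat k = ρ₄.nat k := by
    intro k hk
    simp only [List.mem_cons, List.not_mem_nil, or_false, not_or] at hk
    rw [f6.nat k hk.1 (by simp [findGap, hk]), f5.nat k hk.1 (by simp [occurring, hk])]
  have R6 : ρ₆.real = ρ₄.real := funext fun k =>
    (f6.real k (by simp [findGap])).trans (f5.real k (by simp [occurring]))
  rw [b5] at gap2
  have gap4 := (o5 _).1 gap3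
  rw [hg4.bnd_two] at gap4
  set g := ρ₆.nat aGap 0 with hgdef
  -- the output
  set C : ℕ → Prop := fun u => (flowOf ρ₄).DV u < g with hC
  set D : ℕ → Prop := fun u => g < (flowOf ρ₄).DH u with hD'
  have hsel : HasSelection P N X Y C D ρ₆ := by
    have hg6 : HasGrid P N X Y ρ₆ := hg4.congr
      (fun k hk => N6 k (by rintro h; simp at h hk; omega)) fun k _ => by rw [R6]
    refine ⟨hg6.bnd_two, hg6.X_eq, hg6.Y_eq, hg6.col, hg6.row, ?_, ?_, fun c _ => ?_, fun c _ => ?_⟩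
    · unfold HasCells
      rw [N6 _ (by decide), N4 _ (by decide)]; exact hc3
    · unfold HasRuns
      rw [N6 _ (by decide), N6 _ (by decide), N4 _ (by decide), N4 _ (by decide)]; exact hr3
    · rw [N6 aDV (by decide)]; rfl
    · rw [N6 aDH (by decide)]; rfl
  rw [output_spec hsel (by
    rw [N6 _ (by decide), N4 _ (by decide), N3 _ (by decide), n2]; rfl)]
  obtain ⟨nd, hT⟩ := cameras_spec C D hgrid
  exact ⟨nd, hgrid.isOptimalCover
    (BipartiteGraph.isVertexCover_of_gap hI (fun u hu => (gap4 u hu).1) fun u hu => (gap4 u hu).2)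
    (fun A B hAB => BipartiteGraph.weight_gap_le hI hD gap1 gap2 (fun u hu => (gap4 u hu).1)
      (fun u hu => (gap4 u hu).2) (fun _ => Iff.rfl) (fun _ => Iff.rfl) hAB) hT⟩

/-- Polynomial bounds, in the number of vertices, on the loop bounds. -/
noncomputable def loopBound (b : ℕ) : Polynomial ℕ :=
  if b = 0 then .X else if b = 1 then .X else if b = 2 then .X ^ 2 else if b = 3 then
    2 * .X ^ 2 + 2 else 0

/-- The algorithm. The loop bounds are set between the for-programs. -/
def algorithm : Prog :=
  .seq (.setNat bnd (.lit 0) (.get 0 (.lit 0)))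
    (.seq offsets.toProg
      (.seq (.setNat bnd (.lit 1) (.get aOffset (.get 0 (.lit 0))))
        (.seq prepare.toProg
          (.seq (.setNat bnd (.lit 2) (.get aSize (.lit 0)))
            (.seq (.setNat bnd (.lit 3)
                (.add (.add (.get bnd (.lit 2)) (.get bnd (.lit 2))) (.lit 2)))
              solve.toProg)))))

/-- The time bound of the algorithm. The four assignments to loop bounds take 22 units of time. -/
noncomputable def algorithmTime : Polynomial ℕ :=
  offsets.costPoly loopBound + prepare.costPoly loopBound + solve.costPoly loopBound + 22

end ForProg

open ForProg in
theorem mainTheorem1 :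
    ∃ (prog : RealRAM.Prog) (timeBound : Polynomial ℕ),
      ∀ (P : Set Point) (B : List (List Point)), IsOrthogonalPolygon P B →
        ∃ (final : RealRAM.State) (t : ℕ),
          RealRAM.Exec prog (RealRAM.inputState B) final t ∧
          t ≤ timeBound.eval (numVertices B) ∧
          (RealRAM.outputSegs final).Nodup ∧
          IsOptimalCover P (RealRAM.outputSegs final).toFinset := by
  refine ⟨algorithm, algorithmTime, fun P B h => ?_⟩
  have hB : ∀ c ∈ B, 4 ≤ c.length := fun c hc => (h.cycles c hc).four_le
  set n := numVertices B with hn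
  have hBn : B.length ≤ n := by
    simpa [hn, numVertices] using List.length_le_sum_of_one_le (B.map List.length) fun x hx => by
      obtain ⟨c, hc, rfl⟩ := List.mem_map.1 hx
      have := hB c hc; omega
  -- the positions of the cycles
  have s1 := Exec.setNat (inputState B) bnd (.lit 0) (.get 0 (.lit 0))
  set σ₁ := (inputState B).setNat bnd (NatExpr.eval (inputState B) (.lit 0))
    (NatExpr.eval (inputState B) (.get 0 (.lit 0))) with hσ₁
  have b1 : ∀ b, σ₁.nat bnd b = if b = 0 then B.length else 0 := by
    intro b; simp [hσ₁, inputState]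
  have z1 : ∀ k, k ≠ 0 → k ≠ 1 → k ≠ bnd → σ₁.nat k = 0 := by
    intro k h0 h1 h2; funext i; simp [hσ₁, inputState, h0, h1, h2]
  obtain ⟨t1, ht1, e1⟩ := exists_exec loopBound n offsets (by simp [offsets]) σ₁ (fun b => by
    rw [b1]; split_ifs with hb
    · simpa [loopBound, hb] using hBn
    · exact Nat.zero_le _)
  have o1 := offsets_spec (B := B) (σ := σ₁) (by rw [z1 _ (by decide) (by decide) (by decide)]; rfl)
    (by rw [b1]; rfl) (fun i hi => by simp [hσ₁, inputState, hi])
  have f1 := den_frame offsets (by simp [offsets]) σ₁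
  generalize offsets.den σ₁ = τ₁ at *
  -- the sorted coordinates
  have s2 := Exec.setNat τ₁ bnd (.lit 1) (.get aOffset (.get 0 (.lit 0)))
  set σ₂ := τ₁.setNat bnd (NatExpr.eval τ₁ (.lit 1))
    (NatExpr.eval τ₁ (.get aOffset (.get 0 (.lit 0)))) with hσ₂
  have ev2 : NatExpr.eval τ₁ (.get aOffset (.get 0 (.lit 0))) = n := by
    simp only [NatExpr.eval]
    rw [f1.nat 0 (by decide) (by simp [offsets]),
      show σ₁.nat 0 0 = B.length by simp [hσ₁, inputState], o1 _ le_rfl, offset_length]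
  have b2 : ∀ b, σ₂.nat bnd b = if b = 0 then B.length else if b = 1 then n else 0 := by
    intro b
    rw [hσ₂, ev2, nat_setNat, f1.nat bnd (by decide) (by simp [offsets]), b1]
    by_cases h1 : b = 1 <;> simp [h1]
  have k2 : ∀ k, k ≠ bnd → σ₂.nat k = τ₁.nat k := fun k hk => nat_setNat_of_ne _ _ _ hk
  have z2 : ∀ k, k ∉ [0, 1, 10, 11, 12] → σ₂.nat k = 0 := by
    intro k hk
    simp only [List.mem_cons, List.not_mem_nil, or_false, not_or] at hk
    rw [k2 k hk.2.2.1, f1.nat k hk.2.2.2.1 (by simp [offsets, hk]), z1 k hk.1 hk.2.1 hk.2.2.1]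
  have r2 : σ₂.real = (inputState B).real := by
    rw [hσ₂, real_setNat]
    funext k
    rw [f1.real k (by simp [offsets]), hσ₁, real_setNat]
  obtain ⟨t2, ht2, e2⟩ := exists_exec loopBound n prepare prepare_ok σ₂ (fun b => by
    rw [b2]; split_ifs with hb hb
    · simpa [loopBound, hb] using hBn
    · simp [loopBound, hb]
    · exact Nat.zero_le _)
  obtain ⟨p1, p2, p3, p4⟩ := prepare_spec (B := B) (σ := σ₂) hB (by rw [b2]; rfl)
    (by rw [b2]; simp [hn]) (fun i hi => by rw [k2 _ (by decide)]; exact o1 i hi)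
    (by rw [z2 _ (by decide)]; rfl)
  have f2 := den_frame prepare prepare_ok σ₂
  have w2 : ∀ k ∈ prepare.natWrites, k = 13 ∨ k = 14 := by
    simp [prepare, successors, sort, findMin, findNext, square]
  have x2 : ∀ k ∈ prepare.realWrites, k = 6 ∨ k = 7 := by
    simp [prepare, successors, sort, findMin, findNext, square]
  generalize prepare.den σ₂ = τ₂ at *
  -- the optimal cover
  have s3 := Exec.setNat τ₂ bnd (.lit 2) (.get aSize (.lit 0))
  set σ₃ := τ₂.setNat bnd (NatExpr.eval τ₂ (.lit 2)) (NatExpr.eval τ₂ (.get aSize (.lit 0)))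
    with hσ₃
  have s4 := Exec.setNat σ₃ bnd (.lit 3)
    (.add (.add (.get bnd (.lit 2)) (.get bnd (.lit 2))) (.lit 2))
  set σ₄ := σ₃.setNat bnd (NatExpr.eval σ₃ (.lit 3))
    (NatExpr.eval σ₃ (.add (.add (.get bnd (.lit 2)) (.get bnd (.lit 2))) (.lit 2))) with hσ₄
  have b3 : ∀ b, σ₃.nat bnd b = if b = 0 then B.length else if b = 1 then n else
      if b = 2 then n * n else 0 := by
    intro b
    rw [hσ₃, nat_setNat, f2.nat bnd (by decide) (fun hw => by have := w2 _ hw; omega), b2]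
    simp only [NatExpr.eval, true_and]
    by_cases h2 : b = 2
    · subst h2; simpa using p4
    · simp [h2]
  have b4 : ∀ b, σ₄.nat bnd b = if b = 0 then B.length else if b = 1 then n else
      if b = 2 then n * n else if b = 3 then 2 * (n * n) + 2 else 0 := by
    intro b
    rw [hσ₄, nat_setNat, b3]
    simp only [NatExpr.eval, true_and, b3]
    by_cases h3 : b = 3
    · subst h3; simp; ring
    · simp [h3]
  have k4 : ∀ k, k ≠ bnd → σ₄.nat k = τ₂.nat k := fun k hk =>
    (nat_setNat_of_ne _ _ _ hk).trans (nat_setNat_of_ne _ _ _ hk)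
  have z4 : ∀ k, k ∉ [0, 1, 10, 11, 12, 13, 14] → σ₄.nat k = 0 := by
    intro k hk
    simp only [List.mem_cons, List.not_mem_nil, or_false, not_or] at hk
    rw [k4 k (by omega), f2.nat k (by omega) (fun hw => by have := w2 _ hw; omega),
      z2 k (by simp; omega)]
  have r4 : ∀ k, k ≠ 6 → k ≠ 7 → σ₄.real k = (inputState B).real k := by
    intro k h6 h7
    rw [← r2]
    exact f2.real k fun hw => by have := x2 _ hw; omega
  obtain ⟨t3, ht3, e3⟩ := exists_exec loopBound n solve solve_ok σ₄ (fun b => by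
    rw [b4]; split_ifs with hb hb hb hb
    · simpa [loopBound, hb] using hBn
    · simp [loopBound, hb]
    · simp [loopBound, hb, sq]
    · simp [loopBound, hb, sq]
    · exact Nat.zero_le _)
  have hbdry := h.isBoundary p1
  have e0 : (fun a => (B.flatten.map Prod.fst).getD a 0) = (inputState B).real 0 := by
    funext a; simp [inputState]
  have e0' : (fun a => (B.flatten.map Prod.snd).getD a 0) = (inputState B).real 1 := by
    funext a; simp [inputState]
  rw [e0, e0', ← r4 0 (by decide) (by decide), ← r4 1 (by decide) (by decide),
    ← k4 aNext (by decide)] at hbdry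
  rw [r2, ← r4 0 (by decide) (by decide)] at p2
  rw [r2, ← r4 1 (by decide) (by decide)] at p3
  have hfin := solve_spec h.isCompact h.closure_interior (σ := σ₄) (N := n) (by rw [b4]; rfl)
    (by rw [b4]; rfl) (by rw [b4]; rfl) hbdry p2 p3
    (fun k hk => z4 k (by intro h; simp at h hk; omega))
    (fun k hk => by
      have h1 : k ≠ 0 ∧ k ≠ 1 ∧ k ≠ 6 ∧ k ≠ 7 := by simp at hk; omega
      rw [r4 k h1.2.2.1 h1.2.2.2]
      funext i
      simp [inputState, h1.1, h1.2.1])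
  refine ⟨_, _, Exec.seq s1 (Exec.seq e1 (Exec.seq s2 (Exec.seq e2 (Exec.seq s3
    (Exec.seq s4 e3))))), ?_, hfin⟩
  simp only [algorithmTime, Polynomial.eval_add, NatExpr.cost]
  have : Polynomial.eval n (22 : Polynomial ℕ) = 22 := Polynomial.eval_ofNat ..
  rw [this]
  omega
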